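/- Let $\hat C$ and $N$ be smooth connected projective curves over $\mathbb{C}$, let $\pi\colon \hat C\to N$ be a double cover (a finite morphism of degree $2$), and let $\tau$ be the corresponding involution of $\hat C$, so that $\tau^2=\mathrm{Id}$, $\tau\neq\mathrm{Id}$ and $\pi\circ\tau=\pi$. Suppose that the fixed (closed) points of $\tau$ are exactly the $2k$ distinct points $p_1,\dots,p_{2k}$, where $k>0$. Let $(\operatorname{Pic}\hat C)^\tau$ be the subgroup of all $L\in\operatorname{Pic}\hat C$ with $\tau^*L\cong L$. A linearization of a line bundle $L$ on $\hat C$ is an isomorphism $\varphi\colon\tau^*L\to L$ such that the composition $$L=(\tau^*)^2L\xrightarrow{\ \tau^*\varphi\ }\tau^*L\xrightarrow{\ \varphi\ }L$$ is the identity. Let $\mathrm{Id}=(1,\dots,1)\in\{\pm1\}^{2k}$, and let $d\colon\{\pm1\}^{2k}/(\pm\mathrm{Id})\to\{\pm1\}$ be the homomorphism induced by $(\epsilon_1,\dots,\epsilon_{2k})\mapsto\epsilon_1\cdots\epsilon_{2k}$. Every line bundle $L$ with $\tau^*L\cong L$ has a linearization $\varphi$; it is unique up to sign, and on the fibre $L_{p_i}$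 at each fixed point it acts as multiplication by a scalar $\varphi_{p_i}\in\{\pm1\}$. Setting $$\alpha(L)=\text{the class of }(\varphi_{p_1},\dots,\varphi_{p_{2k}})\in\{\pm1\}^{2k}/(\pm\mathrm{Id})$$ gives a well-defined map $\alpha\colon(\operatorname{Pic}\hat C)^\tau\to\{\pm1\}^{2k}/(\pm\mathrm{Id})$, and: 1. $\alpha$ is a surjective homomorphism; 2. $d(\alpha(L))=(-1)^{\deg L}$ for every $L\in(\operatorname{Pic}\hat C)^\tau$; 3. if $1\le i_1<\dots<i_\ell\le 2k$, then $\mathcal{O}_{\hat C}(p_{i_1}+\dots+p_{i_\ell})$ is $\tau$-invariant and $\alpha(\mathcal{O}_{\hat C}(p_{i_1}+\dots+p_{i_\ell}))$ is represented by $(\epsilon_1,\dots,\epsilon_{2k})$, where $\epsilon_i=-1$ if and only if $i=i_j$ for some $j$; 4. $\operatorname{Ker}\alpha=\pi^*\operatorname{Pic}N$. -/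

import Mathlib

open CategoryTheory AlgebraicGeometry TopologicalSpace

universe u

noncomputable section

namespace InvariantLineBundles

section Units

variable {X Y Z : Scheme.{u}}

/-- Restriction of invertible functions to a smaller open set. -/
def res {U V : X.Opens} (h : V ≤ U) : Γ(X, U)ˣ →* Γ(X, V)ˣ :=
  Units.map (X.presheaf.map (homOfLE h).op).hom.toMonoidHom

/-- Pullback of invertible functions along a morphism of schemes. -/
def pull (f : X ⟶ Y) {U : Y.Opens} {V : X.Opens} (h : V ≤ f ⁻¹ᵁ U) : Γ(Y, U)ˣ →* Γ(X, V)ˣ :=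
  Units.map (f.appLE U V h).hom.toMonoidHom

theorem res_res {U V W : X.Opens} (h : V ≤ U) (h' : W ≤ V) (a : Γ(X, U)ˣ) :
    res h' (res h a) = res (h'.trans h) a := by
  ext
  change (X.presheaf.map (homOfLE h).op ≫ X.presheaf.map (homOfLE h').op) (a : Γ(X, U)) = _
  rw [← Functor.map_comp]
  rfl

theorem res_pull (f : X ⟶ Y) {U : Y.Opens} {V W : X.Opens} (h : V ≤ f ⁻¹ᵁ U) (h' : W ≤ V)
    (a : Γ(Y, U)ˣ) : res h' (pull f h a) = pull f (h'.trans h) a := by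
  ext
  change (f.appLE U V h ≫ X.presheaf.map (homOfLE h').op) (a : Γ(Y, U)) = _
  rw [Scheme.Hom.appLE_map]
  rfl

theorem pull_res (f : X ⟶ Y) {U U' : Y.Opens} {V : X.Opens} (h : U' ≤ U) (h' : V ≤ f ⁻¹ᵁ U')
    (a : Γ(Y, U)ˣ) :
    pull f h' (res h a) = pull f (h'.trans (f.preimage_mono h)) a := by
  ext
  change (Y.presheaf.map (homOfLE h).op ≫ f.appLE U' V h') (a : Γ(Y, U)) = _
  rw [Scheme.Hom.map_appLE]
  rfl

theorem preimage_inf_le (f : X ⟶ Y) (U V : Y.Opens) : f ⁻¹ᵁ U ⊓ f ⁻¹ᵁ V ≤ f ⁻¹ᵁ (U ⊓ V) :=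
  fun _ h => h

end Units

/-- A line bundle on a scheme, given by local trivializations and transition functions.
For every point `x` there is an open neighbourhood `U x` of `x` with a nowhere vanishing section
`e x` of the bundle over `U x`, and on `U x ⊓ U y` these are related by `e y = g x y • e x`.
Thus a section of the bundle is a family of functions `s x` with `s x = g x y * s y`. -/
structure LineBundle (X : Scheme.{u}) where
  U : X → X.Opens
  mem_U : ∀ x, x ∈ U x
  g : ∀ x y, Γ(X, U x ⊓ U y)ˣ
  cocycle : ∀ x y z,
    res (V := U x ⊓ U y ⊓ U z) inf_le_left (g x y) *
        res (V := U x ⊓ U y ⊓ U z) (inf_le_inf_right _ inf_le_right) (g y z) =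
      res (V := U x ⊓ U y ⊓ U z) (inf_le_inf_right _ inf_le_left) (g x z)

namespace LineBundle

variable {X Y : Scheme.{u}}

theorem cocycle_of_le (L : LineBundle X) (x y z : X) {V : X.Opens} (hx : V ≤ L.U x)
    (hy : V ≤ L.U y) (hz : V ≤ L.U z) :
    res (le_inf hx hy) (L.g x y) * res (le_inf hy hz) (L.g y z) =
      res (le_inf hx hz) (L.g x z) := by
  have h := congrArg (res (le_inf (le_inf hx hy) hz)) (L.cocycle x y z)
  simpa only [map_mul, res_res] using h

/-- An isomorphism of line bundles, described in the given trivializations: near `x` it sends the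
generator `e x` of `L` to `h x` times the generator `e' x` of `M`, and these local descriptions
agree on overlaps. The neighbourhoods `W x` on which the local description is recorded may be
chosen arbitrarily small. -/
structure Iso (L M : LineBundle X) where
  W : X → X.Opens
  mem_W : ∀ x, x ∈ W x
  le_left : ∀ x, W x ≤ L.U x
  le_right : ∀ x, W x ≤ M.U x
  h : ∀ x, Γ(X, W x)ˣ
  comm : ∀ x y,
    res (inf_le_inf (le_left x) (le_left y)) (L.g x y) *
        res (V := W x ⊓ W y) inf_le_left (h x) =
      res (V := W x ⊓ W y) inf_le_right (h y) *
        res (inf_le_inf (le_right x) (le_right y)) (M.g x y)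

/-- Two descriptions define the same isomorphism of line bundles. -/
def Iso.Same {L M : LineBundle X} (φ ψ : Iso L M) : Prop :=
  ∀ x, res (V := φ.W x ⊓ ψ.W x) inf_le_left (φ.h x) =
    res (V := φ.W x ⊓ ψ.W x) inf_le_right (ψ.h x)

theorem res_neg {U V : X.Opens} (h : V ≤ U) (a : Γ(X, U)ˣ) : res h (-a) = -res h a := by
  ext
  exact map_neg (X.presheaf.map (homOfLE h).op).hom (a : Γ(X, U))

/-- The isomorphism `-φ`. -/
def Iso.neg {L M : LineBundle X} (φ : Iso L M) : Iso L M where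
  W := φ.W
  mem_W := φ.mem_W
  le_left := φ.le_left
  le_right := φ.le_right
  h x := -φ.h x
  comm x y := by
    rw [res_neg, res_neg, mul_neg, neg_mul, φ.comm x y]

/-- The trivial line bundle `𝒪_X`. -/
def trivial (X : Scheme.{u}) : LineBundle X where
  U _ := ⊤
  mem_U _ := Opens.mem_top _
  g _ _ := 1
  cocycle _ _ _ := by simp only [map_one, mul_one]

/-- The tensor product: transition functions are multiplied. -/
def tensor (L M : LineBundle X) : LineBundle X where
  U x := L.U x ⊓ M.U x
  mem_U x := ⟨L.mem_U x, M.mem_U x⟩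
  g x y := res (inf_le_inf inf_le_left inf_le_left) (L.g x y) *
    res (inf_le_inf inf_le_right inf_le_right) (M.g x y)
  cocycle x y z := by
    simp only [map_mul, res_res]
    rw [mul_mul_mul_comm]
    congr 1
    · apply L.cocycle_of_le x y z
      · exact (inf_le_left.trans inf_le_left).trans inf_le_left
      · exact (inf_le_left.trans inf_le_right).trans inf_le_left
      · exact inf_le_right.trans inf_le_left
    · apply M.cocycle_of_le x y z
      · exact (inf_le_left.trans inf_le_left).trans inf_le_right
      · exact (inf_le_left.trans inf_le_right).trans inf_le_right
      · exact inf_le_right.trans inf_le_right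

/-- The dual line bundle: transition functions are inverted. -/
def dual (L : LineBundle X) : LineBundle X where
  U := L.U
  mem_U := L.mem_U
  g x y := (L.g x y)⁻¹
  cocycle x y z := by
    simp only [map_inv]
    rw [← mul_inv, L.cocycle x y z]

/-- The pullback `f^* L`: transition functions are pulled back. -/
def pullback (f : X ⟶ Y) (L : LineBundle Y) : LineBundle X where
  U x := f ⁻¹ᵁ L.U (f x)
  mem_U x := L.mem_U (f x)
  g x y := pull f (U := L.U (f x) ⊓ L.U (f y)) (preimage_inf_le f _ _)
    (L.g (f x) (f y))
  cocycle x y z := by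
    have h := congrArg (pull f (U := L.U (f x) ⊓ L.U (f y) ⊓ L.U (f z))
      ((inf_le_inf_right _ (preimage_inf_le f _ _)).trans (preimage_inf_le f _ _)))
      (L.cocycle (f x) (f y) (f z))
    rw [map_mul, pull_res, pull_res, pull_res] at h
    rw [res_pull, res_pull, res_pull]
    exact h

theorem res_trivial {x y : X} {V : X.Opens} (h : V ≤ (trivial X).U x ⊓ (trivial X).U y) :
    res h ((trivial X).g x y) = 1 :=
  map_one (res h)

theorem res_tensor (L M : LineBundle X) {x y : X} {V : X.Opens}
    (h : V ≤ (L.tensor M).U x ⊓ (L.tensor M).U y) :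
    res h ((L.tensor M).g x y) =
      res (h.trans (inf_le_inf inf_le_left inf_le_left)) (L.g x y) *
        res (h.trans (inf_le_inf inf_le_right inf_le_right)) (M.g x y) := by
  refine (map_mul (res h) _ _).trans ?_
  exact congrArg₂ (· * ·) (res_res _ _ _) (res_res _ _ _)

theorem res_dual (L : LineBundle X) {x y : X} {V : X.Opens} (h : V ≤ L.dual.U x ⊓ L.dual.U y) :
    res h (L.dual.g x y) = (res (U := L.U x ⊓ L.U y) h (L.g x y))⁻¹ :=
  map_inv (res (U := L.U x ⊓ L.U y) h) (L.g x y)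

theorem res_pullback (f : X ⟶ Y) (L : LineBundle Y) {x y : X} {V : X.Opens}
    (h : V ≤ (L.pullback f).U x ⊓ (L.pullback f).U y) :
    res h ((L.pullback f).g x y) =
      pull f (h.trans (preimage_inf_le f _ _)) (L.g (f x) (f y)) :=
  res_pull f _ _ _

namespace Iso

/-- A family of invertible functions that is the identity in coinciding local trivializations. -/
def ofEq {L M : LineBundle X}
    (h : ∀ x y, res (V := (L.U x ⊓ M.U x) ⊓ (L.U y ⊓ M.U y)) (inf_le_inf inf_le_left inf_le_left)
      (L.g x y) = res (inf_le_inf inf_le_right inf_le_right) (M.g x y)) : Iso L M where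
  W x := L.U x ⊓ M.U x
  mem_W x := ⟨L.mem_U x, M.mem_U x⟩
  le_left _ := inf_le_left
  le_right _ := inf_le_right
  h _ := 1
  comm x y := by
    rw [map_one, map_one, mul_one, one_mul]
    exact h x y

/-- The identity. -/
def refl (L : LineBundle X) : Iso L L := ofEq fun _ _ => rfl

/-- The inverse isomorphism. -/
def symm {L M : LineBundle X} (φ : Iso L M) : Iso M L where
  W := φ.W
  mem_W := φ.mem_W
  le_left := φ.le_right
  le_right := φ.le_left
  h x := (φ.h x)⁻¹
  comm x y := by
    have h := φ.comm x y
    rw [map_inv, map_inv, mul_inv_eq_iff_eq_mul, mul_assoc, eq_inv_mul_iff_mul_eq]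
    exact h.symm

/-- Composition of isomorphisms. -/
def trans {L M P : LineBundle X} (φ : Iso L M) (ψ : Iso M P) : Iso L P where
  W x := φ.W x ⊓ ψ.W x
  mem_W x := ⟨φ.mem_W x, ψ.mem_W x⟩
  le_left x := inf_le_left.trans (φ.le_left x)
  le_right x := inf_le_right.trans (ψ.le_right x)
  h x := res inf_le_left (φ.h x) * res inf_le_right (ψ.h x)
  comm x y := by
    have h₁ := congrArg (res (V := (φ.W x ⊓ ψ.W x) ⊓ (φ.W y ⊓ ψ.W y))
      (inf_le_inf inf_le_left inf_le_left)) (φ.comm x y)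
    have h₂ := congrArg (res (V := (φ.W x ⊓ ψ.W x) ⊓ (φ.W y ⊓ ψ.W y))
      (inf_le_inf inf_le_right inf_le_right)) (ψ.comm x y)
    simp only [map_mul, res_res] at h₁ h₂ ⊢
    rw [← mul_assoc, h₁, mul_assoc, h₂, mul_assoc]

/-- The tensor product of isomorphisms. -/
def tensor {L L' M M' : LineBundle X} (φ : Iso L L') (ψ : Iso M M') :
    Iso (L.tensor M) (L'.tensor M') where
  W x := φ.W x ⊓ ψ.W x
  mem_W x := ⟨φ.mem_W x, ψ.mem_W x⟩
  le_left x := inf_le_inf (φ.le_left x) (ψ.le_left x)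
  le_right x := inf_le_inf (φ.le_right x) (ψ.le_right x)
  h x := res inf_le_left (φ.h x) * res inf_le_right (ψ.h x)
  comm x y := by
    have h₁ := congrArg (res (V := (φ.W x ⊓ ψ.W x) ⊓ (φ.W y ⊓ ψ.W y))
      (inf_le_inf inf_le_left inf_le_left)) (φ.comm x y)
    have h₂ := congrArg (res (V := (φ.W x ⊓ ψ.W x) ⊓ (φ.W y ⊓ ψ.W y))
      (inf_le_inf inf_le_right inf_le_right)) (ψ.comm x y)
    simp only [map_mul, res_res] at h₁ h₂ ⊢
    rw [res_tensor, res_tensor, mul_mul_mul_comm, h₁, h₂, mul_mul_mul_comm]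

/-- The dual isomorphism, in the direction of the original one. -/
def dual {L M : LineBundle X} (φ : Iso L M) : Iso L.dual M.dual where
  W := φ.W
  mem_W := φ.mem_W
  le_left := φ.le_left
  le_right := φ.le_right
  h x := (φ.h x)⁻¹
  comm x y := by
    rw [res_dual, res_dual, map_inv, map_inv, ← mul_inv, ← mul_inv]
    exact congrArg (·⁻¹) (φ.comm x y)

/-- The pullback of an isomorphism. -/
def pullback (f : X ⟶ Y) {L M : LineBundle Y} (φ : Iso L M) :
    Iso (L.pullback f) (M.pullback f) where
  W x := f ⁻¹ᵁ φ.W (f x)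
  mem_W x := φ.mem_W (f x)
  le_left x := f.preimage_mono (φ.le_left (f x))
  le_right x := f.preimage_mono (φ.le_right (f x))
  h x := pull f le_rfl (φ.h (f x))
  comm x y := by
    have h := congrArg (pull f (U := φ.W (f x) ⊓ φ.W (f y))
      (preimage_inf_le f _ _)) (φ.comm (f x) (f y))
    rw [map_mul, map_mul, pull_res, pull_res, pull_res, pull_res] at h
    rw [res_pullback, res_pullback, res_pull, res_pull]
    exact h

end Iso

/-- Line bundles up to isomorphism. -/
instance setoid (X : Scheme.{u}) : Setoid (LineBundle X) where
  r L M := Nonempty (Iso L M)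
  iseqv :=
    { refl := fun L => ⟨Iso.refl L⟩
      symm := fun ⟨φ⟩ => ⟨φ.symm⟩
      trans := fun ⟨φ⟩ ⟨ψ⟩ => ⟨φ.trans ψ⟩ }

end LineBundle

/-- The Picard group: isomorphism classes of line bundles, under the tensor product. -/
def Pic (X : Scheme.{u}) : Type u := Quotient (LineBundle.setoid X)

namespace Pic

open LineBundle

variable {X Y : Scheme.{u}}

/-- The class of a line bundle. -/
def mk (L : LineBundle X) : Pic X := Quotient.mk _ L

instance : CommGroup (Pic X) where
  mul := Quotient.map₂ LineBundle.tensor fun _ _ ⟨φ⟩ _ _ ⟨ψ⟩ => ⟨φ.tensor ψ⟩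
  one := mk (LineBundle.trivial X)
  inv := Quotient.map LineBundle.dual fun _ _ ⟨φ⟩ => ⟨φ.dual⟩
  mul_assoc := by
    rintro ⟨L⟩ ⟨M⟩ ⟨P⟩
    refine Quotient.sound ⟨Iso.ofEq fun x y => ?_⟩
    simp only [res_tensor, mul_assoc]
  one_mul := by
    rintro ⟨L⟩
    refine Quotient.sound ⟨Iso.ofEq fun x y => ?_⟩
    rw [res_tensor, res_trivial, one_mul]
  mul_one := by
    rintro ⟨L⟩
    refine Quotient.sound ⟨Iso.ofEq fun x y => ?_⟩
    rw [res_tensor, res_trivial, mul_one]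
  inv_mul_cancel := by
    rintro ⟨L⟩
    refine Quotient.sound ⟨Iso.ofEq fun x y => ?_⟩
    rw [res_tensor, res_trivial, res_dual]
    exact inv_mul_cancel _
  mul_comm := by
    rintro ⟨L⟩ ⟨M⟩
    refine Quotient.sound ⟨Iso.ofEq fun x y => ?_⟩
    rw [res_tensor, res_tensor, mul_comm]

/-- The pullback homomorphism `f^* : Pic Y → Pic X`. -/
def pullback (f : X ⟶ Y) : Pic Y →* Pic X :=
  MonoidHom.mk' (Quotient.map (LineBundle.pullback f) fun _ _ ⟨φ⟩ => ⟨φ.pullback f⟩) (by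
    rintro ⟨L⟩ ⟨M⟩
    refine Quotient.sound ⟨Iso.ofEq fun x y => ?_⟩
    rw [res_pullback, res_tensor, res_pullback, res_pullback]
    refine (map_mul (pull f _) _ _).trans ?_
    exact congrArg₂ (· * ·) (pull_res _ _ _ _) (pull_res _ _ _ _))

/-- The subgroup `(Pic X)^τ` of classes `L` with `τ^* L = L`. -/
def invariants (τ : X ⟶ X) : Subgroup (Pic X) :=
  (pullback τ).eqLocus (MonoidHom.id _)

end Pic

/-- A linearization of `L` with respect to an involution `τ`: an isomorphism `φ : τ^* L → L` such
that the composition `L = τ^* τ^* L → τ^* L → L` of `τ^* φ` and `φ` is the identity. -/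
structure Linearization {X : Scheme.{u}} (τ : X ⟶ X) (L : LineBundle X) extends
    LineBundle.Iso (L.pullback τ) L where
  sq_eq_one : ∀ x,
    pull τ (V := W x ⊓ τ ⁻¹ᵁ W (τ x)) inf_le_right (h (τ x)) * res inf_le_left (h x) = 1

/-- For a fixed point `x` of `τ`, the scalar by which a linearization acts on the fibre
`L_x = L_{τ x} = (τ^* L)_x`. The trivialization of `τ^* L` near `x` is the pullback of the one
of `L` near `τ x = x`, so that both fibres carry the same basis vector. -/
def Linearization.fibreScalar {X : Scheme.{u}} {τ : X ⟶ X} {L : LineBundle X}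
    (φ : Linearization τ L) (x : X) : X.residueField x :=
  X.evaluation (φ.W x) x (φ.mem_W x) (φ.h x : Γ(X, φ.W x))

open Classical in
/-- The divisor `1 · x`. -/
def pointDivisor {X : Scheme.{u}} (x : X) : X → ℤ := Pi.single x 1

section Divisors

variable {X : Scheme.{u}} [IsIntegral X]

theorem genericPoint_mem {U : X.Opens} {x : X} (hx : x ∈ U) : genericPoint X ∈ U :=
  ((genericPoint_spec X).mem_open_set_iff U.isOpen).mpr ⟨x, Set.mem_univ _, hx⟩

/-- A nonzero rational section of a line bundle: in the trivialization around `x` it is the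
rational function `s x`, so that `s x = g x y * s y`. -/
structure RationalSection (L : LineBundle X) where
  s : X → X.functionField
  ne_zero : ∀ x, s x ≠ 0
  eq_mul : ∀ x y, s x =
    X.presheaf.germ (L.U x ⊓ L.U y) (genericPoint X)
      ⟨genericPoint_mem (L.mem_U x), genericPoint_mem (L.mem_U y)⟩ (L.g x y : Γ(X, _)) * s y

variable [IsLocallyNoetherian X]

/-- The divisor of a rational section: its order of vanishing at every point of codimension one
(and `0` at all other points). -/
def RationalSection.divisor {L : LineBundle X} (σ : RationalSection L) (x : X) : ℤ :=
  Scheme.ord (σ.s x) x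

/-- `c` is the class of `𝒪_X(D)`, that is, of a line bundle with a rational section whose divisor
is `D`. -/
def Pic.IsClassOfDivisor (c : Pic X) (D : X → ℤ) : Prop :=
  ∃ (L : LineBundle X) (σ : RationalSection L), Pic.mk L = c ∧ σ.divisor = D

/-- `c` has degree `n`: some line bundle of class `c` has a nonzero rational section whose divisor
has degree `n`. (On a curve over an algebraically closed field, all closed points have degree
one.) -/
def Pic.HasDegree (c : Pic X) (n : ℤ) : Prop :=
  ∃ (L : LineBundle X) (σ : RationalSection L), Pic.mk L = c ∧
    (Function.support σ.divisor).Finite ∧ ∑ᶠ x, σ.divisor x = n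

end Divisors

/-- A smooth connected projective curve over `ℂ`. (A smooth connected scheme over a field is
integral, and proper curves are projective.) -/
structure SmoothCurve where
  scheme : Scheme.{0}
  structureMap : scheme ⟶ Spec (.of ℂ)
  isIntegral : IsIntegral scheme
  isProper : IsProper structureMap
  smooth : SmoothOfRelativeDimension 1 structureMap

namespace SmoothCurve

attribute [instance] isIntegral isProper smooth

instance (C : SmoothCurve) : IsLocallyNoetherian C.scheme :=
  LocallyOfFiniteType.isLocallyNoetherian C.structureMap

end SmoothCurve

/-- A double cover `π : C → N` of smooth connected projective curves over `ℂ` (a finite flat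
morphism of degree two), together with its covering involution `τ`. -/
structure DoubleCover (C N : SmoothCurve) where
  π : C.scheme ⟶ N.scheme
  π_comp : π ≫ N.structureMap = C.structureMap
  isFinite : IsFinite π
  flat : Flat π
  degree_eq_two : ∀ y, π.finrank y = 2
  τ : C.scheme ⟶ C.scheme
  τ_comp_τ : τ ≫ τ = 𝟙 _
  τ_ne_id : τ ≠ 𝟙 _
  τ_comp_π : τ ≫ π = π

/-- The group `{±1}^n / (± Id)`. -/
abbrev SignQuotient (n : ℕ) : Type :=
  (Fin n → ℤˣ) ⧸ Subgroup.zpowers (fun _ : Fin n => (-1 : ℤˣ))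

/-- The class of a vector of signs. -/
def SignQuotient.mk {n : ℕ} (ε : Fin n → ℤˣ) : SignQuotient n := QuotientGroup.mk ε

/-- The homomorphism `(ε₁, …, ε₂ₖ) ↦ ε₁ ⋯ ε₂ₖ` on `{±1}^{2k}`. -/
def signProd (n : ℕ) : (Fin n → ℤˣ) →* ℤˣ where
  toFun ε := ∏ i, ε i
  map_one' := by simp
  map_mul' ε δ := by simp [Finset.prod_mul_distrib]

/-- The homomorphism `d` induced by the product of signs on `{±1}^{2k} / (± Id)`. -/
def SignQuotient.d (k : ℕ) : SignQuotient (2 * k) →* ℤˣ :=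
  QuotientGroup.lift _ (signProd (2 * k)) (by
    intro ε hε
    obtain ⟨m, rfl⟩ := Subgroup.mem_zpowers_iff.mp hε
    rw [MonoidHom.mem_ker, map_zpow]
    have : signProd (2 * k) (fun _ => (-1 : ℤˣ)) = 1 := by
      simp [signProd]
    rw [this, one_zpow])

end InvariantLineBundles

end

/-! Since the curve is integral, a line bundle is determined by the local equations `s x` of a
nonzero rational section, and everything is computed in the function field K of Ĉ, on which τ acts.
Isomorphisms of bundles become rational functions (`LineBundle.Iso.nonempty_iff`), and a
linearization becomes a function f with f · τ(f) = 1 (`Linearization.exists_fun`).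

An isomorphism τ*L ≅ L gives an f for which f · τ(f) has no zeros or poles. It is therefore a
constant, and dividing f by a square root of it produces a linearization. Two linearizations differ
by a constant of square 1. By Hilbert 90 (`exists_eq_div_inv`), f = b/τ(b), so a suitable rational
section ρ is fixed by φ and its divisor D is τ-invariant. Conversely, every invariant divisor gives
a linearization. At a fixed point there is a uniformizer w with τ(w) = -w, so the scalar of φ there
is (-1)^ord(ρ) (`fibreScalar_eq`). Thus α(L) records the parities at the fixed points of an
invariant divisor representing L.

Two such divisors of one class differ by div f with f/τ(f) = ±1, and the sign determines the parity
of ord(f) at all fixed points at once (`IsSignVector.eq_or_eq_neg`). So α is well defined, and it is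
a homomorphism because divisors add. Sums of fixed points give its values in claim 3 and its
surjectivity. In the degree of D, points not fixed by τ contribute in equal pairs, which gives d ∘
α. That the degree depends only on the class requires deg(div f) = 0: zeros and poles of f are both
counted by [K : ℂ(f)] (`finsum_max_ord_eq_finrank`).

For the kernel, pulled-back local equations are τ-invariant and so have even order at the fixed
points. Conversely, if D is invariant and even there, it is locally the divisor of a norm s · τ(s).
Norms come from N (`exists_emb_eq`) and the fibres of π are τ-orbits (`eq_or_eq_τ_of_π_eq`), so
these norms are local equations on N of a bundle that pulls back to L. -/

noncomputable section

namespace InvariantLineBundles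

/-! ### Rational functions: behaviour at a point and pullback. -/

section FunctionField

variable {X Y Z : Scheme.{u}} [IsIntegral X] [IsIntegral Y] [IsIntegral Z]

/-- The rational function defined by an invertible function. -/
def unitToFun {U : X.Opens} (hU : genericPoint X ∈ U) : Γ(X, U)ˣ →* X.functionField :=
  (X.presheaf.germ U (genericPoint X) hU).hom.toMonoidHom.comp (Units.coeHom _)

theorem unitToFun_apply {U : X.Opens} (hU : genericPoint X ∈ U) (u : Γ(X, U)ˣ) :
    unitToFun hU u = X.presheaf.germ U (genericPoint X) hU (u : Γ(X, U)) := rfl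

theorem unitToFun_injective {U : X.Opens} (hU : genericPoint X ∈ U) :
    Function.Injective (unitToFun hU) := fun _ _ h =>
  Units.ext (germ_injective_of_isIntegral X _ hU h)

theorem unitToFun_ne_zero {U : X.Opens} (hU : genericPoint X ∈ U) (u : Γ(X, U)ˣ) :
    unitToFun hU u ≠ 0 :=
  ((u.isUnit).map (X.presheaf.germ U (genericPoint X) hU).hom).ne_zero

@[simp]
theorem unitToFun_res {U V : X.Opens} (h : V ≤ U) (hV : genericPoint X ∈ V) (u : Γ(X, U)ˣ) :
    unitToFun hV (res h u) = unitToFun (h hV) u := by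
  exact X.presheaf.germ_res_apply (homOfLE h) _ hV (u : Γ(X, U))

/-- The rational function `f` is regular at `x`. -/
def RegularAt (x : X) (f : X.functionField) : Prop :=
  ∃ a : X.presheaf.stalk x, algebraMap _ X.functionField a = f

/-- The rational function `f` is regular and invertible at `x`. -/
def UnitAt (x : X) (f : X.functionField) : Prop :=
  ∃ a : X.presheaf.stalk x, IsUnit a ∧ algebraMap _ X.functionField a = f

/-- The rational function `f` is regular at `x` and vanishes there. -/
def VanishesAt (x : X) (f : X.functionField) : Prop :=
  ∃ a : X.presheaf.stalk x, a ∈ IsLocalRing.maximalIdeal _ ∧ algebraMap _ X.functionField a = f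

theorem stalk_injective (x : X) :
    Function.Injective (algebraMap (X.presheaf.stalk x) X.functionField) :=
  IsFractionRing.injective _ _

theorem algebraMap_germ {U : X.Opens} {x : X} (hx : x ∈ U) (f : Γ(X, U)) :
    algebraMap (X.presheaf.stalk x) X.functionField (X.presheaf.germ U x hx f) =
      X.presheaf.germ U (genericPoint X) (genericPoint_mem hx) f := by
  have : Nonempty U := ⟨⟨x, hx⟩⟩
  exact Scheme.algebraMap_germ_eq_germToFunctionField X hx f

namespace UnitAt

variable {x : X} {f g : X.functionField}

theorem ne_zero (h : UnitAt x f) : f ≠ 0 := by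
  obtain ⟨a, ha, rfl⟩ := h
  exact (ha.map _).ne_zero

theorem mul (hf : UnitAt x f) (hg : UnitAt x g) : UnitAt x (f * g) := by
  obtain ⟨a, ha, rfl⟩ := hf
  obtain ⟨b, hb, rfl⟩ := hg
  exact ⟨a * b, ha.mul hb, map_mul _ _ _⟩

theorem inv (hf : UnitAt x f) : UnitAt x f⁻¹ := by
  obtain ⟨a, ⟨u, rfl⟩, rfl⟩ := hf
  refine ⟨_, (u⁻¹).isUnit, eq_inv_of_mul_eq_one_left ?_⟩
  rw [← map_mul, Units.inv_mul, map_one]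

theorem div (hf : UnitAt x f) (hg : UnitAt x g) : UnitAt x (f / g) := by
  rw [div_eq_mul_inv]
  exact hf.mul hg.inv

theorem one : UnitAt x (1 : X.functionField) := ⟨1, isUnit_one, map_one _⟩

theorem neg (hf : UnitAt x f) : UnitAt x (-f) := by
  obtain ⟨a, ha, rfl⟩ := hf
  exact ⟨-a, ha.neg, map_neg _ _⟩

theorem regularAt (hf : UnitAt x f) : RegularAt x f := by
  obtain ⟨a, ha, rfl⟩ := hf
  exact ⟨a, rfl⟩

theorem pow (hf : UnitAt x f) (n : ℕ) : UnitAt x (f ^ n) := by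
  obtain ⟨a, ha, rfl⟩ := hf
  exact ⟨a ^ n, ha.pow n, map_pow _ _ _⟩

theorem zpow (hf : UnitAt x f) (n : ℤ) : UnitAt x (f ^ n) := by
  obtain n | n := n
  · simpa using hf.pow n
  · simpa using (hf.pow (n + 1)).inv

end UnitAt

theorem VanishesAt.regularAt {x : X} {f : X.functionField} (hf : VanishesAt x f) :
    RegularAt x f := by
  obtain ⟨a, ha, rfl⟩ := hf
  exact ⟨a, rfl⟩

theorem VanishesAt.not_unitAt {x : X} {f : X.functionField} (hf : VanishesAt x f) :
    ¬ UnitAt x f := by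
  obtain ⟨a, ha, rfl⟩ := hf
  rintro ⟨b, hb, h⟩
  rw [stalk_injective x h] at hb
  exact ha hb

theorem VanishesAt.zero (x : X) : VanishesAt x (0 : X.functionField) :=
  ⟨0, zero_mem _, map_zero _⟩

theorem VanishesAt.add {x : X} {f g : X.functionField} (hf : VanishesAt x f)
    (hg : VanishesAt x g) : VanishesAt x (f + g) := by
  obtain ⟨a, ha, rfl⟩ := hf
  obtain ⟨b, hb, rfl⟩ := hg
  exact ⟨a + b, add_mem ha hb, map_add _ _ _⟩

theorem VanishesAt.neg {x : X} {f : X.functionField} (hf : VanishesAt x f) :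
    VanishesAt x (-f) := by
  obtain ⟨a, ha, rfl⟩ := hf
  exact ⟨-a, neg_mem ha, map_neg _ _⟩

theorem VanishesAt.mul_regular {x : X} {f g : X.functionField} (hf : VanishesAt x f)
    (hg : RegularAt x g) : VanishesAt x (f * g) := by
  obtain ⟨a, ha, rfl⟩ := hf
  obtain ⟨b, rfl⟩ := hg
  exact ⟨a * b, Ideal.mul_mem_right _ _ ha, map_mul _ _ _⟩

theorem RegularAt.mul {x : X} {f g : X.functionField} (hf : RegularAt x f)
    (hg : RegularAt x g) : RegularAt x (f * g) := by
  obtain ⟨a, rfl⟩ := hf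
  obtain ⟨b, rfl⟩ := hg
  exact ⟨a * b, map_mul _ _ _⟩

theorem RegularAt.add {x : X} {f g : X.functionField} (hf : RegularAt x f)
    (hg : RegularAt x g) : RegularAt x (f + g) := by
  obtain ⟨a, rfl⟩ := hf
  obtain ⟨b, rfl⟩ := hg
  exact ⟨a + b, map_add _ _ _⟩

theorem RegularAt.neg {x : X} {f : X.functionField} (hf : RegularAt x f) : RegularAt x (-f) := by
  obtain ⟨a, rfl⟩ := hf
  exact ⟨-a, map_neg _ _⟩

theorem RegularAt.unitAt_or_vanishesAt {x : X} {f : X.functionField} (hf : RegularAt x f) :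
    UnitAt x f ∨ VanishesAt x f := by
  obtain ⟨a, rfl⟩ := hf
  by_cases ha : IsUnit a
  · exact .inl ⟨a, ha, rfl⟩
  · exact .inr ⟨a, ha, rfl⟩

theorem UnitAt.add_vanishesAt {x : X} {f g : X.functionField} (hf : UnitAt x f)
    (hg : VanishesAt x g) : UnitAt x (f + g) := by
  refine ((hf.regularAt.add hg.regularAt).unitAt_or_vanishesAt).resolve_right fun h => ?_
  have := h.add hg.neg
  rw [add_neg_cancel_right] at this
  exact this.not_unitAt hf

/-- The stalk at the generic point is the function field itself. Conditions imposed at all points x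
therefore need no exception for the generic point. -/
theorem unitAt_genericPoint {f : X.functionField} (hf : f ≠ 0) : UnitAt (genericPoint X) f := by
  refine ⟨f, isUnit_iff_ne_zero.mpr hf, ?_⟩
  change X.presheaf.stalkSpecializes _ f = f
  rw [TopCat.Presheaf.stalkSpecializes_refl]
  rfl

theorem unitAt_unitToFun {U : X.Opens} {x : X} (hx : x ∈ U) (u : Γ(X, U)ˣ) :
    UnitAt x (unitToFun (genericPoint_mem hx) u) :=
  ⟨X.presheaf.germ U x hx u, u.isUnit.map (X.presheaf.germ U x hx).hom, algebraMap_germ hx _⟩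

theorem UnitAt.exists_unit {x : X} {f : X.functionField} (hf : UnitAt x f) {V : X.Opens}
    (hV : x ∈ V) : ∃ (U : X.Opens) (hx : x ∈ U) (u : Γ(X, U)ˣ), U ≤ V ∧
      unitToFun (genericPoint_mem hx) u = f := by
  obtain ⟨a, ha, rfl⟩ := hf
  obtain ⟨U, hU, s, rfl⟩ := X.presheaf.exists_germ_eq a
  have hb : x ∈ X.basicOpen s := (X.mem_basicOpen s x hU).mpr ha
  have hs : IsUnit (X.presheaf.map (homOfLE (X.basicOpen_le s)).op s) :=
    X.toRingedSpace.isUnit_res_basicOpen s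
  obtain ⟨u, hu⟩ := hs
  refine ⟨X.basicOpen s ⊓ V, ⟨hb, hV⟩, res inf_le_left u, inf_le_right, ?_⟩
  rw [unitToFun_res, unitToFun_apply, hu, algebraMap_germ]
  exact X.presheaf.germ_res_apply _ _ _ _

/-- Local representatives of f have the same germ at the generic point, and germs there are
injective on an integral scheme. So the representatives agree on overlaps and glue. -/
theorem exists_section_of_forall_regularAt {U : X.Opens} (hU : genericPoint X ∈ U)
    {f : X.functionField} (hf : ∀ x ∈ U, RegularAt x f) :
    ∃ s : Γ(X, U), X.presheaf.germ U (genericPoint X) hU s = f := by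
  have key : ∀ x : U, ∃ (V : X.Opens) (_ : (x : X) ∈ V) (_ : V ≤ U) (s : Γ(X, V)),
      ∀ hη, X.presheaf.germ V (genericPoint X) hη s = f := by
    rintro ⟨x, hx⟩
    obtain ⟨a, rfl⟩ := hf x hx
    obtain ⟨V, hV, s, rfl⟩ := X.presheaf.exists_germ_eq a
    refine ⟨V ⊓ U, ⟨hV, hx⟩, inf_le_right, X.presheaf.map (homOfLE inf_le_left).op s, ?_⟩
    intro hη
    rw [algebraMap_germ]
    exact X.presheaf.germ_res_apply _ _ _ _
  choose V hxV hVU s hs using key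
  obtain ⟨t, ht, -⟩ := X.sheaf.existsUnique_gluing' V U (fun x => homOfLE (hVU x))
    (fun x hx => Opens.mem_iSup.mpr ⟨⟨x, hx⟩, hxV ⟨x, hx⟩⟩) s (by
      intro x y
      have hη : genericPoint X ∈ V x ⊓ V y :=
        ⟨genericPoint_mem (hxV x), genericPoint_mem (hxV y)⟩
      apply germ_injective_of_isIntegral X _ hη
      trans f
      · exact (X.presheaf.germ_res_apply _ _ _ _).trans (hs x _)
      · exact ((X.presheaf.germ_res_apply _ _ _ _).trans (hs y _)).symm)
  refine ⟨t, ?_⟩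
  rw [← hs ⟨_, hU⟩ (hxV ⟨_, hU⟩), ← ht ⟨_, hU⟩]
  exact (X.presheaf.germ_res_apply _ _ _ _).symm

theorem exists_unit_of_forall_unitAt {U : X.Opens} (hU : genericPoint X ∈ U)
    {f : X.functionField} (hf : ∀ x ∈ U, UnitAt x f) : ∃ u : Γ(X, U)ˣ, unitToFun hU u = f := by
  obtain ⟨s, hs⟩ := exists_section_of_forall_regularAt hU fun x hx => (hf x hx).regularAt
  obtain ⟨t, ht⟩ := exists_section_of_forall_regularAt hU fun x hx => (hf x hx).inv.regularAt
  have h : s * t = 1 := by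
    apply germ_injective_of_isIntegral X _ hU
    rw [map_mul, map_one, hs, ht]
    exact mul_inv_cancel₀ (hf _ hU).ne_zero
  exact ⟨⟨s, t, h, by rw [mul_comm, h]⟩, hs⟩

/-- The homomorphism of function fields given by a dominant morphism. -/
def funMap (f : X ⟶ Y) (hf : f (genericPoint X) = genericPoint Y) :
    Y.functionField →+* X.functionField :=
  -- The two generic points are only propositionally equal, so a specialization map identifies the
  -- stalks.
  (Y.presheaf.stalkSpecializes (specializes_of_eq hf) ≫ f.stalkMap (genericPoint X)).hom

theorem funMap_algebraMap (f : X ⟶ Y) (hf : f (genericPoint X) = genericPoint Y) (x : X)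
    (a : Y.presheaf.stalk (f x)) : funMap f hf (algebraMap _ _ a) =
      algebraMap (X.presheaf.stalk x) X.functionField (f.stalkMap x a) := by
  change (Y.presheaf.stalkSpecializes _ ≫ Y.presheaf.stalkSpecializes _ ≫ f.stalkMap _) a =
    (f.stalkMap x ≫ X.presheaf.stalkSpecializes _) a
  rw [TopCat.Presheaf.stalkSpecializes_comp_assoc]
  rw [Scheme.Hom.stalkSpecializes_stalkMap]

theorem funMap_germ (f : X ⟶ Y) (hf : f (genericPoint X) = genericPoint Y) {U : Y.Opens}
    (hU : genericPoint Y ∈ U) {V : X.Opens} (h : V ≤ f ⁻¹ᵁ U) (hV : genericPoint X ∈ V)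
    (s : Γ(Y, U)) : funMap f hf (Y.presheaf.germ U _ hU s) =
      X.presheaf.germ V _ hV (f.appLE U V h s) := by
  change (Y.presheaf.germ U _ hU ≫ Y.presheaf.stalkSpecializes _ ≫ f.stalkMap _) s =
    (f.appLE U V h ≫ X.presheaf.germ V _ hV) s
  rw [TopCat.Presheaf.germ_stalkSpecializes_assoc, Scheme.Hom.germ_stalkMap, Scheme.Hom.appLE,
    Category.assoc, TopCat.Presheaf.germ_res]

theorem funMap_unitToFun (f : X ⟶ Y) (hf : f (genericPoint X) = genericPoint Y) {U : Y.Opens}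
    (hU : genericPoint Y ∈ U) {V : X.Opens} (h : V ≤ f ⁻¹ᵁ U) (hV : genericPoint X ∈ V)
    (u : Γ(Y, U)ˣ) : funMap f hf (unitToFun hU u) = unitToFun hV (pull f h u) :=
  funMap_germ f hf hU h hV _

theorem exists_germ_functionField (a : X.functionField) :
    ∃ (U : X.Opens) (hU : genericPoint X ∈ U) (s : Γ(X, U)), X.presheaf.germ U _ hU s = a :=
  X.presheaf.exists_germ_eq a

theorem funMap_comp (f : X ⟶ Y) (hf : f (genericPoint X) = genericPoint Y) (g : Y ⟶ Z)
    (hg : g (genericPoint Y) = genericPoint Z) (hfg : (f ≫ g) (genericPoint X) = genericPoint Z)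
    (a : Z.functionField) : funMap (f ≫ g) hfg a = funMap f hf (funMap g hg a) := by
  obtain ⟨U, hU, s, rfl⟩ := exists_germ_functionField a
  have hV : genericPoint Y ∈ g ⁻¹ᵁ U := by change g (genericPoint Y) ∈ U; rwa [hg]
  have hW : genericPoint X ∈ f ⁻¹ᵁ g ⁻¹ᵁ U := by
    change f (genericPoint X) ∈ g ⁻¹ᵁ U; rwa [hf]
  rw [funMap_germ g hg hU le_rfl hV, funMap_germ f hf hV le_rfl hW,
    funMap_germ (f ≫ g) hfg hU (V := f ⁻¹ᵁ g ⁻¹ᵁ U) le_rfl hW]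
  congr 1
  change _ = (g.appLE U _ le_rfl ≫ f.appLE _ _ le_rfl) s
  rw [Scheme.Hom.appLE_comp_appLE]

theorem funMap_id (h : (𝟙 X : X ⟶ X) (genericPoint X) = genericPoint X) (a : X.functionField) :
    funMap (𝟙 X) h a = a := by
  obtain ⟨U, hU, s, rfl⟩ := exists_germ_functionField a
  rw [funMap_germ (𝟙 X) h hU (V := U) le_rfl hU]
  congr 1
  simp only [Scheme.Hom.appLE, Scheme.Hom.id_app]
  exact congrArg (fun g => g.hom s) (X.presheaf.map_id (Opposite.op U))

theorem UnitAt.funMap {f : X ⟶ Y} (hf : f (genericPoint X) = genericPoint Y) {x : X}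
    {a : Y.functionField} (ha : UnitAt (f x) a) : UnitAt x (funMap f hf a) := by
  obtain ⟨b, hb, rfl⟩ := ha
  exact ⟨f.stalkMap x b, hb.map (f.stalkMap x).hom, (funMap_algebraMap f hf x b).symm⟩

theorem VanishesAt.funMap {f : X ⟶ Y} (hf : f (genericPoint X) = genericPoint Y) {x : X}
    {a : Y.functionField} (ha : VanishesAt (f x) a) : VanishesAt x (funMap f hf a) := by
  obtain ⟨b, hb, rfl⟩ := ha
  refine ⟨f.stalkMap x b, ?_, (funMap_algebraMap f hf x b).symm⟩
  exact map_nonunit (f.stalkMap x).hom b hb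

end FunctionField

/-! ### Line bundles, isomorphisms and linearizations as rational functions. -/

section Dictionary

variable {X Y : Scheme.{u}} [IsIntegral X] [IsIntegral Y]

theorem genericPoint_mem_inf {U V : X.Opens} (hU : genericPoint X ∈ U)
    (hV : genericPoint X ∈ V) : genericPoint X ∈ U ⊓ V := ⟨hU, hV⟩

theorem map_genericPoint_of_surjective (f : X ⟶ Y) (hf : Function.Surjective f) :
    f (genericPoint X) = genericPoint Y := by
  apply (IsGenericPoint.eq _ (genericPoint_spec Y))
  have h := (genericPoint_spec X).image f.continuous
  rwa [Set.image_univ, hf.range_eq, closure_univ] at h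

theorem RationalSection.eq_unitToFun {L : LineBundle X} (σ : RationalSection L) (x y : X) :
    unitToFun (genericPoint_mem_inf (genericPoint_mem (L.mem_U x)) (genericPoint_mem (L.mem_U y)))
        (L.g x y) =
      σ.s x / σ.s y :=
  (eq_div_iff (σ.ne_zero y)).mpr (σ.eq_mul x y).symm

theorem RationalSection.unitToFun_res_g {L : LineBundle X} (σ : RationalSection L) {x y : X}
    {V : X.Opens} (h : V ≤ L.U x ⊓ L.U y) (hV : genericPoint X ∈ V) :
    unitToFun hV (res h (L.g x y)) = σ.s x / σ.s y := by
  rw [unitToFun_res]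
  exact σ.eq_unitToFun x y

/-- The rational section that generates `L` at the generic point. -/
def LineBundle.rationalSection (L : LineBundle X) : RationalSection L where
  s x := unitToFun (genericPoint_mem_inf (genericPoint_mem (L.mem_U x)) (L.mem_U _))
    (L.g x (genericPoint X))
  ne_zero x := unitToFun_ne_zero _ _
  eq_mul x y := by
    have hx := genericPoint_mem (L.mem_U x)
    have hy := genericPoint_mem (L.mem_U y)
    have hη : genericPoint X ∈ L.U x ⊓ L.U y ⊓ L.U (genericPoint X) :=
      genericPoint_mem_inf (genericPoint_mem_inf hx hy) (L.mem_U _)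
    have h := congrArg (unitToFun hη) (L.cocycle x y (genericPoint X))
    rw [map_mul, unitToFun_res, unitToFun_res, unitToFun_res] at h
    exact h.symm

/-- The pullback of a rational section along a dominant morphism. -/
def RationalSection.pullback (f : X ⟶ Y) (hf : f (genericPoint X) = genericPoint Y)
    {L : LineBundle Y} (σ : RationalSection L) : RationalSection (L.pullback f) where
  s x := funMap f hf (σ.s (f x))
  ne_zero x := (map_ne_zero _).mpr (σ.ne_zero _)
  eq_mul x y := by
    conv_lhs => rw [σ.eq_mul (f x) (f y), map_mul]
    congr 1
    exact funMap_unitToFun f hf _ _ _ _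

/-- The tensor product of rational sections. -/
def RationalSection.tensor {L M : LineBundle X} (σ : RationalSection L) (ρ : RationalSection M) :
    RationalSection (L.tensor M) where
  s x := σ.s x * ρ.s x
  ne_zero x := mul_ne_zero (σ.ne_zero x) (ρ.ne_zero x)
  eq_mul x y := by
    have hη : genericPoint X ∈ (L.tensor M).U x ⊓ (L.tensor M).U y :=
      genericPoint_mem_inf (genericPoint_mem ((L.tensor M).mem_U x))
        (genericPoint_mem ((L.tensor M).mem_U y))
    have : unitToFun hη ((L.tensor M).g x y) = (σ.s x / σ.s y) * (ρ.s x / ρ.s y) := by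
      refine (map_mul (unitToFun hη) _ _).trans ?_
      exact congrArg₂ (· * ·) (σ.unitToFun_res_g _ _) (ρ.unitToFun_res_g _ _)
    refine Eq.trans ?_ (congrArg (· * (σ.s y * ρ.s y)) this.symm)
    have := σ.ne_zero y
    have := ρ.ne_zero y
    field_simp

/-- The product of a rational section with a rational function. -/
def RationalSection.smul {L : LineBundle X} (σ : RationalSection L) (b : X.functionField)
    (hb : b ≠ 0) : RationalSection L where
  s x := b * σ.s x
  ne_zero x := mul_ne_zero hb (σ.ne_zero x)
  eq_mul x y := by
    rw [mul_left_comm, ← σ.eq_mul x y]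

namespace LineBundle.Iso

variable {L M : LineBundle X}

/-- Here f is the ratio φ(σ)/ρ. Compatibility of φ with the transition functions says that it can be
computed in any trivialization. -/
theorem exists_fun (φ : Iso L M) (σ : RationalSection L) (ρ : RationalSection M) :
    ∃ f : X.functionField, f ≠ 0 ∧
      ∀ x, unitToFun (genericPoint_mem (φ.mem_W x)) (φ.h x) = f * ρ.s x / σ.s x := by
  let F (x : X) := unitToFun (genericPoint_mem (φ.mem_W x)) (φ.h x) * σ.s x / ρ.s x
  have hF : ∀ x y, F x = F y := by
    intro x y
    have hη : genericPoint X ∈ φ.W x ⊓ φ.W y :=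
      genericPoint_mem_inf (genericPoint_mem (φ.mem_W x)) (genericPoint_mem (φ.mem_W y))
    have h := congrArg (unitToFun hη) (φ.comm x y)
    rw [map_mul, map_mul, σ.unitToFun_res_g, ρ.unitToFun_res_g, unitToFun_res,
      unitToFun_res] at h
    have h1 := σ.ne_zero y
    have h2 := ρ.ne_zero y
    have h3 := ρ.ne_zero x
    field_simp at h
    simp only [F]
    rw [div_eq_div_iff h3 h2]
    linear_combination h
  refine ⟨F (genericPoint X), ?_, fun x => ?_⟩
  · exact div_ne_zero (mul_ne_zero (unitToFun_ne_zero _ _) (σ.ne_zero _)) (ρ.ne_zero _)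
  · rw [hF _ x]
    have h1 := σ.ne_zero x
    have h3 := ρ.ne_zero x
    simp only [F]
    field_simp

theorem exists_of_fun (σ : RationalSection L) (ρ : RationalSection M) (f : X.functionField)
    (hf : ∀ x, UnitAt x (f * ρ.s x / σ.s x)) : ∃ φ : Iso L M,
      ∀ x, unitToFun (genericPoint_mem (φ.mem_W x)) (φ.h x) = f * ρ.s x / σ.s x := by
  choose W hW u hle hu using fun x =>
    (hf x).exists_unit (V := L.U x ⊓ M.U x) ⟨L.mem_U x, M.mem_U x⟩
  refine ⟨⟨W, hW, fun x => (hle x).trans inf_le_left, fun x => (hle x).trans inf_le_right, u,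
    fun x y => ?_⟩, hu⟩
  apply unitToFun_injective
    (genericPoint_mem_inf (genericPoint_mem (hW x)) (genericPoint_mem (hW y)))
  rw [map_mul, map_mul, σ.unitToFun_res_g, ρ.unitToFun_res_g, unitToFun_res, unitToFun_res, hu, hu]
  have := σ.ne_zero x
  have := σ.ne_zero y
  have := ρ.ne_zero x
  have := ρ.ne_zero y
  field_simp

theorem nonempty_iff (σ : RationalSection L) (ρ : RationalSection M) :
    Nonempty (Iso L M) ↔ ∃ f : X.functionField, ∀ x, UnitAt x (f * ρ.s x / σ.s x) := by
  constructor
  · rintro ⟨φ⟩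
    obtain ⟨f, -, h⟩ := φ.exists_fun σ ρ
    refine ⟨f, fun x => ?_⟩
    rw [← h]
    exact unitAt_unitToFun (φ.mem_W x) _
  · rintro ⟨f, hf⟩
    exact ⟨(exists_of_fun σ ρ f hf).choose⟩

theorem same_iff (φ ψ : Iso L M) : φ.Same ψ ↔
    ∀ x, unitToFun (genericPoint_mem (φ.mem_W x)) (φ.h x) =
      unitToFun (genericPoint_mem (ψ.mem_W x)) (ψ.h x) := by
  refine forall_congr' fun x => ?_
  have hη : genericPoint X ∈ φ.W x ⊓ ψ.W x :=
    genericPoint_mem_inf (genericPoint_mem (φ.mem_W x)) (genericPoint_mem (ψ.mem_W x))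
  rw [← (unitToFun_injective hη).eq_iff, unitToFun_res, unitToFun_res]

end LineBundle.Iso

theorem Pic.mk_eq_mk_iff {X : Scheme.{u}} {L M : LineBundle X} :
    Pic.mk L = Pic.mk M ↔ Nonempty (L.Iso M) :=
  Quotient.eq

theorem apply_apply {X : Scheme.{u}} {τ : X ⟶ X} (hτ : τ ≫ τ = 𝟙 X) (x : X) : τ (τ x) = x := by
  rw [← Scheme.Hom.comp_apply, hτ]
  rfl

theorem funMap_funMap {τ : X ⟶ X} (hη : τ (genericPoint X) = genericPoint X) (hτ : τ ≫ τ = 𝟙 X)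
    (a : X.functionField) :
    funMap τ hη (funMap τ hη a) = a := by
  have h1 : (τ ≫ τ) (genericPoint X) = genericPoint X := by
    rw [hτ]; rfl
  rw [← funMap_comp τ hη τ hη h1]
  have h2 : (𝟙 X : X ⟶ X) (genericPoint X) = genericPoint X := rfl
  have := funMap_id h2 a
  simp only [← hτ] at this
  exact this

namespace Linearization

variable {τ : X ⟶ X} {L : LineBundle X} (hη : τ (genericPoint X) = genericPoint X)

/-- The function f satisfies φ(τ*σ) = f · σ; the involution condition, read at the generic point,
becomes f · τ(f) = 1. -/
theorem exists_fun (hτ : τ ≫ τ = 𝟙 X) (φ : Linearization τ L) (σ : RationalSection L) :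
    ∃ f : X.functionField, f * funMap τ hη f = 1 ∧
      ∀ x, unitToFun (genericPoint_mem (φ.mem_W x)) (φ.h x) =
        f * σ.s x / funMap τ hη (σ.s (τ x)) := by
  obtain ⟨f, hf, h⟩ := φ.toIso.exists_fun (σ.pullback τ hη) σ
  refine ⟨f, ?_, h⟩
  let x := genericPoint X
  have hx : x ∈ φ.W x := φ.mem_W x
  have hx' : x ∈ τ ⁻¹ᵁ φ.W (τ x) := φ.mem_W (τ x)
  have hη' : genericPoint X ∈ φ.W x ⊓ τ ⁻¹ᵁ φ.W (τ x) :=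
    genericPoint_mem_inf (genericPoint_mem hx) (genericPoint_mem hx')
  have hh := congrArg (unitToFun hη') (φ.sq_eq_one x)
  rw [map_mul, map_one, ← funMap_unitToFun τ hη (genericPoint_mem (φ.mem_W (τ x))),
    unitToFun_res, h, h] at hh
  change funMap τ hη (f * σ.s (τ x) / funMap τ hη (σ.s (τ (τ x)))) *
    (f * σ.s x / funMap τ hη (σ.s (τ x))) = 1 at hh
  rw [map_div₀, map_mul, funMap_funMap hη hτ, apply_apply hτ] at hh
  have h1 := σ.ne_zero x
  have h2 : funMap τ hη (σ.s (τ x)) ≠ 0 := (map_ne_zero _).mpr (σ.ne_zero _)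
  field_simp at hh
  rw [mul_comm]
  exact hh

theorem exists_of_fun (hτ : τ ≫ τ = 𝟙 X) (σ : RationalSection L) (f : X.functionField)
    (hf : f * funMap τ hη f = 1)
    (hu : ∀ x, UnitAt x (f * σ.s x / funMap τ hη (σ.s (τ x)))) : ∃ φ : Linearization τ L,
      ∀ x, unitToFun (genericPoint_mem (φ.mem_W x)) (φ.h x) =
        f * σ.s x / funMap τ hη (σ.s (τ x)) := by
  obtain ⟨φ, h⟩ := LineBundle.Iso.exists_of_fun (σ.pullback τ hη) σ f hu
  refine ⟨⟨φ, fun x => ?_⟩, h⟩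
  have hx : x ∈ φ.W x := φ.mem_W x
  have hx' : x ∈ τ ⁻¹ᵁ φ.W (τ x) := φ.mem_W (τ x)
  have hη' : genericPoint X ∈ φ.W x ⊓ τ ⁻¹ᵁ φ.W (τ x) :=
    genericPoint_mem_inf (genericPoint_mem hx) (genericPoint_mem hx')
  apply unitToFun_injective hη'
  rw [map_mul, map_one, ← funMap_unitToFun τ hη (genericPoint_mem (φ.mem_W (τ x))),
    unitToFun_res, h, h]
  change funMap τ hη (f * σ.s (τ x) / funMap τ hη (σ.s (τ (τ x)))) *
    (f * σ.s x / funMap τ hη (σ.s (τ x))) = 1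
  rw [map_div₀, map_mul, funMap_funMap hη hτ, apply_apply hτ]
  have h1 := σ.ne_zero x
  have h2 : funMap τ hη (σ.s (τ x)) ≠ 0 := (map_ne_zero _).mpr (σ.ne_zero _)
  field_simp
  rw [mul_comm]
  exact hf

/-- The scalar is the residue of the germ of `φ.h x`, so comparing it with n is a question about the
maximal ideal of the stalk, which embeds in the function field. -/
theorem fibreScalar_eq_iff (φ : Linearization τ L) (x : X) (n : ℤ) :
    φ.fibreScalar x = (n : X.residueField x) ↔
      VanishesAt x (unitToFun (genericPoint_mem (φ.mem_W x)) (φ.h x) - n) := by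
  have h1 : φ.fibreScalar x - n =
      X.residue x (X.presheaf.germ _ x (φ.mem_W x) (φ.h x : Γ(X, φ.W x)) - n) := by
    rw [map_sub, map_intCast]
    rfl
  have h2 : unitToFun (genericPoint_mem (φ.mem_W x)) (φ.h x) - n =
      algebraMap (X.presheaf.stalk x) X.functionField
        (X.presheaf.germ _ x (φ.mem_W x) (φ.h x : Γ(X, φ.W x)) - n) := by
    rw [map_sub, map_intCast, algebraMap_germ]
    rfl
  rw [← sub_eq_zero, h1, h2]
  constructor
  · intro h
    exact ⟨_, (IsLocalRing.residue_eq_zero_iff _).mp h, rfl⟩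
  · rintro ⟨a, ha, h⟩
    rw [← stalk_injective x h]
    exact (IsLocalRing.residue_eq_zero_iff _).mpr ha

end Linearization

/-- Local equations `s x` define a line bundle with a rational section. -/
theorem exists_lineBundle_of_local (s : X → X.functionField) (hs0 : ∀ x, s x ≠ 0)
    (hs : ∀ x, ∃ U : X.Opens, x ∈ U ∧ ∀ y ∈ U, UnitAt y (s x / s y)) :
    ∃ (L : LineBundle X) (σ : RationalSection L), σ.s = s := by
  choose U hU hs using hs
  have key : ∀ x y, ∃ u : Γ(X, U x ⊓ U y)ˣ,
      unitToFun (genericPoint_mem_inf (genericPoint_mem (hU x)) (genericPoint_mem (hU y))) u =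
        s x / s y := by
    intro x y
    refine exists_unit_of_forall_unitAt _ fun z hz => ?_
    have := (hs x z hz.1).div (hs y z hz.2)
    rwa [div_div_div_cancel_right₀ (hs0 z)] at this
  choose g hg using key
  refine ⟨⟨U, hU, g, fun x y z => ?_⟩, ⟨s, hs0, fun x y => ?_⟩, rfl⟩
  · apply unitToFun_injective (genericPoint_mem_inf
      (genericPoint_mem_inf (genericPoint_mem (hU x)) (genericPoint_mem (hU y)))
      (genericPoint_mem (hU z)))
    rw [map_mul, unitToFun_res, unitToFun_res, unitToFun_res, hg, hg, hg,
      div_mul_div_cancel₀ (hs0 y)]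
  · have := hg x y
    rw [eq_div_iff (hs0 y)] at this
    exact this.symm

end Dictionary

/-! ### Smooth local rings of dimension one are discrete valuation rings. -/

section Cotangent

open IsLocalRing KaehlerDifferential

variable (R A : Type*) [CommRing R] [CommRing A] [IsLocalRing A] [Algebra R A]
  (h : Function.Bijective (algebraMap R (ResidueField A)))

/-- The constant with the same residue class as `a`. -/
def residueLift : A →+* A :=
  (algebraMap R A).comp ((RingEquiv.ofBijective _ h).symm.toRingHom.comp (residue A))

theorem residue_residueLift (a : A) : residue A (residueLift R A h a) = residue A a := by
  have := (RingEquiv.ofBijective _ h).apply_symm_apply (residue A a)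
  exact this

theorem residueLift_algebraMap (r : R) :
    residueLift R A h (algebraMap R A r) = algebraMap R A r := by
  change algebraMap R A _ = _
  congr 1
  exact (RingEquiv.ofBijective _ h).symm_apply_apply r

theorem sub_residueLift_mem (a : A) : a - residueLift R A h a ∈ maximalIdeal A := by
  rw [← residue_eq_zero_iff, map_sub, residue_residueLift, sub_self]

/-- The derivation that takes a function to its differential in the cotangent space. -/
def cotangentDerivation : Derivation R A (CotangentSpace A) where
  toFun a := (maximalIdeal A).toCotangent ⟨a - residueLift R A h a, sub_residueLift_mem R A h a⟩
  map_add' a b := by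
    rw [← map_add]
    congr 1
    ext
    simp only [map_add, Submodule.coe_add]
    ring
  map_smul' r a := by
    rw [RingHom.id_apply, ← algebraMap_smul A r ((maximalIdeal A).toCotangent _),
      ← LinearMap.map_smul]
    congr 1
    ext
    simp only [Algebra.smul_def, map_mul, residueLift_algebraMap, Submodule.coe_smul]
    exact (mul_sub _ _ _).symm
  map_one_eq_zero' := by
    change (maximalIdeal A).toCotangent _ = 0
    rw [Ideal.toCotangent_eq_zero]
    simp
  leibniz' a b := by
    change (maximalIdeal A).toCotangent _ = a • (maximalIdeal A).toCotangent _ +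
      b • (maximalIdeal A).toCotangent _
    rw [← map_smul, ← map_smul, ← map_add, Ideal.toCotangent_eq]
    -- The defect in the Leibniz rule is the product of two elements of the maximal ideal, which
    -- dies in the cotangent space.
    have : (a * b - residueLift R A h (a * b)) - (a * (b - residueLift R A h b) +
        b * (a - residueLift R A h a)) =
        -((a - residueLift R A h a) * (b - residueLift R A h b)) := by
      rw [map_mul]; ring
    change (a * b - residueLift R A h (a * b)) - (a * (b - residueLift R A h b) +
        b * (a - residueLift R A h a)) ∈ _
    rw [this, pow_two]
    exact neg_mem (Ideal.mul_mem_mul (sub_residueLift_mem R A h a) (sub_residueLift_mem R A h b))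

/-- The derivation factors through Ω and sends the differential of an element a of the maximal ideal
to the class of a. Hence the image of a generator of Ω spans the cotangent space. -/
theorem finrank_cotangentSpace_le_one
    (h : Function.Bijective (algebraMap R (ResidueField A))) (ω : Ω[A⁄R])
    (hω : ∀ η : Ω[A⁄R], ∃ a : A, a • ω = η) :
    Module.finrank (ResidueField A) (CotangentSpace A) ≤ 1 := by
  apply finrank_le_one ((cotangentDerivation R A h).liftKaehlerDifferential ω)
  intro w
  obtain ⟨⟨a, ha⟩, rfl⟩ := Ideal.toCotangent_surjective _ w
  obtain ⟨c, hc⟩ := hω (D R A a)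
  refine ⟨residue A c, ?_⟩
  have h1 := congrArg (cotangentDerivation R A h).liftKaehlerDifferential hc
  rw [map_smul, Derivation.liftKaehlerDifferential_comp_D] at h1
  change c • (cotangentDerivation R A h).liftKaehlerDifferential ω = _
  rw [h1]
  change (maximalIdeal A).toCotangent _ = _
  rw [Ideal.toCotangent_eq]
  have h2 : residueLift R A h a = 0 := by
    change algebraMap R A _ = 0
    simp only [RingHom.comp_apply]
    rw [(residue_eq_zero_iff a).mpr ha]
    simp
  simp [h2]

end Cotangent

/-- A local ring with residue field `R` that is smooth of dimension one over `R` is a discrete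
valuation ring. -/
theorem isDiscreteValuationRing_of_smooth (R S A : Type*) [CommRing R] [CommRing S] [CommRing A]
    [Algebra R S] [Algebra S A] [Algebra R A] [IsScalarTower R S A] [IsLocalRing A] [IsDomain A]
    [IsNoetherianRing A] [Algebra.IsStandardSmoothOfRelativeDimension 1 R S] (M : Submonoid S)
    [IsLocalization M A]
    (h : Function.Bijective (algebraMap R (IsLocalRing.ResidueField A))) :
    IsDiscreteValuationRing A := by
  have : Nontrivial S := (algebraMap S A).domain_nontrivial
  have : Algebra.FormallyEtale S A := .of_isLocalization M
  have : Algebra.IsStandardSmooth R S :=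
    Algebra.IsStandardSmoothOfRelativeDimension.isStandardSmooth 1
  have hr :=
    Algebra.IsStandardSmoothOfRelativeDimension.rank_kaehlerDifferential (R := R) (S := S) 1
  let b : Module.Basis (Fin 1) S (Ω[S⁄R]) := by
    refine (Module.Free.chooseBasis S (Ω[S⁄R])).reindex ?_
    have := (Module.Free.rank_eq_card_chooseBasisIndex S (Ω[S⁄R])).symm.trans hr
    rw [Nat.cast_one, Cardinal.eq_one_iff_unique] at this
    have := this.1
    have := Classical.inhabited_of_nonempty ‹_ ∧ _›.2
    have := Unique.mk' (Module.Free.ChooseBasisIndex S (Ω[S⁄R]))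
    exact Equiv.ofUnique _ _
  let b' : Module.Basis (Fin 1) A (Ω[A⁄R]) := (b.baseChange A).map
    (KaehlerDifferential.tensorKaehlerEquivOfFormallyEtale R S A)
  have hle : Module.finrank (IsLocalRing.ResidueField A) (IsLocalRing.CotangentSpace A) ≤ 1 := by
    refine finrank_cotangentSpace_le_one R A h (b' 0) fun η => ⟨b'.repr η 0, ?_⟩
    conv_rhs => rw [← b'.sum_repr η]
    simp
  rw [← IsLocalRing.finrank_CotangentSpace_eq_one_iff]
  refine le_antisymm hle (Nat.one_le_iff_ne_zero.mpr fun h0 => ?_)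
  rw [IsLocalRing.finrank_cotangentSpace_eq_zero_iff] at h0
  -- If the cotangent space were zero, A would be a field, equal to its residue field and so a
  -- quotient of R. Then Ω would vanish, although it is free of rank one.
  have hsurj : Function.Surjective (algebraMap R A) := by
    intro a
    obtain ⟨r, hr⟩ := h.2 (IsLocalRing.residue A a)
    refine ⟨r, sub_eq_zero.mp ?_⟩
    have hm : algebraMap R A r - a ∈ IsLocalRing.maximalIdeal A := by
      rw [← IsLocalRing.residue_eq_zero_iff, map_sub, ← hr]
      exact sub_self _
    by_contra hne
    exact hm (by
      obtain ⟨y, hy⟩ := h0.mul_inv_cancel hne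
      exact IsUnit.of_mul_eq_one _ hy)
  have := KaehlerDifferential.subsingleton_of_surjective R A hsurj
  exact b'.ne_zero 0 (Subsingleton.elim _ _)

theorem fromSpecResidueField_appTop {X : Scheme.{u}} (x : X) :
    (X.fromSpecResidueField x).appTop ≫ (Scheme.ΓSpecIso _).hom =
      X.presheaf.germ ⊤ x trivial ≫ X.residue x := by
  rw [Scheme.fromSpecResidueField, Scheme.Hom.comp_appTop, Category.assoc,
    Scheme.ΓSpecIso_naturality, Scheme.fromSpecStalk_appTop]
  have : (Spec (X.presheaf.stalk x)).presheaf.map (homOfLE (le_top (a := ⊤))).op = 𝟙 _ :=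
    CategoryTheory.Functor.map_id _ _
  rw [this]
  simp

/-! ### Points, orders of vanishing, constants and divisors on a curve. -/

namespace SmoothCurve

variable (C : SmoothCurve)

/-- Constants as regular functions. -/
def const : ℂ →+* Γ(C.scheme, ⊤) :=
  ((Scheme.ΓSpecIso (.of ℂ)).inv ≫ C.structureMap.appTop).hom

/-- Residue fields at closed points equal ℂ, because ℂ is algebraically closed. -/
theorem residue_appTop_bijective {x : C.scheme} (hx : IsClosed {x}) :
    Function.Bijective (C.structureMap.appTop ≫ C.scheme.presheaf.germ ⊤ x trivial ≫
      C.scheme.residue x) := by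
  let i := residueFieldIsoBase C.structureMap x hx
  have h := SpecMap_residueFieldIsoBase_inv C.structureMap x hx
  have h2 := congrArg Scheme.Hom.appTop h
  have h3 : C.structureMap.appTop ≫ C.scheme.presheaf.germ ⊤ x trivial ≫ C.scheme.residue x =
      (Scheme.ΓSpecIso (.of ℂ)).hom ≫ i.inv := by
    rw [← Scheme.ΓSpecIso_naturality, h2, Scheme.Hom.comp_appTop, Category.assoc,
      fromSpecResidueField_appTop]
  rw [h3]
  exact ConcreteCategory.bijective_of_isIso _

theorem isDiscreteValuationRing_of_isClosed {x : C.scheme} (hx : IsClosed {x}) :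
    IsDiscreteValuationRing (C.scheme.presheaf.stalk x) := by
  obtain ⟨U, hU, V, hV, hxV, e, hs⟩ :=
    C.smooth.exists_isStandardSmoothOfRelativeDimension x
  -- Spec ℂ has only one point.
  obtain rfl : U = ⊤ := by
    ext y
    simp only [Opens.coe_top, Set.mem_univ, iff_true]
    have h : C.structureMap x ∈ U := e hxV
    rwa [Subsingleton.elim (α := PrimeSpectrum ℂ) (C.structureMap x) y] at h
  let R := Γ(Spec (.of ℂ), ⊤)
  let S := Γ(C.scheme, V)
  let A := C.scheme.presheaf.stalk x
  let : Algebra R S := (C.structureMap.appLE ⊤ V e).hom.toAlgebra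
  let : Algebra S A := (C.scheme.presheaf.germ V x hxV).hom.toAlgebra
  let : Algebra R A := ((C.structureMap.appLE ⊤ V e) ≫ C.scheme.presheaf.germ V x hxV).hom.toAlgebra
  have : IsScalarTower R S A := .of_algebraMap_eq fun _ => rfl
  have : Algebra.IsStandardSmoothOfRelativeDimension 1 R S := hs
  have : IsLocalization.AtPrime A (hV.primeIdealOf ⟨x, hxV⟩).asIdeal :=
    hV.isLocalization_stalk ⟨x, hxV⟩
  refine isDiscreteValuationRing_of_smooth R S A (hV.primeIdealOf ⟨x, hxV⟩).asIdeal.primeCompl ?_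
  have hb := C.residue_appTop_bijective hx
  have : C.structureMap.appLE ⊤ V e ≫ C.scheme.presheaf.germ V x hxV =
      C.structureMap.appTop ≫ C.scheme.presheaf.germ ⊤ x trivial := by
    rw [Scheme.Hom.appLE, Category.assoc, TopCat.Presheaf.germ_res]
    rfl
  rw [← reassoc_of% this] at hb
  exact hb

/-- Every point x specializes to a closed point z. The points specializing to z are the primes of a
discrete valuation ring, and there are only two: the generic point and z. -/
theorem eq_genericPoint_or_isClosed (x : C.scheme) :
    x = genericPoint C.scheme ∨ IsClosed {x} := by
  have : CompactSpace C.scheme := (quasiCompact_iff_compactSpace C.structureMap).mp inferInstance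
  obtain ⟨z, hz, hz'⟩ := IsClosed.exists_closed_singleton (isClosed_closure (s := {x}))
    ⟨x, subset_closure rfl⟩
  have hspec : x ⤳ z := specializes_iff_mem_closure.mpr hz
  have := C.isDiscreteValuationRing_of_isClosed hz'
  have hη : genericPoint C.scheme ⤳ z := genericPoint_specializes z
  change x ∈ {y | y ⤳ z} at hspec
  change _ ∈ {y | y ⤳ z} at hη
  rw [← Scheme.range_fromSpecStalk] at hspec hη
  obtain ⟨y, rfl⟩ := hspec
  obtain ⟨w, hw⟩ := hη
  by_cases hy : y.asIdeal = ⊥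
  · left
    refine Specializes.antisymm ?_ (genericPoint_specializes _) |>.eq
    rw [← hw]
    refine Specializes.map ?_ (C.scheme.fromSpecStalk z).continuous
    refine (PrimeSpectrum.le_iff_specializes y w).mp ?_
    change y.asIdeal ≤ w.asIdeal
    rw [hy]
    exact bot_le
  · right
    have : y = IsLocalRing.closedPoint _ := by
      apply PrimeSpectrum.ext
      exact IsLocalRing.eq_maximalIdeal (Ideal.IsPrime.isMaximal y.isPrime hy)
    rw [this, Scheme.fromSpecStalk_closedPoint]
    exact hz'

theorem not_isClosed_genericPoint : ¬ IsClosed {genericPoint C.scheme} := fun h =>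
  (C.isDiscreteValuationRing_of_isClosed h).not_isField _ (Field.toIsField C.scheme.functionField)

theorem isClosed_iff {x : C.scheme} : IsClosed {x} ↔ x ≠ genericPoint C.scheme := by
  constructor
  · rintro h rfl
    exact C.not_isClosed_genericPoint h
  · exact (C.eq_genericPoint_or_isClosed x).resolve_left

/-- `Scheme.ord` is nontrivial only at points of coheight one; on a curve these are the closed
points. -/
theorem coheight_eq_one {x : C.scheme} (hx : IsClosed {x}) : Order.coheight x = 1 := by
  have := C.isDiscreteValuationRing_of_isClosed hx
  have h := ringKrullDim_stalk_eq_coheight x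
  rw [IsDiscreteValuationRing.ringKrullDim_eq_one] at h
  exact_mod_cast h.symm

theorem coheight_genericPoint : Order.coheight (genericPoint C.scheme) = 0 := by
  have h := ringKrullDim_stalk_eq_coheight (genericPoint C.scheme)
  have h1 : ringKrullDim (C.scheme.presheaf.stalk (genericPoint C.scheme)) = 0 :=
    ringKrullDim_eq_zero_of_field C.scheme.functionField
  rw [h1] at h
  exact_mod_cast h.symm

variable {C}
variable {x : C.scheme} {f g : C.scheme.functionField}

theorem ord_genericPoint (f : C.scheme.functionField) : Scheme.ord f (genericPoint C.scheme) = 0 :=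
  Scheme.ord_eq_zero_of_coheight_neq_one (by simp [coheight_genericPoint]) f

theorem ord_eq_iff (hx : IsClosed {x}) (hf : f ≠ 0) {n : ℤ} :
    Scheme.ord f x = n ↔
      haveI := C.isDiscreteValuationRing_of_isClosed hx
      haveI : Ring.KrullDimLE 1 (C.scheme.presheaf.stalk x) :=
        krullDimLE_of_coheight_le (C.coheight_eq_one hx).le
      Ring.ordFrac (C.scheme.presheaf.stalk x) f = Multiplicative.ofAdd n :=
  Scheme.ord_eq_iff (C.coheight_eq_one hx) hf

theorem unitAt_iff (hf : f ≠ 0) : UnitAt x f ↔ Scheme.ord f x = 0 := by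
  rcases C.eq_genericPoint_or_isClosed x with rfl | hx
  · simp [ord_genericPoint, unitAt_genericPoint hf]
  have := C.isDiscreteValuationRing_of_isClosed hx
  rw [ord_eq_iff hx hf]
  constructor
  · rintro ⟨a, ha, rfl⟩
    exact Ring.ordFrac_of_isUnit ha
  · intro h
    obtain ⟨u, hu⟩ := Ring.associated_of_ordFrac_eq (R := C.scheme.presheaf.stalk x) 1 f
      (by rw [h, map_one]; rfl)
    refine ⟨u, u.isUnit, ?_⟩
    rw [← hu, Units.smul_def, Algebra.smul_def, mul_one]

theorem ord_one : Scheme.ord (1 : C.scheme.functionField) x = 0 :=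
  (unitAt_iff one_ne_zero).mp .one

theorem ord_inv : Scheme.ord f⁻¹ x = - Scheme.ord f x := by
  by_cases hf : f = 0
  · simp [hf]
  have := Scheme.ord_mul (x := x) hf (inv_ne_zero hf)
  rw [mul_inv_cancel₀ hf, ord_one] at this
  linarith

theorem ord_div (hf : f ≠ 0) (hg : g ≠ 0) :
    Scheme.ord (f / g) x = Scheme.ord f x - Scheme.ord g x := by
  rw [div_eq_mul_inv, Scheme.ord_mul hf (inv_ne_zero hg), ord_inv, sub_eq_add_neg]

theorem ord_pow (hf : f ≠ 0) (n : ℕ) : Scheme.ord (f ^ n) x = n * Scheme.ord f x := by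
  induction n with
  | zero => simp [ord_one]
  | succ n ih => rw [pow_succ, Scheme.ord_mul (pow_ne_zero n hf) hf, ih]; push_cast; ring

theorem ord_zpow (hf : f ≠ 0) (n : ℤ) : Scheme.ord (f ^ n) x = n * Scheme.ord f x := by
  obtain n | n := n
  · simpa using ord_pow hf n
  · rw [zpow_negSucc, ord_inv, ord_pow hf, Int.negSucc_eq]; push_cast; ring

theorem regularAt_or_inv (x : C.scheme) (f : C.scheme.functionField) :
    RegularAt x f ∨ RegularAt x f⁻¹ := by
  by_cases hf : f = 0
  · exact .inl ⟨0, by rw [hf, map_zero]⟩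
  rcases C.eq_genericPoint_or_isClosed x with rfl | hx
  · exact .inl (unitAt_genericPoint hf).regularAt
  have := C.isDiscreteValuationRing_of_isClosed hx
  exact ValuationRing.isInteger_or_isInteger (C.scheme.presheaf.stalk x) f

theorem regularAt_iff (hf : f ≠ 0) : RegularAt x f ↔ 0 ≤ Scheme.ord f x := by
  rcases C.eq_genericPoint_or_isClosed x with rfl | hx
  · simp [ord_genericPoint, (unitAt_genericPoint hf).regularAt]
  have := C.isDiscreteValuationRing_of_isClosed hx
  have hpos : ∀ {f : C.scheme.functionField}, f ≠ 0 → RegularAt x f → 0 ≤ Scheme.ord f x := by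
    rintro _ hf ⟨a, rfl⟩
    have ha : a ≠ 0 := by rintro rfl; simp at hf
    rw [Scheme.le_ord_iff (C.coheight_eq_one hx) hf]
    exact Ring.ordFrac_ge_one_of_ne_zero ha
  refine ⟨hpos hf, ?_⟩
  · intro h
    rcases regularAt_or_inv x f with h1 | h1
    · exact h1
    rcases h1.unitAt_or_vanishesAt with h2 | h2
    · simpa using h2.inv.regularAt
    have h3 := hpos (inv_ne_zero hf) h1
    rw [ord_inv] at h3
    exact ((unitAt_iff hf).mpr (by linarith)).regularAt

theorem vanishesAt_iff (hf : f ≠ 0) : VanishesAt x f ↔ 0 < Scheme.ord f x := by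
  constructor
  · intro h
    refine lt_of_le_of_ne ((regularAt_iff hf).mp h.regularAt) fun h0 => ?_
    exact h.not_unitAt ((unitAt_iff hf).mpr h0.symm)
  · intro h
    refine (((regularAt_iff hf).mpr h.le).unitAt_or_vanishesAt).resolve_left fun h0 => ?_
    exact h.ne' ((unitAt_iff hf).mp h0)

theorem exists_ord_eq_one (hx : IsClosed {x}) :
    ∃ t : C.scheme.functionField, t ≠ 0 ∧ Scheme.ord t x = 1 := by
  have := C.isDiscreteValuationRing_of_isClosed hx
  obtain ⟨t, ht⟩ := IsDiscreteValuationRing.exists_irreducible (C.scheme.presheaf.stalk x)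
  have h0 : algebraMap _ C.scheme.functionField t ≠ 0 := fun h =>
    ht.ne_zero (stalk_injective x (h.trans (map_zero _).symm))
  exact ⟨_, h0, (ord_eq_iff hx h0).mpr (Ring.ordFrac_irreducible ht)⟩

variable (C)

/-- Constants as rational functions. -/
def constFun : ℂ →+* C.scheme.functionField :=
  (C.scheme.presheaf.germ ⊤ (genericPoint C.scheme) trivial).hom.comp C.const

variable {C}

theorem constFun_eq (x : C.scheme) (z : ℂ) : C.constFun z =
    algebraMap _ C.scheme.functionField (C.scheme.presheaf.germ ⊤ x trivial (C.const z)) :=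
  (algebraMap_germ _ _).symm

theorem regularAt_constFun (z : ℂ) : RegularAt x (C.constFun z) := ⟨_, (constFun_eq x z).symm⟩

theorem unitAt_constFun {z : ℂ} (hz : z ≠ 0) : UnitAt x (C.constFun z) :=
  ⟨_, (((isUnit_iff_ne_zero.mpr hz).map C.const).map (C.scheme.presheaf.germ ⊤ x trivial).hom),
    (constFun_eq x z).symm⟩

/-- The constant z is the value of f at x. -/
theorem exists_vanishesAt_sub_constFun (hx : IsClosed {x}) (hf : RegularAt x f) :
    ∃ z, VanishesAt x (f - C.constFun z) := by
  obtain ⟨a, rfl⟩ := hf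
  obtain ⟨w, hw⟩ := (C.residue_appTop_bijective hx).2 (C.scheme.residue x a)
  let z := (Scheme.ΓSpecIso (.of ℂ)).hom w
  have hz : C.const z = C.structureMap.appTop w := by
    change ((Scheme.ΓSpecIso (.of ℂ)).hom ≫ (Scheme.ΓSpecIso (.of ℂ)).inv ≫ _) w = _
    rw [Iso.hom_inv_id_assoc]
  refine ⟨z, a - C.scheme.presheaf.germ ⊤ x trivial (C.const z), ?_, ?_⟩
  · rw [← IsLocalRing.residue_eq_zero_iff, map_sub, sub_eq_zero, hz]
    exact hw.symm
  · rw [map_sub, ← constFun_eq]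

/-- By properness, global functions are integral over ℂ, hence constant since ℂ is algebraically
closed and the curve is integral. -/
theorem exists_eq_constFun (hf : ∀ x, RegularAt x f) : ∃ z, f = C.constFun z := by
  obtain ⟨s, hs⟩ := exists_section_of_forall_regularAt (U := ⊤) trivial fun x _ => hf x
  have hint : C.const.IsIntegral := by
    apply RingHom.isIntegral_respectsIso.2
      (e := (Scheme.ΓSpecIso (.of ℂ)).symm.commRingCatIsoToRingEquiv)
    exact isIntegral_appTop_of_universallyClosed C.structureMap
  have hd : IsDomain Γ(C.scheme, ⊤) := inferInstance
  obtain ⟨z, hz⟩ := (IsAlgClosed.ringHom_bijective_of_isIntegral C.const hint).2 s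
  exact ⟨z, by rw [← hs, ← hz]; rfl⟩

instance : IsNoetherian C.scheme where
  toCompactSpace := (quasiCompact_iff_compactSpace C.structureMap).mp inferInstance

/-- Each of the finitely many irreducible components is the closure of a non-generic point, and such
points are closed. -/
theorem finite_of_isClosed {Z : Set C.scheme} (hZ : IsClosed Z)
    (hη : genericPoint C.scheme ∉ Z) : Z.Finite := by
  obtain ⟨S, hS, hSc, hSi, rfl⟩ :=
    NoetherianSpace.exists_finite_set_isClosed_irreducible hZ
  refine Set.Finite.sUnion hS fun T hT => ?_
  have hTc := hSc T hT
  have hTi := hSi T hT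
  obtain ⟨z, hz⟩ := QuasiSober.sober hTi hTc
  have hzT : z ∈ T := hz.mem
  have hz' : IsClosed {z} := C.isClosed_iff.mpr fun h => hη ⟨T, hT, h ▸ hzT⟩
  rw [← hz.def, hz'.closure_eq]
  exact Set.finite_singleton z

theorem isClosed_of_finite {Z : Set C.scheme} (hZ : Z.Finite)
    (hη : genericPoint C.scheme ∉ Z) : IsClosed Z := by
  rw [← Set.biUnion_of_singleton Z]
  exact hZ.isClosed_biUnion fun x hx => C.isClosed_iff.mpr fun h => hη (h ▸ hx)

theorem finite_support_ord (f : C.scheme.functionField) : {x | Scheme.ord f x ≠ 0}.Finite := by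
  by_cases hf : f = 0
  · simp [hf]
  obtain ⟨U, -, f', hU, rfl, hu⟩ := exists_isUnit_germ_eq C.scheme f hf
  refine (finite_of_isClosed (C := C) (Z := (U : Set C.scheme)ᶜ) U.isOpen.isClosed_compl
    fun h => h ?_).subset fun x hx hxU => hx (Scheme.ord_of_isUnit hu hxU)
  exact genericPoint_mem hU.some.2

theorem exists_lineBundle_of_finite (s : C.scheme → C.scheme.functionField) (hs0 : ∀ x, s x ≠ 0)
    (hs : {x | Scheme.ord (s x) x ≠ 0}.Finite) :
    ∃ (L : LineBundle C.scheme) (σ : RationalSection L), σ.s = s := by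
  refine exists_lineBundle_of_local s hs0 fun x => ?_
  -- The equation `s x` remains valid at every y outside this finite set, which contains neither x
  -- nor the generic point. Its complement is the required neighbourhood of x.
  let Z := {y | Scheme.ord (s x) y ≠ Scheme.ord (s y) y}
  have hZ : Z.Finite := by
    refine ((finite_support_ord (s x)).union hs).subset fun y hy => ?_
    by_contra h
    simp only [Set.mem_union, Set.mem_ofPred_eq, not_or, not_not] at h
    exact hy (h.1.trans h.2.symm)
  have hZ' : IsClosed Z := isClosed_of_finite hZ (by simp [Z, ord_genericPoint])
  refine ⟨⟨Zᶜ, hZ'.isOpen_compl⟩, by change x ∈ Zᶜ; simp [Z], fun y hy => ?_⟩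
  have hy : y ∈ Zᶜ := hy
  simp only [Z, Set.mem_compl_iff, Set.mem_ofPred_eq, not_not] at hy
  rw [unitAt_iff (div_ne_zero (hs0 x) (hs0 y)), ord_div (hs0 x) (hs0 y), hy, sub_self]

/-- The divisor reads a different function `σ.s y` at each y. On a trivializing open set the single
function `σ.s x` has the same orders, and finitely many such sets cover the curve. -/
theorem finite_support_divisor {L : LineBundle C.scheme} (σ : RationalSection L) :
    (Function.support σ.divisor).Finite := by
  obtain ⟨t, ht⟩ := CompactSpace.elim_nhds_subcover (X := C.scheme)
    (fun x => (L.U x : Set C.scheme))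
    fun x => (L.U x).isOpen.mem_nhds (L.mem_U x)
  refine (t.finite_toSet.biUnion fun x _ => finite_support_ord (σ.s x)).subset fun y hy => ?_
  have : y ∈ ⋃ x ∈ t, (L.U x : Set C.scheme) := by rw [ht]; trivial
  simp only [Set.mem_iUnion, exists_prop] at this
  obtain ⟨x, hx, hxy⟩ := this
  refine Set.mem_biUnion hx ?_
  have h : UnitAt y (σ.s x / σ.s y) := by
    rw [← σ.eq_unitToFun x y]
    exact unitAt_unitToFun (U := L.U x ⊓ L.U y) ⟨hxy, L.mem_U y⟩ _
  rw [unitAt_iff (div_ne_zero (σ.ne_zero x) (σ.ne_zero y)), ord_div (σ.ne_zero x) (σ.ne_zero y),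
    sub_eq_zero] at h
  simp only [Set.mem_ofPred_eq, h]
  exact hy

end SmoothCurve

/-! ### Dominant morphisms of curves and their action on function fields. -/

theorem fromSpecStalk_comp_eq {X Y : Scheme.{u}} [IsIntegral X] [IsIntegral Y] (f : X ⟶ Y)
    (hf : f (genericPoint X) = genericPoint Y) :
    X.fromSpecStalk (genericPoint X) ≫ f =
      Spec.map (CommRingCat.ofHom (funMap f hf)) ≫ Y.fromSpecStalk (genericPoint Y) := by
  rw [← Scheme.SpecMap_stalkMap_fromSpecStalk,
    ← Scheme.SpecMap_stalkSpecializes_fromSpecStalk (specializes_of_eq hf), ← Category.assoc,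
    ← Spec.map_comp]
  rfl

namespace SmoothCurve

variable {C D : SmoothCurve} (g : C.scheme ⟶ D.scheme)
  (hg : g (genericPoint C.scheme) = genericPoint D.scheme)

theorem ord_constFun (z : ℂ) (x : C.scheme) : Scheme.ord (C.constFun z) x = 0 := by
  by_cases hz : z = 0
  · simp [hz]
  · exact (unitAt_iff ((map_ne_zero _).mpr hz)).mp (unitAt_constFun hz)

theorem funMap_constFun (h : g ≫ D.structureMap = C.structureMap) (z : ℂ) :
    funMap g hg (D.constFun z) = C.constFun z := by
  refine (funMap_germ g hg (U := ⊤) trivial (V := ⊤) le_top trivial (D.const z)).trans ?_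
  change C.scheme.presheaf.germ _ _ _ _ = C.scheme.presheaf.germ _ _ _ _
  congr 1
  change (((Scheme.ΓSpecIso (.of ℂ)).inv ≫ D.structureMap.appTop) ≫ g.appLE ⊤ ⊤ le_top) z =
    ((Scheme.ΓSpecIso (.of ℂ)).inv ≫ C.structureMap.appTop) z
  rw [← h, Scheme.Hom.comp_appTop, Category.assoc]
  congr 5
  simp [Scheme.Hom.appLE]
  rfl

/-- The order of a pulled back function is the order of the function times the ramification
index. -/
theorem exists_ord_funMap {x : C.scheme} (hx : IsClosed {g x}) :
    ∃ e : ℤ, 0 < e ∧ ∀ a : D.scheme.functionField,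
      Scheme.ord (funMap g hg a) x = e * Scheme.ord a (g x) := by
  obtain ⟨t, ht0, ht⟩ := exists_ord_eq_one hx
  have hTt : funMap g hg t ≠ 0 := (map_ne_zero _).mpr ht0
  refine ⟨Scheme.ord (funMap g hg t) x, ?_, fun a => ?_⟩
  · rw [← vanishesAt_iff hTt]
    refine VanishesAt.funMap hg ?_
    rw [vanishesAt_iff ht0, ht]
    exact one_pos
  · by_cases ha : a = 0
    · simp [ha]
    have hTa : funMap g hg a ≠ 0 := (map_ne_zero _).mpr ha
    set n := Scheme.ord a (g x)
    -- Removing a power of the uniformizer leaves a unit, and units pull back to units.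
    have hu : UnitAt (g x) (a / t ^ n) := by
      rw [unitAt_iff (div_ne_zero ha (zpow_ne_zero _ ht0)), ord_div ha (zpow_ne_zero _ ht0),
        ord_zpow ht0, ht]
      ring
    have hTu := UnitAt.funMap hg hu
    rw [map_div₀, map_zpow₀, unitAt_iff (div_ne_zero hTa (zpow_ne_zero _ hTt)),
      ord_div hTa (zpow_ne_zero _ hTt), ord_zpow hTt] at hTu
    linarith

end SmoothCurve

/-! ### The involution of the function field and its local form at fixed points. -/

namespace DoubleCover

open SmoothCurve

variable {C N : SmoothCurve} (cov : DoubleCover C N)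

theorem π_surjective : Function.Surjective cov.π := by
  have := cov.isFinite
  have := cov.flat
  have h : Surjective cov.π := by
    rw [← Scheme.Hom.one_le_finrank_iff_surjective]
    intro y
    rw [cov.degree_eq_two y]
    exact one_le_two
  exact h.surj

theorem τ_τ (x : C.scheme) : cov.τ (cov.τ x) = x := apply_apply cov.τ_comp_τ x

theorem π_τ (x : C.scheme) : cov.π (cov.τ x) = cov.π x := by
  rw [← Scheme.Hom.comp_apply, cov.τ_comp_π]

theorem τ_genericPoint : cov.τ (genericPoint C.scheme) = genericPoint C.scheme :=
  map_genericPoint_of_surjective cov.τ fun x => ⟨cov.τ x, cov.τ_τ x⟩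

theorem π_genericPoint : cov.π (genericPoint C.scheme) = genericPoint N.scheme :=
  map_genericPoint_of_surjective cov.π cov.π_surjective

/-- The involution of the function field. -/
def inv : C.scheme.functionField →+* C.scheme.functionField := funMap cov.τ cov.τ_genericPoint

/-- The embedding of the function field of the base. -/
def emb : N.scheme.functionField →+* C.scheme.functionField := funMap cov.π cov.π_genericPoint

@[simp]
theorem inv_inv (a : C.scheme.functionField) : cov.inv (cov.inv a) = a :=
  funMap_funMap cov.τ_genericPoint cov.τ_comp_τ a

@[simp]
theorem inv_emb (a : N.scheme.functionField) : cov.inv (cov.emb a) = cov.emb a := by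
  have h : (cov.τ ≫ cov.π) (genericPoint C.scheme) = genericPoint N.scheme := by
    rw [cov.τ_comp_π, cov.π_genericPoint]
  refine (funMap_comp cov.τ cov.τ_genericPoint cov.π cov.π_genericPoint h a).symm.trans ?_
  simp only [cov.τ_comp_π]
  rfl

theorem inv_ne_zero_iff {a : C.scheme.functionField} : cov.inv a ≠ 0 ↔ a ≠ 0 := map_ne_zero _

@[simp]
theorem inv_constFun (z : ℂ) : cov.inv (C.constFun z) = C.constFun z :=
  funMap_constFun cov.τ cov.τ_genericPoint (by rw [← cov.π_comp, ← Category.assoc, cov.τ_comp_π]) z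

theorem isClosed_τ_iff {x : C.scheme} : IsClosed {cov.τ x} ↔ IsClosed {x} := by
  rw [C.isClosed_iff, C.isClosed_iff, not_iff_not]
  constructor
  · intro h
    rw [← cov.τ_τ x, h, cov.τ_genericPoint]
  · rintro rfl
    exact cov.τ_genericPoint

/-- Because τ² = 1, the ramification indices of τ at x and at τ(x) multiply to 1, so both equal 1.
-/
theorem ord_inv (a : C.scheme.functionField) (x : C.scheme) :
    Scheme.ord (cov.inv a) x = Scheme.ord a (cov.τ x) := by
  rcases C.eq_genericPoint_or_isClosed x with rfl | hx
  · rw [cov.τ_genericPoint, ord_genericPoint, ord_genericPoint]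
  obtain ⟨e, he, h⟩ := exists_ord_funMap cov.τ cov.τ_genericPoint (cov.isClosed_τ_iff.mpr hx)
  obtain ⟨e', he', h'⟩ := exists_ord_funMap cov.τ cov.τ_genericPoint (x := cov.τ x)
    (by rwa [cov.τ_τ])
  have h1 : e * e' = 1 := by
    obtain ⟨t, ht0, ht⟩ := exists_ord_eq_one hx
    have := h (cov.inv t)
    change Scheme.ord (cov.inv (cov.inv t)) x = e * Scheme.ord (cov.inv t) (cov.τ x) at this
    rw [cov.inv_inv, ht] at this
    have h2 := h' t
    rw [cov.τ_τ, ht] at h2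
    rw [this]
    exact congrArg (e * ·) (h2.trans (mul_one e')).symm
  have : e = 1 := Int.eq_one_of_mul_eq_one_right he.le h1
  have h3 := h a
  rw [this, one_mul] at h3
  exact h3

/-- The functions a - τ(a) are anti-invariant. If all were zero, τ would act trivially on the
function field, and would be the identity because the curve is separated and its generic point is
dense. -/
theorem exists_inv_eq_neg : ∃ v : C.scheme.functionField, v ≠ 0 ∧ cov.inv v = -v := by
  by_contra! hv
  have hid : ∀ a, cov.inv a = a := by
    intro a
    by_contra h
    exact hv (a - cov.inv a) (sub_ne_zero.mpr (Ne.symm h)) (by rw [map_sub, cov.inv_inv]; ring)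
  apply cov.τ_ne_id
  have hd : IsDominant (C.scheme.fromSpecStalk (genericPoint C.scheme)) := by
    refine ⟨?_⟩
    refine Dense.mono (s₁ := {genericPoint C.scheme}) ?_ ?_
    · rw [Scheme.range_fromSpecStalk, Set.singleton_subset_iff]
      exact specializes_rfl
    · rw [dense_iff_closure_eq]
      exact genericPoint_closure _
  refine ext_of_isDominant_of_isSeparated C.structureMap ?_
    (C.scheme.fromSpecStalk (genericPoint C.scheme)) ?_
  · rw [← cov.π_comp, ← Category.assoc, cov.τ_comp_π, Category.id_comp]
  · rw [fromSpecStalk_comp_eq cov.τ cov.τ_genericPoint, Category.comp_id]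
    have : CommRingCat.ofHom (funMap cov.τ cov.τ_genericPoint) = 𝟙 _ := by
      ext a
      exact hid a
    rw [this, Spec.map_id, Category.id_comp]

section FixedPoint

variable {x : C.scheme}

theorem unitAt_inv_of_fixed (hτ : cov.τ x = x) {f : C.scheme.functionField} (hf : UnitAt x f) :
    UnitAt x (cov.inv f) := by
  apply UnitAt.funMap
  rwa [hτ]

/-- At a fixed point f and τ(f) take the same complex value, since τ fixes constants. -/
theorem vanishesAt_inv_sub (hx : IsClosed {x}) (hτ : cov.τ x = x)
    {f : C.scheme.functionField} (hf : RegularAt x f) :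
    VanishesAt x (f - cov.inv f) := by
  obtain ⟨z, hz⟩ := exists_vanishesAt_sub_constFun hx hf
  have h2 : VanishesAt x (cov.inv (f - C.constFun z)) := by
    apply VanishesAt.funMap
    rwa [hτ]
  rw [map_sub, inv_constFun] at h2
  have := hz.add h2.neg
  rwa [neg_sub, sub_add_sub_cancel] at this

/-- An anti-invariant v is corrected by powers of the invariant function q = t · τ(t), which has
order 2. The order of v must be odd: otherwise some u = v/q^m would be an anti-invariant unit, and u
- τ(u) = 2u would have to vanish at x. -/
theorem exists_uniformizer (hx : IsClosed {x}) (hτ : cov.τ x = x) :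
    ∃ w : C.scheme.functionField, w ≠ 0 ∧ cov.inv w = -w ∧
    Scheme.ord w x = 1 := by
  obtain ⟨v, hv0, hv⟩ := cov.exists_inv_eq_neg
  obtain ⟨t, ht0, ht⟩ := exists_ord_eq_one hx
  have hTt0 := cov.inv_ne_zero_iff.mpr ht0
  let q := t * cov.inv t
  have hq0 : q ≠ 0 := mul_ne_zero ht0 hTt0
  have hq : cov.inv q = q := by simp only [q, map_mul, inv_inv]; ring
  have hqo : Scheme.ord q x = 2 := by
    rw [Scheme.ord_mul ht0 hTt0, cov.ord_inv, hτ, ht]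
    norm_num
  have key : ∀ m : ℤ, v / q ^ m ≠ 0 ∧ cov.inv (v / q ^ m) = -(v / q ^ m) ∧
      Scheme.ord (v / q ^ m) x = Scheme.ord v x - 2 * m := by
    intro m
    refine ⟨div_ne_zero hv0 (zpow_ne_zero _ hq0), ?_, ?_⟩
    · rw [map_div₀, map_zpow₀, hq, hv, neg_div]
    · rw [ord_div hv0 (zpow_ne_zero _ hq0), ord_zpow hq0, hqo]
      ring
  rcases Int.even_or_odd' (Scheme.ord v x) with ⟨m, hm | hm⟩
  · exfalso
    obtain ⟨h0, h1, h2⟩ := key m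
    have hu : UnitAt x (v / q ^ m) := by rw [unitAt_iff h0, h2, hm, sub_self]
    have h3 := cov.vanishesAt_inv_sub hx hτ hu.regularAt
    rw [h1, sub_neg_eq_add, ← two_mul] at h3
    have h4 : UnitAt x (C.constFun 2) := unitAt_constFun two_ne_zero
    rw [map_ofNat] at h4
    exact h3.not_unitAt (h4.mul hu)
  · obtain ⟨h0, h1, h2⟩ := key m
    exact ⟨_, h0, h1, by rw [h2, hm]; ring⟩

/-- Write s = w^n · a with w an anti-invariant uniformizer and a a unit. Then w/τ(w) = -1, while
a/τ(a) has value 1 at x. -/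
theorem vanishesAt_div_inv_sub (hx : IsClosed {x}) (hτ : cov.τ x = x)
    {s : C.scheme.functionField} (hs : s ≠ 0) :
    VanishesAt x (s / cov.inv s - (-1) ^ Scheme.ord s x) := by
  obtain ⟨w, hw0, hw, hwo⟩ := cov.exists_uniformizer hx hτ
  set n := Scheme.ord s x
  set a := s / w ^ n
  have ha0 : a ≠ 0 := div_ne_zero hs (zpow_ne_zero _ hw0)
  have ha : UnitAt x a := by
    rw [unitAt_iff ha0, ord_div hs (zpow_ne_zero _ hw0), ord_zpow hw0, hwo]
    ring
  have hTa := cov.unitAt_inv_of_fixed hτ ha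
  have hs' : s = w ^ n * a := by
    simp only [a]
    field_simp
  have hneg : ((-1 : C.scheme.functionField) ^ n) * (-1) ^ n = 1 := by
    rw [← mul_zpow]; simp
  have h1 : s / cov.inv s = (-1) ^ n * (a / cov.inv a) := by
    rw [hs', map_mul, map_zpow₀, hw, neg_eq_neg_one_mul, mul_zpow]
    have h2 : ((-1 : C.scheme.functionField) ^ n) ≠ 0 := zpow_ne_zero _ (by norm_num)
    have h3 := zpow_ne_zero n hw0
    have h4 := hTa.ne_zero
    field_simp
    rw [pow_two, hneg]
  have h5 : s / cov.inv s - (-1) ^ n = (a - cov.inv a) * ((-1) ^ n * (cov.inv a)⁻¹) := by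
    rw [h1]
    have h4 := hTa.ne_zero
    field_simp
  rw [h5]
  exact (cov.vanishesAt_inv_sub hx hτ ha.regularAt).mul_regular
    (((UnitAt.one.neg).zpow n).mul hTa.inv).regularAt

end FixedPoint

/-- Hilbert's theorem 90 for the involution of the function field. -/
theorem exists_eq_div_inv {f : C.scheme.functionField} (hf : f * cov.inv f = 1) :
    ∃ b, b ≠ 0 ∧ f = b / cov.inv b := by
  have hf0 : f ≠ 0 := left_ne_zero_of_mul_eq_one hf
  -- Since f · τ(1 + f) = f + 1, the choice b = 1 + f works unless f = -1; in that case any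
  -- anti-invariant function does.
  by_cases h : 1 + f = 0
  · obtain ⟨v, hv0, hv⟩ := cov.exists_inv_eq_neg
    refine ⟨v, hv0, ?_⟩
    rw [hv, div_neg, div_self hv0]
    linear_combination h
  · refine ⟨1 + f, h, ?_⟩
    have h2 : 1 + cov.inv f ≠ 0 := by
      rw [← map_one cov.inv, ← map_add]
      exact cov.inv_ne_zero_iff.mpr h
    rw [map_add, map_one, eq_div_iff h2]
    linear_combination hf

end DoubleCover

/-! ### Linearizations and invariant divisors. -/

namespace DoubleCover

open SmoothCurve

variable {C N : SmoothCurve} (cov : DoubleCover C N) {L : LineBundle C.scheme}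

theorem exists_linearization (hL : Pic.mk L ∈ Pic.invariants cov.τ) :
    Nonempty (Linearization cov.τ L) := by
  have hL' : Pic.mk (L.pullback cov.τ) = Pic.mk L := hL
  obtain ⟨φ⟩ := Pic.mk_eq_mk_iff.mp hL'
  let σ := L.rationalSection
  obtain ⟨f, hf0, hf⟩ := φ.exists_fun (σ.pullback cov.τ cov.τ_genericPoint) σ
  have hu : ∀ x, UnitAt x (f * σ.s x / cov.inv (σ.s (cov.τ x))) := fun x => by
    have := unitAt_unitToFun (φ.mem_W x) (φ.h x)
    rwa [hf] at this
  -- The composition of φ with its pullback by τ is multiplication by f · τ(f), a function without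
  -- zeros or poles and hence a constant z. Rescaling f by a square root of z turns the composition
  -- into the identity.
  have hff : ∀ x, UnitAt x (f * cov.inv f) := fun x => by
    have h1 := UnitAt.funMap cov.τ_genericPoint (hu (cov.τ x))
    change UnitAt x (cov.inv _) at h1
    rw [map_div₀, map_mul, inv_inv, cov.τ_τ] at h1
    have h2 := (hu x).mul h1
    have h3 := σ.ne_zero x
    have h4 := cov.inv_ne_zero_iff.mpr (σ.ne_zero (cov.τ x))
    convert h2 using 1
    field_simp
  obtain ⟨z, hz⟩ := exists_eq_constFun fun x => (hff x).regularAt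
  obtain ⟨r, hr⟩ := IsAlgClosed.exists_pow_nat_eq z (n := 2) two_pos
  have hz0 : z ≠ 0 := by
    rintro rfl
    rw [map_zero] at hz
    exact (hff (genericPoint _)).ne_zero hz
  have hr0 : r ≠ 0 := by rintro rfl; exact hz0 (by rw [← hr]; norm_num)
  have hcr : C.constFun r ≠ 0 := (map_ne_zero _).mpr hr0
  obtain ⟨ψ, -⟩ := Linearization.exists_of_fun cov.τ_genericPoint cov.τ_comp_τ σ
    (f / C.constFun r) (by
      change f / C.constFun r * cov.inv (f / C.constFun r) = 1
      rw [map_div₀, inv_constFun, div_mul_div_comm, hz, ← hr, map_pow, pow_two]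
      exact div_self (mul_ne_zero hcr hcr)) (fun x => by
      have h1 := (hu x).div (unitAt_constFun (C := C) (x := x) hr0)
      convert h1 using 1
      change f / C.constFun r * σ.s x / cov.inv _ = _
      ring)
  exact ⟨ψ⟩

/-- Hilbert 90 replaces an arbitrary rational section by one that φ fixes, namely φ(τ*ρ) = ρ. -/
theorem exists_section_of_linearization (φ : Linearization cov.τ L) :
    ∃ ρ : RationalSection L, ∀ x, unitToFun (genericPoint_mem (φ.mem_W x)) (φ.h x) =
      ρ.s x / cov.inv (ρ.s (cov.τ x)) := by
  let σ := L.rationalSection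
  obtain ⟨f, hf, h⟩ := φ.exists_fun cov.τ_genericPoint cov.τ_comp_τ σ
  obtain ⟨b, hb0, rfl⟩ := cov.exists_eq_div_inv hf
  refine ⟨σ.smul b hb0, fun x => ?_⟩
  rw [h x]
  change _ = b * σ.s x / cov.inv (b * σ.s (cov.τ x))
  rw [map_mul]
  have h3 := σ.ne_zero x
  have h4 := cov.inv_ne_zero_iff.mpr (σ.ne_zero (cov.τ x))
  have h5 := cov.inv_ne_zero_iff.mpr hb0
  change b / cov.inv b * σ.s x / cov.inv (σ.s (cov.τ x)) = _
  field_simp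

theorem unitAt_section_iff (ρ : RationalSection L) (x : C.scheme) :
    UnitAt x (ρ.s x / cov.inv (ρ.s (cov.τ x))) ↔ ρ.divisor (cov.τ x) = ρ.divisor x := by
  have h3 := ρ.ne_zero x
  have h4 := cov.inv_ne_zero_iff.mpr (ρ.ne_zero (cov.τ x))
  rw [unitAt_iff (div_ne_zero h3 h4), ord_div h3 h4, cov.ord_inv, sub_eq_zero, eq_comm]
  rfl

theorem divisor_invariant_of_linearization {φ : Linearization cov.τ L} {ρ : RationalSection L}
    (h : ∀ x, unitToFun (genericPoint_mem (φ.mem_W x)) (φ.h x) =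
      ρ.s x / cov.inv (ρ.s (cov.τ x))) (x : C.scheme) :
    ρ.divisor (cov.τ x) = ρ.divisor x := by
  rw [← cov.unitAt_section_iff, ← h]
  exact unitAt_unitToFun (φ.mem_W x) _

theorem exists_linearization_of_divisor (ρ : RationalSection L)
    (hρ : ∀ x, ρ.divisor (cov.τ x) = ρ.divisor x) :
    ∃ φ : Linearization cov.τ L, ∀ x, unitToFun (genericPoint_mem (φ.mem_W x)) (φ.h x) =
      ρ.s x / cov.inv (ρ.s (cov.τ x)) := by
  obtain ⟨φ, h⟩ := Linearization.exists_of_fun cov.τ_genericPoint cov.τ_comp_τ ρ 1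
    (by rw [map_one, mul_one]) (fun x => by
      rw [one_mul]
      exact (cov.unitAt_section_iff ρ x).mpr (hρ x))
  refine ⟨φ, fun x => (h x).trans ?_⟩
  rw [one_mul]
  rfl

theorem mem_invariants_of_linearization (φ : Linearization cov.τ L) :
    Pic.mk L ∈ Pic.invariants cov.τ :=
  show Pic.mk (L.pullback cov.τ) = Pic.mk L from Pic.mk_eq_mk_iff.mpr ⟨φ.toIso⟩

theorem mem_invariants_of_divisor (ρ : RationalSection L)
    (hρ : ∀ x, ρ.divisor (cov.τ x) = ρ.divisor x) : Pic.mk L ∈ Pic.invariants cov.τ :=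
  cov.mem_invariants_of_linearization (cov.exists_linearization_of_divisor ρ hρ).choose

theorem eq_one_or_eq_neg_one {f : C.scheme.functionField} (hf : ∀ x, RegularAt x f)
    (h : f * cov.inv f = 1) : f = 1 ∨ f = -1 := by
  obtain ⟨z, rfl⟩ := exists_eq_constFun hf
  rw [inv_constFun] at h
  exact mul_self_eq_one_iff.mp h

/-- The quotient of the two defining functions is regular everywhere, so constant, and its product
with its τ-conjugate is 1; hence it is ±1. -/
theorem linearization_unique (φ ψ : Linearization cov.τ L) :
    φ.toIso.Same ψ.toIso ∨ φ.toIso.Same ψ.toIso.neg := by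
  let σ := L.rationalSection
  obtain ⟨f, hf, h⟩ := φ.exists_fun cov.τ_genericPoint cov.τ_comp_τ σ
  obtain ⟨g, hg, h'⟩ := ψ.exists_fun cov.τ_genericPoint cov.τ_comp_τ σ
  have hg0 : g ≠ 0 := left_ne_zero_of_mul_eq_one hg
  have hreg : ∀ x, RegularAt x (f / g) := fun x => by
    have h1 := unitAt_unitToFun (φ.mem_W x) (φ.h x)
    have h2 := unitAt_unitToFun (ψ.mem_W x) (ψ.h x)
    rw [h] at h1
    rw [h'] at h2
    have h3 := (h1.div h2).regularAt
    have h4 := σ.ne_zero x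
    have h5 := cov.inv_ne_zero_iff.mpr (σ.ne_zero (cov.τ x))
    convert h3 using 1
    change _ = f * σ.s x / cov.inv (σ.s (cov.τ x)) / (g * σ.s x / cov.inv (σ.s (cov.τ x)))
    field_simp
  have hfg : f / g * cov.inv (f / g) = 1 := by
    rw [map_div₀, div_mul_div_comm]
    change f * funMap _ _ f / (g * funMap _ _ g) = 1
    rw [hf, hg, div_one]
  rw [LineBundle.Iso.same_iff, LineBundle.Iso.same_iff]
  refine (cov.eq_one_or_eq_neg_one hreg hfg).imp (fun h1 x => ?_) fun h1 x => ?_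
  · rw [div_eq_one_iff_eq hg0] at h1
    rw [h, h', h1]
  · have h2 : f = -g := by
      rw [div_eq_iff hg0] at h1
      rw [h1, neg_one_mul]
    have h3 : unitToFun (genericPoint_mem (ψ.toIso.neg.mem_W x)) (ψ.toIso.neg.h x) =
        - unitToFun (genericPoint_mem (ψ.mem_W x)) (ψ.h x) :=
      map_neg (C.scheme.presheaf.germ (ψ.W x) _ _).hom _
    rw [h3, h, h', h2]
    ring

section FixedPoint

variable {x : C.scheme}

/-- Because φ fixes ρ, its scalar at x is the value of `ρ.s x` divided by its τ-conjugate. -/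
theorem fibreScalar_eq (hx : IsClosed {x}) (hτ : cov.τ x = x)
    {φ : Linearization cov.τ L} {ρ : RationalSection L}
    (h : ∀ x, unitToFun (genericPoint_mem (φ.mem_W x)) (φ.h x) =
      ρ.s x / cov.inv (ρ.s (cov.τ x))) :
    φ.fibreScalar x = (((-1 : ℤˣ) ^ ρ.divisor x : ℤˣ) : ℤ) := by
  rw [Linearization.fibreScalar_eq_iff, h, hτ]
  have := cov.vanishesAt_div_inv_sub hx hτ (ρ.ne_zero x)
  have h2 : (((((-1 : ℤˣ) ^ ρ.divisor x : ℤˣ) : ℤ)) : C.scheme.functionField) =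
      (-1) ^ ρ.divisor x := by
    rcases Int.even_or_odd (ρ.divisor x) with he | ho
    · simp [he.neg_one_zpow]
    · simp [ho.neg_one_zpow]
  rw [h2]
  exact this

end FixedPoint

/-- The residue field has 2 ≠ 0, being a ring under ℂ, so the signs stay distinct in it. -/
theorem intUnits_cast_injective (x : C.scheme) {ε δ : ℤˣ}
    (h : ((ε : ℤ) : C.scheme.residueField x) = ((δ : ℤ) : C.scheme.residueField x)) : ε = δ := by
  have h2 : (2 : C.scheme.residueField x) ≠ 0 := by
    have : (2 : C.scheme.residueField x) =
        C.scheme.residue x (C.scheme.presheaf.germ ⊤ x trivial (C.const 2)) := by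
      rw [map_ofNat, map_ofNat, map_ofNat]
    rw [this]
    exact ((((isUnit_iff_ne_zero.mpr two_ne_zero).map C.const).map
      (C.scheme.presheaf.germ ⊤ x trivial).hom).map (C.scheme.residue x).hom).ne_zero
  rcases Int.units_eq_one_or ε with rfl | rfl <;> rcases Int.units_eq_one_or δ with rfl | rfl
  · rfl
  · exfalso
    apply h2
    simp only [Units.val_one, Int.cast_one, Units.val_neg, Int.cast_neg] at h
    linear_combination h
  · exfalso
    apply h2
    simp only [Units.val_one, Int.cast_one, Units.val_neg, Int.cast_neg] at h
    linear_combination -h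
  · rfl

end DoubleCover

/-! ### Sign vectors of invariant classes and the homomorphism α. -/

open SmoothCurve

theorem SignQuotient.mk_eq_mk_of_eq_or {n : ℕ} {ε δ : Fin n → ℤˣ}
    (h : ε = δ ∨ ε = fun i => -δ i) : SignQuotient.mk ε = SignQuotient.mk δ := by
  rcases h with rfl | rfl
  · rfl
  · refine QuotientGroup.eq.mpr (Subgroup.mem_zpowers_iff.mpr ⟨1, ?_⟩)
    ext i
    simp

theorem SignQuotient.mk_eq_one {n : ℕ} {ε : Fin n → ℤˣ} (h : SignQuotient.mk ε = 1) :
    ε = 1 ∨ ε = fun _ => -1 := by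
  obtain ⟨m, hm⟩ := Subgroup.mem_zpowers_iff.mp ((QuotientGroup.eq_one_iff ε).mp h)
  rcases Int.even_or_odd m with he | ho
  · left
    rw [← hm]
    ext i
    simp [he.neg_one_zpow]
  · right
    rw [← hm]
    ext i
    simp [ho.neg_one_zpow]

theorem SmoothCurve.exists_ord_eq_of_mk_eq {C : SmoothCurve} {L M : LineBundle C.scheme}
    (h : Pic.mk L = Pic.mk M) (σ : RationalSection L) (ρ : RationalSection M) :
    ∃ f : C.scheme.functionField, f ≠ 0 ∧ ∀ x, Scheme.ord f x = σ.divisor x - ρ.divisor x := by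
  obtain ⟨f, hf⟩ := (LineBundle.Iso.nonempty_iff σ ρ).mp (Pic.mk_eq_mk_iff.mp h)
  have hf0 : f ≠ 0 := by
    rintro rfl
    exact (hf (genericPoint _)).ne_zero (by simp)
  refine ⟨f, hf0, fun x => ?_⟩
  have h1 := hf x
  have h2 := mul_ne_zero hf0 (ρ.ne_zero x)
  rw [unitAt_iff (div_ne_zero h2 (σ.ne_zero x)), ord_div h2 (σ.ne_zero x),
    Scheme.ord_mul hf0 (ρ.ne_zero x)] at h1
  change _ = Scheme.ord (σ.s x) x - Scheme.ord (ρ.s x) x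
  linarith

theorem SmoothCurve.mk_eq_of_ord {C : SmoothCurve} {L M : LineBundle C.scheme}
    (σ : RationalSection L) (ρ : RationalSection M) {f : C.scheme.functionField} (hf0 : f ≠ 0)
    (hf : ∀ x, Scheme.ord f x = σ.divisor x - ρ.divisor x) : Pic.mk L = Pic.mk M := by
  refine Pic.mk_eq_mk_iff.mpr ((LineBundle.Iso.nonempty_iff σ ρ).mpr ⟨f, fun x => ?_⟩)
  have h2 := mul_ne_zero hf0 (ρ.ne_zero x)
  rw [unitAt_iff (div_ne_zero h2 (σ.ne_zero x)), ord_div h2 (σ.ne_zero x),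
    Scheme.ord_mul hf0 (ρ.ne_zero x), hf x]
  change Scheme.ord (σ.s x) x - Scheme.ord (ρ.s x) x + Scheme.ord (ρ.s x) x -
    Scheme.ord (σ.s x) x = 0
  ring

namespace DoubleCover

variable {C N : SmoothCurve} (cov : DoubleCover C N) {n : ℕ} (p : Fin n → C.scheme)

/-- The class `c` contains an invariant divisor whose parities at the points `p i` are given by
the signs `ε i`. -/
def IsSignVector (c : Pic C.scheme) (ε : Fin n → ℤˣ) : Prop :=
  ∃ (L : LineBundle C.scheme) (ρ : RationalSection L), Pic.mk L = c ∧
    (∀ x, ρ.divisor (cov.τ x) = ρ.divisor x) ∧ ∀ i, ε i = (-1) ^ ρ.divisor (p i)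

variable {p}

theorem exists_isSignVector {c : Pic C.scheme} (hc : c ∈ Pic.invariants cov.τ) :
    ∃ ε, cov.IsSignVector p c ε := by
  obtain ⟨L, rfl⟩ : ∃ L, Pic.mk L = c := Quotient.exists_rep c
  obtain ⟨φ⟩ := cov.exists_linearization hc
  obtain ⟨ρ, hρ⟩ := cov.exists_section_of_linearization φ
  exact ⟨_, L, ρ, rfl, cov.divisor_invariant_of_linearization hρ, fun i => rfl⟩

theorem IsSignVector.mul {c d : Pic C.scheme} {ε δ : Fin n → ℤˣ}
    (hc : cov.IsSignVector p c ε) (hd : cov.IsSignVector p d δ) :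
    cov.IsSignVector p (c * d) (ε * δ) := by
  obtain ⟨L, ρ, rfl, hρ, hε⟩ := hc
  obtain ⟨M, σ, rfl, hσ, hδ⟩ := hd
  have key : ∀ x, (ρ.tensor σ).divisor x = ρ.divisor x + σ.divisor x := fun x =>
    Scheme.ord_mul (ρ.ne_zero x) (σ.ne_zero x)
  refine ⟨L.tensor M, ρ.tensor σ, rfl, fun x => ?_, fun i => ?_⟩
  · rw [key, key, hρ, hσ]
  · rw [key, zpow_add, Pi.mul_apply, hε, hδ]

section

variable (hp : ∀ i, IsClosed {p i} ∧ cov.τ (p i) = p i)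

/-- The function f/τ(f) is the constant ε, and its value at a fixed point is (-1)^ord(f); a mismatch
would make ±2 vanish there. So the parity of ord(f) is the same at every `p i`. -/
theorem parity_of_inv_eq (hp : ∀ i, IsClosed {p i} ∧ cov.τ (p i) = p i)
    {f : C.scheme.functionField} (hf : f ≠ 0) {ε : ℤˣ}
    (h : f = (ε : ℤ) * cov.inv f) (i : Fin n) : (-1 : ℤˣ) ^ Scheme.ord f (p i) = ε := by
  have h1 := cov.vanishesAt_div_inv_sub (hp i).1 (hp i).2 hf
  have h0 := cov.inv_ne_zero_iff.mpr hf
  have h2 : f / cov.inv f = (ε : ℤ) := by rw [div_eq_iff h0]; exact h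
  rw [h2] at h1
  have h4 : UnitAt (p i) (C.constFun 2) := unitAt_constFun two_ne_zero
  rw [map_ofNat] at h4
  rcases Int.units_eq_one_or ε with rfl | rfl <;>
  rcases Int.even_or_odd (Scheme.ord f (p i)) with he | ho
  · exact he.neg_one_zpow
  · exfalso
    rw [ho.neg_one_zpow] at h1
    refine h1.not_unitAt ?_
    convert h4 using 1
    norm_num
  · exfalso
    rw [he.neg_one_zpow] at h1
    refine h1.not_unitAt ?_
    convert h4.neg using 1
    norm_num
  · exact ho.neg_one_zpow

/-- Multiplying the section by an anti-invariant function keeps its divisor invariant and flips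
every parity. -/
theorem IsSignVector.neg (hp : ∀ i, IsClosed {p i} ∧ cov.τ (p i) = p i)
    {c : Pic C.scheme} {ε : Fin n → ℤˣ} (hc : cov.IsSignVector p c ε) :
    cov.IsSignVector p c fun i => -ε i := by
  obtain ⟨L, ρ, rfl, hρ, hε⟩ := hc
  obtain ⟨v, hv0, hv⟩ := cov.exists_inv_eq_neg
  have key : ∀ x, (ρ.smul v hv0).divisor x = Scheme.ord v x + ρ.divisor x := fun x =>
    Scheme.ord_mul hv0 (ρ.ne_zero x)
  have hinv : ∀ x, Scheme.ord v (cov.τ x) = Scheme.ord v x := fun x => by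
    rw [← cov.ord_inv, hv, neg_eq_neg_one_mul, Scheme.ord_mul (by norm_num) hv0]
    have : UnitAt x (-1 : C.scheme.functionField) := UnitAt.one.neg
    rw [(unitAt_iff (by norm_num)).mp this, zero_add]
  refine ⟨L, ρ.smul v hv0, rfl, fun x => ?_, fun i => ?_⟩
  · rw [key, key, hρ, hinv]
  · rw [key, zpow_add, cov.parity_of_inv_eq hp hv0 (ε := -1) (by rw [hv]; simp), ← hε, neg_one_mul]

/-- The two invariant divisors differ by div f with div f = div τ(f). So f/τ(f) is a constant sign,
which by `parity_of_inv_eq` governs all the parities of f together. -/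
theorem IsSignVector.eq_or_eq_neg (hp : ∀ i, IsClosed {p i} ∧ cov.τ (p i) = p i)
    {c : Pic C.scheme} {ε δ : Fin n → ℤˣ}
    (hε : cov.IsSignVector p c ε) (hδ : cov.IsSignVector p c δ) :
    ε = δ ∨ ε = fun i => -δ i := by
  obtain ⟨L, ρ, rfl, hρ, hε⟩ := hε
  obtain ⟨M, σ, hM, hσ, hδ⟩ := hδ
  obtain ⟨f, hf0, hf⟩ := exists_ord_eq_of_mk_eq hM.symm ρ σ
  have hTf := cov.inv_ne_zero_iff.mpr hf0
  have hu : ∀ x, RegularAt x (f / cov.inv f) := fun x => by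
    rw [regularAt_iff (div_ne_zero hf0 hTf), ord_div hf0 hTf, cov.ord_inv, hf, hf, hρ, hσ, sub_self]
  have hsign : ∀ i, ε i = (-1) ^ Scheme.ord f (p i) * δ i := fun i => by
    rw [hε, hδ, ← zpow_add, hf, sub_add_cancel]
  refine (cov.eq_one_or_eq_neg_one hu (by
    rw [map_div₀, inv_inv, div_mul_div_comm, mul_comm, div_self (mul_ne_zero hTf hf0)])).imp
    (fun h => funext fun i => ?_) fun h => funext fun i => ?_
  · rw [hsign, cov.parity_of_inv_eq hp hf0 (ε := 1), one_mul]
    rw [div_eq_iff hTf] at h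
    simpa using h
  · rw [hsign, cov.parity_of_inv_eq hp hf0 (ε := -1), neg_one_mul]
    rw [div_eq_iff hTf] at h
    simpa using h

theorem isSignVector_of_fibreScalar (hp : ∀ i, IsClosed {p i} ∧ cov.τ (p i) = p i)
    {L : LineBundle C.scheme} (φ : Linearization cov.τ L)
    {ε : Fin n → ℤˣ}
    (h : ∀ i, φ.fibreScalar (p i) = ((ε i : ℤ) : C.scheme.residueField (p i))) :
    cov.IsSignVector p (Pic.mk L) ε := by
  obtain ⟨ρ, hρ⟩ := cov.exists_section_of_linearization φ
  refine ⟨L, ρ, rfl, cov.divisor_invariant_of_linearization hρ, fun i => ?_⟩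
  refine intUnits_cast_injective (p i) ?_
  rw [← h i, cov.fibreScalar_eq (hp i).1 (hp i).2 hρ]

theorem fibreScalar_eq_one_or (hp : ∀ i, IsClosed {p i} ∧ cov.τ (p i) = p i)
    {L : LineBundle C.scheme} (φ : Linearization cov.τ L) (i : Fin n) :
    φ.fibreScalar (p i) = 1 ∨ φ.fibreScalar (p i) = -1 := by
  obtain ⟨ρ, hρ⟩ := cov.exists_section_of_linearization φ
  rw [cov.fibreScalar_eq (hp i).1 (hp i).2 hρ]
  rcases Int.units_eq_one_or ((-1 : ℤˣ) ^ ρ.divisor (p i)) with h | h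
  · left; simp [h]
  · right; simp [h]

variable (p)

/-- The homomorphism `α`. -/
def signHom (hp : ∀ i, IsClosed {p i} ∧ cov.τ (p i) = p i) :
    Pic.invariants cov.τ →* SignQuotient n :=
  -- A sign vector is chosen for each class; `IsSignVector.eq_or_eq_neg` makes its class modulo ±Id
  -- independent of the choice.
  MonoidHom.mk' (fun c => SignQuotient.mk (cov.exists_isSignVector (p := p) c.2).choose) (by
    intro c d
    have h1 := (cov.exists_isSignVector (p := p) c.2).choose_spec
    have h2 := (cov.exists_isSignVector (p := p) d.2).choose_spec
    have h3 := (cov.exists_isSignVector (p := p) (c * d).2).choose_spec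
    exact SignQuotient.mk_eq_mk_of_eq_or (h3.eq_or_eq_neg cov hp (h1.mul cov h2)))

variable {p}

theorem signHom_eq {c : Pic C.scheme} (hc : c ∈ Pic.invariants cov.τ) {ε : Fin n → ℤˣ}
    (h : cov.IsSignVector p c ε) : cov.signHom p hp ⟨c, hc⟩ = SignQuotient.mk ε :=
  SignQuotient.mk_eq_mk_of_eq_or
    ((cov.exists_isSignVector (p := p) hc).choose_spec.eq_or_eq_neg cov hp h)

theorem signHom_eq_one_iff {c : Pic C.scheme} (hc : c ∈ Pic.invariants cov.τ) :
    cov.signHom p hp ⟨c, hc⟩ = 1 ↔ cov.IsSignVector p c 1 := by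
  constructor
  · intro h
    obtain ⟨ε, hε⟩ := cov.exists_isSignVector (p := p) hc
    rw [cov.signHom_eq hp hc hε] at h
    rcases SignQuotient.mk_eq_one h with rfl | rfl
    · exact hε
    · convert hε.neg cov hp using 1
      ext i
      simp
  · intro h
    rw [cov.signHom_eq hp hc h]
    rfl

theorem isSignVector_of_isClassOfDivisor (hp : ∀ i, IsClosed {p i} ∧ cov.τ (p i) = p i)
    (hinj : Function.Injective p) (S : Finset (Fin n))
    {c : Pic C.scheme} (hc : c.IsClassOfDivisor (∑ i ∈ S, pointDivisor (p i))) :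
    c ∈ Pic.invariants cov.τ ∧ cov.IsSignVector p c fun i => if i ∈ S then -1 else 1 := by
  classical
  obtain ⟨L, σ, rfl, hσ⟩ := hc
  have hval : ∀ x, σ.divisor x = ∑ i ∈ S, if x = p i then 1 else 0 := fun x => by
    rw [hσ, Finset.sum_apply]
    refine Finset.sum_congr rfl fun i _ => ?_
    simp only [pointDivisor, Pi.single_apply]
  have hinv : ∀ x, σ.divisor (cov.τ x) = σ.divisor x := fun x => by
    rw [hval, hval]
    refine Finset.sum_congr rfl fun i _ => ?_
    have : cov.τ x = p i ↔ x = p i := by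
      constructor
      · intro h
        rw [← cov.τ_τ x, h, (hp i).2]
      · rintro rfl
        exact (hp i).2
    simp only [this]
  refine ⟨cov.mem_invariants_of_divisor σ hinv, L, σ, rfl, hinv, fun i => ?_⟩
  rw [hval]
  simp only [hinj.eq_iff, Finset.sum_ite_eq]
  split_ifs <;> simp

end

end DoubleCover

theorem SmoothCurve.exists_isClassOfDivisor {C : SmoothCurve} {n : ℕ} {p : Fin n → C.scheme}
    (hp : ∀ i, IsClosed {p i}) (S : Finset (Fin n)) :
    ∃ c : Pic C.scheme, c.IsClassOfDivisor (∑ i ∈ S, pointDivisor (p i)) := by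
  classical
  set D : C.scheme → ℤ := ∑ i ∈ S, pointDivisor (p i) with hD
  have hval : ∀ x, D x = ∑ i ∈ S, if x = p i then 1 else 0 := fun x => by
    rw [hD, Finset.sum_apply]
    refine Finset.sum_congr rfl fun i _ => ?_
    simp only [pointDivisor, Pi.single_apply]
  have hη : D (genericPoint C.scheme) = 0 := by
    rw [hval]
    refine Finset.sum_eq_zero fun i _ => if_neg fun h => ?_
    exact C.isClosed_iff.mp (hp i) h.symm
  have hfin : {x | D x ≠ 0}.Finite := by
    refine (Set.finite_range p).subset fun x hx => ?_
    by_contra h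
    refine hx ?_
    rw [hval]
    exact Finset.sum_eq_zero fun i _ => if_neg fun hi => h ⟨i, hi.symm⟩
  -- Powers of uniformizers serve as local equations of D; at the generic point the equation is 1.
  have key : ∀ x, ∃ t : C.scheme.functionField, t ≠ 0 ∧ Scheme.ord t x = D x := by
    intro x
    rcases C.eq_genericPoint_or_isClosed x with rfl | hx
    · exact ⟨1, one_ne_zero, by rw [ord_genericPoint, hη]⟩
    · obtain ⟨t, ht0, ht⟩ := exists_ord_eq_one hx
      exact ⟨t ^ D x, zpow_ne_zero _ ht0, by rw [ord_zpow ht0, ht, mul_one]⟩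
  choose s hs0 hs using key
  obtain ⟨L, σ, hσ⟩ := exists_lineBundle_of_finite s hs0 (by simpa only [hs] using hfin)
  refine ⟨Pic.mk L, L, σ, rfl, funext fun x => ?_⟩
  change Scheme.ord (σ.s x) x = D x
  rw [hσ, hs]

/-! ### Points of the curve and valuation rings of its function field. -/

theorem exists_lift_of_forall_mem_range {R S K : Type*} [CommRing R] [CommRing S] [CommRing K]
    {j : R →+* K} (hj : Function.Injective j) (g : S →+* K) (hg : ∀ s, g s ∈ j.range) :
    ∃ φ : S →+* R, j.comp φ = g := by
  let e : R ≃+* j.range := RingEquiv.ofBijective j.rangeRestrict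
    ⟨fun a b h => hj (congrArg Subtype.val h), j.rangeRestrict_surjective⟩
  refine ⟨e.symm.toRingHom.comp (g.codRestrict j.range hg), RingHom.ext fun s => ?_⟩
  exact congrArg Subtype.val (e.apply_symm_apply ⟨g s, hg s⟩)

namespace SmoothCurve

variable (C : SmoothCurve)

theorem fromSpecStalk_genericPoint_structureMap :
    C.scheme.fromSpecStalk (genericPoint C.scheme) ≫ C.structureMap =
      Spec.map (CommRingCat.ofHom C.constFun) := by
  apply ext_of_isAffine
  rw [Scheme.Hom.comp_appTop, Scheme.fromSpecStalk_appTop]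
  have : (Spec (C.scheme.presheaf.stalk (genericPoint C.scheme))).presheaf.map
      (homOfLE (le_top (a := ⊤))).op = 𝟙 _ := CategoryTheory.Functor.map_id _ _
  rw [this, Category.comp_id, ← cancel_mono (Scheme.ΓSpecIso _).hom, Category.assoc, Category.assoc,
    Iso.inv_hom_id, Category.comp_id, Scheme.ΓSpecIso_naturality]
  rw [← Iso.inv_comp_eq]
  rfl

variable {C}

/-- Every valuation ring of the function field that contains the constants dominates the local
ring of some point. -/
theorem exists_point_of_valuationRing (A : Type) [CommRing A] [IsDomain A] [ValuationRing A]
    [Algebra A C.scheme.functionField] [IsFractionRing A C.scheme.functionField]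
    (hA : ∀ z, C.constFun z ∈ (algebraMap A C.scheme.functionField).range) :
    ∃ x : C.scheme, ∀ a : C.scheme.presheaf.stalk x, ∃ b : A,
      algebraMap A C.scheme.functionField b = algebraMap _ C.scheme.functionField a ∧
        (IsUnit b ↔ IsUnit a) := by
  have hinj := IsFractionRing.injective A C.scheme.functionField
  obtain ⟨j, hj⟩ := exists_lift_of_forall_mem_range hinj C.constFun hA
  -- The valuative criterion extends the generic point Spec K → C to Spec A; the required point is
  -- the image of the closed point of Spec A.
  let S : ValuativeCommSq C.structureMap :=
    { R := A
      K := C.scheme.functionField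
      i₁ := C.scheme.fromSpecStalk (genericPoint C.scheme)
      i₂ := Spec.map (CommRingCat.ofHom j)
      commSq := ⟨by
        rw [fromSpecStalk_genericPoint_structureMap]
        have : CommRingCat.ofHom C.constFun = CommRingCat.ofHom j ≫
          CommRingCat.ofHom (algebraMap A C.scheme.functionField) := by
            ext z
            exact (congrArg (· z) hj).symm
        rw [this, Spec.map_comp]⟩ }
  have hex : ValuativeCriterion.Existence C.structureMap := by
    have h := C.isProper.toUniversallyClosed
    rw [UniversallyClosed.eq_valuativeCriterion] at h
    exact h.1
  obtain ⟨⟨l, hl, -⟩⟩ := hex S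
  change Spec (.of A) ⟶ C.scheme at l
  let x : C.scheme := l (IsLocalRing.closedPoint A)
  let ψ : C.scheme.presheaf.stalk x ⟶ CommRingCat.of A := Scheme.stalkClosedPointTo l
  have hψ : Spec.map ψ ≫ C.scheme.fromSpecStalk x = l :=
    Scheme.Spec_stalkClosedPointTo_fromSpecStalk l
  have hloc : IsLocalHom ψ.hom := Scheme.isLocalHom_stalkClosedPointTo l
  refine ⟨x, fun a => ⟨ψ a, ?_, ⟨isUnit_of_map_unit ψ.hom a, fun h => h.map ψ.hom⟩⟩⟩
  have h : ψ ≫ CommRingCat.ofHom (algebraMap A C.scheme.functionField) =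
      C.scheme.presheaf.stalkSpecializes ((genericPoint_spec C.scheme).specializes trivial) := by
    apply Spec.map_injective
    rw [← cancel_mono (C.scheme.fromSpecStalk x), Scheme.SpecMap_stalkSpecializes_fromSpecStalk,
      Spec.map_comp, Category.assoc, hψ]
    exact hl
  exact congrArg (· a) (congrArg CommRingCat.Hom.hom h)

/-- A point is determined by its local ring inside the function field. -/
theorem eq_of_forall_regularAt {x y : C.scheme}
    (h : ∀ a, RegularAt x a → RegularAt y a) (h' : ∀ a, VanishesAt x a → VanishesAt y a) :
    x = y := by
  obtain ⟨φ, hφ⟩ := exists_lift_of_forall_mem_range (stalk_injective y)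
    (algebraMap (C.scheme.presheaf.stalk x) C.scheme.functionField) fun s => h _ ⟨s, rfl⟩
  -- The inclusion φ of the local ring at x into that at y is local. By separatedness, Spec φ
  -- followed by the canonical map to the curve is the canonical map from the local ring at y, so
  -- the closed point is sent both to x and to y.
  have hloc : IsLocalHom φ := by
    refine ⟨fun a ha => ?_⟩
    by_contra hu
    have hv := h' (algebraMap _ _ a) ⟨a, hu, rfl⟩
    refine hv.not_unitAt ⟨φ a, ha, ?_⟩
    exact congrArg (· a) hφ
  have hη : ∀ z : C.scheme, Spec.map (CommRingCat.ofHom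
      (algebraMap (C.scheme.presheaf.stalk z) C.scheme.functionField)) ≫
      C.scheme.fromSpecStalk z = C.scheme.fromSpecStalk (genericPoint C.scheme) := fun z =>
    Scheme.SpecMap_stalkSpecializes_fromSpecStalk
      ((genericPoint_spec C.scheme).specializes trivial)
  have hd : IsDominant (Spec.map (CommRingCat.ofHom
      (algebraMap (C.scheme.presheaf.stalk y) C.scheme.functionField))) := by
    refine ⟨(PrimeSpectrum.denseRange_comap_iff_ker_le_nilRadical _).mpr ?_⟩
    exact ((RingHom.injective_iff_ker_eq_bot _).mp (stalk_injective y)).trans_le bot_le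
  have hK : Spec.map (CommRingCat.ofHom
      (algebraMap (C.scheme.presheaf.stalk y) C.scheme.functionField)) ≫
      Spec.map (CommRingCat.ofHom φ) ≫ C.scheme.fromSpecStalk x =
      C.scheme.fromSpecStalk (genericPoint C.scheme) := by
    rw [← Category.assoc, ← Spec.map_comp, ← CommRingCat.ofHom_comp, hφ, hη]
  have key : Spec.map (CommRingCat.ofHom φ) ≫ C.scheme.fromSpecStalk x =
      C.scheme.fromSpecStalk y := by
    refine ext_of_isDominant_of_isSeparated C.structureMap ?_ (Spec.map (CommRingCat.ofHom
      (algebraMap (C.scheme.presheaf.stalk y) C.scheme.functionField))) ?_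
    · refine ext_of_isDominant (Spec.map (CommRingCat.ofHom
        (algebraMap (C.scheme.presheaf.stalk y) C.scheme.functionField))) ?_
      rw [← Category.assoc, hK, ← Category.assoc, hη]
    · rw [hη, hK]
  have hy := congrArg (fun g => g (IsLocalRing.closedPoint (C.scheme.presheaf.stalk y))) key
  refine (Scheme.fromSpecStalk_closedPoint (x := x)).symm.trans
    (.trans ?_ (hy.trans (Scheme.fromSpecStalk_closedPoint (x := y))))
  exact congrArg (C.scheme.fromSpecStalk x) (IsLocalRing.comap_closedPoint φ).symm

end SmoothCurve

/-! ### Finiteness of the function field over ℂ(f). -/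

theorem not_isMaximal_span_X {k : Type*} [Field k] {s : ℕ} (i j : Fin s) (hij : i ≠ j) :
    ¬ (Ideal.span {(MvPolynomial.X i : MvPolynomial (Fin s) k)}).IsMaximal := by
  intro h
  have hle : Ideal.span {(MvPolynomial.X i : MvPolynomial (Fin s) k)} ≤
      RingHom.ker (MvPolynomial.constantCoeff (R := k) (σ := Fin s)) := by
    rw [Ideal.span_singleton_le_iff_mem, RingHom.mem_ker, MvPolynomial.constantCoeff_X]
  have heq := h.eq_of_le (RingHom.ker_ne_top _) hle
  have hj : (MvPolynomial.X j : MvPolynomial (Fin s) k) ∈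
      RingHom.ker (MvPolynomial.constantCoeff (R := k) (σ := Fin s)) := by
    rw [RingHom.mem_ker, MvPolynomial.constantCoeff_X]
  rw [← heq, Ideal.mem_span_singleton, MvPolynomial.X_dvd_X] at hj
  exact hij hj

/-- By Noether normalization A is integral over a polynomial ring in s variables, where s is the
transcendence degree. If s ≥ 2, a prime of A over the ideal (X_i) is nonzero but cannot be maximal,
since (X_i) is not. -/
theorem trdeg_le_one (k A : Type u) [Field k] [CommRing A] [IsDomain A] [Algebra k A]
    [Algebra.FiniteType k A] (hmax : ∀ P : Ideal A, P.IsPrime → P ≠ ⊥ → P.IsMaximal) :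
    Algebra.trdeg k A ≤ 1 := by
  obtain ⟨s, g, hg, hint⟩ := exists_integral_inj_algHom_of_fg k A
  let := g.toAlgebra
  have : Algebra.IsIntegral (MvPolynomial (Fin s) k) A := ⟨hint⟩
  have : FaithfulSMul (MvPolynomial (Fin s) k) A :=
    (faithfulSMul_iff_algebraMap_injective _ _).mpr hg
  have : IsScalarTower k (MvPolynomial (Fin s) k) A :=
    .of_algebraMap_eq fun x => (g.commutes x).symm
  have hs : s ≤ 1 := by
    by_contra! hs
    let i : Fin s := ⟨0, by omega⟩
    let j : Fin s := ⟨1, by omega⟩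
    have hprime : (Ideal.span {(MvPolynomial.X i : MvPolynomial (Fin s) k)}).IsPrime :=
      (Ideal.span_singleton_prime (MvPolynomial.X_ne_zero i)).mpr (MvPolynomial.X_prime)
    obtain ⟨Q, hQ, hQP⟩ := Ideal.exists_ideal_over_prime_of_isIntegral_of_isDomain (S := A)
      (Ideal.span {(MvPolynomial.X i : MvPolynomial (Fin s) k)}) (by
        exact ((RingHom.injective_iff_ker_eq_bot _).mp hg).trans_le bot_le)
    have hQ0 : Q ≠ ⊥ := by
      rintro rfl
      have : (MvPolynomial.X i : MvPolynomial (Fin s) k) ∈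
        Ideal.comap (algebraMap (MvPolynomial (Fin s) k) A) ⊥ := by
          rw [hQP]; exact Ideal.mem_span_singleton_self _
      rw [Ideal.mem_comap, Ideal.mem_bot] at this
      exact MvPolynomial.X_ne_zero i (hg (this.trans (map_zero _).symm))
    have := hmax Q hQ hQ0
    have := Ideal.isMaximal_comap_of_isIntegral_of_isMaximal (R := MvPolynomial (Fin s) k) Q
    rw [hQP] at this
    exact not_isMaximal_span_X i j (by simp [i, j]) this
  have h := trdeg_add_eq k (MvPolynomial (Fin s) k) (A := A)
  rw [trdeg_eq_zero (R := MvPolynomial (Fin s) k), MvPolynomial.trdeg_of_isDomain, add_zero,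
    Cardinal.mk_fin, Cardinal.lift_natCast] at h
  rw [← h]
  exact_mod_cast hs

/-- As the transcendence degree is at most one, f alone is a transcendence basis. Then K is
algebraic and finitely generated over k(f), hence finite. -/
theorem finite_adjoin_of_transcendental (k A : Type u) {K : Type u} [Field k] [CommRing A]
    [IsDomain A] [Field K]
    [Algebra k A] [Algebra A K] [IsFractionRing A K] [Algebra k K] [IsScalarTower k A K]
    [Algebra.FiniteType k A] (hmax : ∀ P : Ideal A, P.IsPrime → P ≠ ⊥ → P.IsMaximal)
    {f : K} (hf : Transcendental k f) : Module.Finite (IntermediateField.adjoin k {f}) K := by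
  have htr : Algebra.trdeg k K ≤ 1 := by
    have h := trdeg_add_eq k A (A := K)
    have : Algebra.IsAlgebraic A K := IsLocalization.isAlgebraic K (nonZeroDivisors A)
    rw [trdeg_eq_zero (R := A), add_zero] at h
    rw [← h]
    exact trdeg_le_one k A hmax
  have hb : IsTranscendenceBasis k (fun _ : Unit => f) :=
    AlgebraicIndependent.isTranscendenceBasis_of_lift_trdeg_le_of_finite
      (algebraicIndependent_unique_type_iff.mpr hf) (by simpa using htr)
  have halg : Algebra.IsAlgebraic (IntermediateField.adjoin k {f}) K := by
    have := hb.isAlgebraic_field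
    rwa [Set.range_const] at this
  have : Algebra.EssFiniteType A K := .of_isLocalization K (nonZeroDivisors A)
  have : Algebra.EssFiniteType k K := .comp k A K
  have : Algebra.EssFiniteType (IntermediateField.adjoin k {f}) K := .of_comp k _ K
  exact Algebra.finite_of_essFiniteType_of_isAlgebraic

namespace SmoothCurve

variable (C : SmoothCurve)

/-- The function field of a curve over `ℂ` as a `ℂ`-algebra. -/
abbrev algebraFunctionField : Algebra ℂ C.scheme.functionField := C.constFun.toAlgebra

attribute [local instance] algebraFunctionField

variable {C}

theorem exists_eq_constFun_of_isAlgebraic {f : C.scheme.functionField} (hf : IsAlgebraic ℂ f) :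
    ∃ z, f = C.constFun z := by
  have hint : IsIntegral ℂ f := hf.isIntegral
  have : Algebra.IsIntegral ℂ (Algebra.adjoin ℂ {f}) :=
    Algebra.IsIntegral.adjoin fun x hx => by rwa [Set.mem_singleton_iff.mp hx]
  obtain ⟨z, hz⟩ := (IsAlgClosed.algebraMap_bijective_of_isIntegral (k := ℂ)).2
    (⟨f, Algebra.self_mem_adjoin_singleton ℂ f⟩ : Algebra.adjoin ℂ {f})
  exact ⟨z, (congrArg Subtype.val hz).symm⟩

/-- Primes of Γ(V) are points of V, and every point but the generic one is closed. -/
theorem isMaximal_of_isPrime {V : C.scheme.Opens} (hV : IsAffineOpen V) (P : Ideal Γ(C.scheme, V))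
    (hP : P.IsPrime) (hP0 : P ≠ ⊥) : P.IsMaximal := by
  let P' : Spec Γ(C.scheme, V) := ⟨P, hP⟩
  have hinj : Function.Injective hV.fromSpec := hV.fromSpec.isOpenEmbedding.injective
  have : Nonempty V := ⟨⟨hV.fromSpec P', hV.range_fromSpec.le ⟨P', rfl⟩⟩⟩
  rcases C.eq_genericPoint_or_isClosed (hV.fromSpec P') with h | h
  · rw [← genericPoint_eq_of_isOpenImmersion hV.fromSpec, genericPoint_eq_bot_of_affine] at h
    exact (hP0 (congrArg PrimeSpectrum.asIdeal (hinj h))).elim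
  · refine (PrimeSpectrum.isClosed_singleton_iff_isMaximal P').mp ?_
    have := h.preimage hV.fromSpec.continuous
    rwa [← Set.image_singleton, Set.preimage_image_eq _ hinj] at this

theorem finite_adjoin {f : C.scheme.functionField} (hf : ∀ z, f ≠ C.constFun z) :
    Module.Finite (IntermediateField.adjoin ℂ {f}) C.scheme.functionField := by
  obtain ⟨V, hV, hη, -⟩ := exists_isAffineOpen_mem_and_subset
    (U := ⊤) (x := genericPoint C.scheme) trivial
  have : Nonempty V := ⟨⟨_, hη⟩⟩
  have := functionField_isFractionRing_of_isAffineOpen C.scheme V hV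
  have e : V ≤ C.structureMap ⁻¹ᵁ ⊤ := le_top
  let : Algebra ℂ Γ(C.scheme, V) :=
    ((Scheme.ΓSpecIso (.of ℂ)).inv ≫ C.structureMap.appLE ⊤ V e).hom.toAlgebra
  have : Algebra.FiniteType ℂ Γ(C.scheme, V) :=
    RingHom.FiniteType.comp (C.structureMap.finiteType_appLE (isAffineOpen_top _) hV e)
      (RingHom.FiniteType.of_surjective _
        (Scheme.ΓSpecIso (.of ℂ)).symm.commRingCatIsoToRingEquiv.surjective)
  have : IsScalarTower ℂ Γ(C.scheme, V) C.scheme.functionField := .of_algebraMap_eq fun z => by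
    have : C.structureMap.appLE ⊤ V e ≫ C.scheme.presheaf.germ V (genericPoint C.scheme) hη =
        C.structureMap.appTop ≫ C.scheme.presheaf.germ ⊤ _ trivial := by
      rw [Scheme.Hom.appLE, Category.assoc, TopCat.Presheaf.germ_res]
      rfl
    exact congrArg (fun g => ((Scheme.ΓSpecIso (.of ℂ)).inv ≫ g).hom z) this.symm
  refine finite_adjoin_of_transcendental ℂ Γ(C.scheme, V) (isMaximal_of_isPrime hV) fun h => ?_
  obtain ⟨z, hz⟩ := exists_eq_constFun_of_isAlgebraic h
  exact hf z hz

end SmoothCurve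

/-! ### Counting zeros of a function; principal divisors have degree zero. -/

/-- If the residue field at `p` is an algebraically closed field `k` contained in `R`, all inertia
degrees in the fundamental identity are one. -/
theorem sum_ramificationIdx_eq_finrank (k : Type u) {R : Type u} (F K B : Type*) [Field k]
    [IsAlgClosed k] [CommRing R] [IsDomain R] [IsPrincipalIdealRing R] [Algebra k R]
    [Field F] [Algebra R F] [IsFractionRing R F] [Field K] [Algebra F K] [Algebra R K]
    [IsScalarTower R F K] [Module.Finite F K] [Algebra.IsSeparable F K]
    [CommRing B] [IsDomain B] [Algebra R B] [Algebra B K] [IsScalarTower R B K]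
    [IsIntegralClosure B R K] (p : Ideal R) [p.IsMaximal] [Fintype (p.primesOver B)]
    (hp : Function.Surjective (algebraMap k (R ⧸ p))) :
    ∑ q : p.primesOver B, q.1.ramificationIdx R = Module.finrank F K := by
  have htf : Module.IsTorsionFree R K :=
    Module.isTorsionFree_iff_algebraMap_injective.mpr (by
      rw [IsScalarTower.algebraMap_eq R F K]
      exact (algebraMap F K).injective.comp (IsFractionRing.injective R F))
  have : Module.Finite R B := IsIntegralClosure.finite R F K B
  have : Module.Free R B := IsIntegralClosure.module_free R F K B
  rw [← IsIntegralClosure.rank R F K B, ← Ideal.sum_ramification_inertia_eq_finrank p]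
  refine Finset.sum_congr rfl fun q _ => ?_
  obtain ⟨q, hq, hqp⟩ := q
  have : q.IsMaximal := Ideal.isMaximal_of_isIntegral_of_isMaximal_comap (R := R) q (by
    rw [← Ideal.under_def, ← hqp.over]; infer_instance)
  rw [Ideal.inertiaDeg_eq_of_isMaximal p q]
  let e : k ≃+* R ⧸ p := RingEquiv.ofBijective (algebraMap k (R ⧸ p))
    ⟨(algebraMap k (R ⧸ p)).injective, hp⟩
  let : Field (R ⧸ p) := Ideal.Quotient.field p
  let : Field (B ⧸ q) := Ideal.Quotient.field q
  have hac : IsAlgClosed (R ⧸ p) :=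
    IsAlgClosed.of_ringEquiv k _ e
  have hb := IsAlgClosed.algebraMap_bijective_of_isIntegral (k := R ⧸ p) (K := B ⧸ q)
  have : Module.finrank (R ⧸ p) (B ⧸ q) = 1 := by
    rw [← (AlgEquiv.ofBijective (Algebra.ofId (R ⧸ p) (B ⧸ q)) hb).toLinearEquiv.finrank_eq]
    exact Module.finrank_self _
  simp only [this, mul_one]

namespace SmoothCurve

variable {C : SmoothCurve}

/-- The local ring of the curve at `x` is dominated by the local ring `A` of the function field. -/
def IsDominatedBy (x : C.scheme) (A : Type) [CommRing A] [Algebra A C.scheme.functionField] :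
    Prop :=
  ∀ a : C.scheme.presheaf.stalk x, ∃ b : A,
    algebraMap A C.scheme.functionField b = algebraMap _ C.scheme.functionField a ∧
      (IsUnit b ↔ IsUnit a)

namespace IsDominatedBy

variable {x : C.scheme} {A : Type} [CommRing A] [Algebra A C.scheme.functionField]
  [IsFractionRing A C.scheme.functionField]

theorem unitAt (h : IsDominatedBy x A) {u : A} (hu : IsUnit u) :
    UnitAt x (algebraMap A C.scheme.functionField u) := by
  have key : ∀ {u : A}, IsUnit u → RegularAt x (algebraMap A C.scheme.functionField u) →
      UnitAt x (algebraMap A C.scheme.functionField u) := by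
    rintro u hu ⟨a, ha⟩
    obtain ⟨b, hb, hba⟩ := h a
    obtain rfl : b = u := IsFractionRing.injective A C.scheme.functionField (hb.trans ha)
    exact ⟨a, hba.mp hu, ha⟩
  rcases C.regularAt_or_inv x (algebraMap A C.scheme.functionField u) with hr | hr
  · exact key hu hr
  · obtain ⟨u, rfl⟩ := hu
    have hinv : (algebraMap A C.scheme.functionField u)⁻¹ =
        algebraMap A C.scheme.functionField (u⁻¹ : Aˣ) := by
      apply inv_eq_of_mul_eq_one_right
      rw [← map_mul, Units.mul_inv, map_one]
    rw [hinv] at hr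
    have := (key (u⁻¹).isUnit hr).inv
    rwa [← hinv, inv_inv] at this

theorem vanishesAt (h : IsDominatedBy x A) {w : A} (hw : ¬ IsUnit w) :
    VanishesAt x (algebraMap A C.scheme.functionField w) := by
  rcases C.regularAt_or_inv x (algebraMap A C.scheme.functionField w) with ⟨a, ha⟩ | ⟨a, ha⟩
  · obtain ⟨b, hb, hba⟩ := h a
    obtain rfl : b = w := IsFractionRing.injective A C.scheme.functionField (hb.trans ha)
    exact ⟨a, fun h => hw (hba.mpr h), ha⟩
  · by_cases hw0 : w = 0
    · rw [hw0, map_zero]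
      exact .zero x
    obtain ⟨b, hb, -⟩ := h a
    refine (hw ⟨⟨w, b, ?_, ?_⟩, rfl⟩).elim
    all_goals
      apply IsFractionRing.injective A C.scheme.functionField
      rw [map_mul, hb, ha, map_one]
    · exact mul_inv_cancel₀ ((map_ne_zero_iff _ (IsFractionRing.injective A _)).mpr hw0)
    · exact inv_mul_cancel₀ ((map_ne_zero_iff _ (IsFractionRing.injective A _)).mpr hw0)

theorem vanishesAt_iff (h : IsDominatedBy x A) {w : A} :
    VanishesAt x (algebraMap A C.scheme.functionField w) ↔ ¬ IsUnit w :=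
  ⟨fun hv hu => hv.not_unitAt (h.unitAt hu), h.vanishesAt⟩

/-- If ϖ generates the maximal ideal of A and has order e > 0 at x, every function has order
divisible by e at x. A uniformizer at x has order 1, which forces e = 1. -/
theorem ord_eq [IsDomain A] (h : IsDominatedBy x A) [IsDiscreteValuationRing A] {a : A}
    (ha : a ≠ 0) :
    Scheme.ord (algebraMap A C.scheme.functionField a) x = (Ring.ord A a).toNat := by
  obtain ⟨ϖ, hϖ⟩ := IsDiscreteValuationRing.exists_irreducible A
  have hinj := IsFractionRing.injective A C.scheme.functionField
  set K := C.scheme.functionField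
  have h0 : ∀ {b : A}, b ≠ 0 → algebraMap A K b ≠ 0 := fun hb => (map_ne_zero_iff _ hinj).mpr hb
  set e := Scheme.ord (algebraMap A K ϖ) x
  have he : 0 < e :=
    (SmoothCurve.vanishesAt_iff (h0 hϖ.ne_zero)).mp (h.vanishesAt hϖ.not_isUnit)
  have hord : ∀ {b : A}, b ≠ 0 → ∃ n : ℕ, Ring.ord A b = n ∧
      Scheme.ord (algebraMap A K b) x = n * e := by
    intro b hb
    obtain ⟨n, u, rfl⟩ := IsDiscreteValuationRing.eq_unit_mul_pow_irreducible hb hϖ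
    refine ⟨n, ?_, ?_⟩
    · rw [Ring.ord_eq_addVal, IsDiscreteValuationRing.addVal_def _ u hϖ n rfl]
    · rw [map_mul, map_pow, Scheme.ord_mul (h0 u.ne_zero) (pow_ne_zero _ (h0 hϖ.ne_zero)),
        ord_pow (h0 hϖ.ne_zero), (unitAt_iff (h0 u.ne_zero)).mp (h.unitAt u.isUnit), zero_add]
  have hx : IsClosed {x} := by
    rw [C.isClosed_iff]
    rintro rfl
    exact he.ne' (ord_genericPoint _)
  have he1 : e = 1 := by
    obtain ⟨t, ht0, ht⟩ := exists_ord_eq_one hx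
    obtain ⟨b, c, hc, rfl⟩ := IsFractionRing.div_surjective (A := A) t
    have hc0 : c ≠ 0 := nonZeroDivisors.ne_zero hc
    have hb0 : b ≠ 0 := by rintro rfl; simp at ht0
    obtain ⟨n, -, hn⟩ := hord hb0
    obtain ⟨m, -, hm⟩ := hord hc0
    rw [ord_div (h0 hb0) (h0 hc0), hn, hm, ← sub_mul] at ht
    exact Int.eq_one_of_dvd_one he.le (Dvd.intro_left _ ht)
  obtain ⟨n, hn, hn'⟩ := hord ha
  rw [hn, hn', he1, mul_one]
  rfl

end IsDominatedBy

end SmoothCurve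

namespace SmoothCurve

variable {C : SmoothCurve}

/-- The nonzero primes of a Dedekind domain inside the function field correspond to points of the
curve. -/
theorem exists_point_of_prime (B : Type) [CommRing B] [IsDedekindDomain B]
    [Algebra B C.scheme.functionField] [IsFractionRing B C.scheme.functionField]
    (hB : ∀ z, C.constFun z ∈ (algebraMap B C.scheme.functionField).range)
    (q : Ideal B) [q.IsPrime] (hq : q ≠ ⊥) :
    ∃ x : C.scheme,
      (∀ b : B, VanishesAt x (algebraMap B C.scheme.functionField b) ↔ b ∈ q) ∧
      (∀ b : B, b ≠ 0 → Scheme.ord (algebraMap B C.scheme.functionField b) x =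
        (Ring.ord (Localization.AtPrime q) (algebraMap B _ b)).toNat) ∧
      ∀ y : C.scheme, (∀ b : B, RegularAt y (algebraMap B C.scheme.functionField b)) →
        (∀ b : B, VanishesAt y (algebraMap B C.scheme.functionField b) ↔ b ∈ q) → y = x := by
  set K := C.scheme.functionField
  let A := Localization.AtPrime q
  let : Algebra A K := IsLocalization.localizationAlgebraOfSubmonoidLe A K q.primeCompl
    (nonZeroDivisors B) q.primeCompl_le_nonZeroDivisors
  have : IsScalarTower B A K := IsLocalization.localization_isScalarTower_of_submonoid_le A K
    q.primeCompl (nonZeroDivisors B) q.primeCompl_le_nonZeroDivisors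
  have : IsFractionRing A K :=
    IsFractionRing.isFractionRing_of_isDomain_of_isLocalization q.primeCompl A K
  have : IsDiscreteValuationRing A :=
    IsLocalization.AtPrime.isDiscreteValuationRing_of_dedekind_domain B hq A
  obtain ⟨x, hx⟩ := exists_point_of_valuationRing (C := C) A fun z => by
    obtain ⟨b, hb⟩ := hB z
    exact ⟨algebraMap B A b, by rw [← IsScalarTower.algebraMap_apply, hb]⟩
  have hx : IsDominatedBy x A := hx
  have hu : ∀ b : B, IsUnit (algebraMap B A b) ↔ b ∉ q := fun b =>
    IsLocalization.AtPrime.isUnit_to_map_iff A q b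
  refine ⟨x, fun b => ?_, fun b hb => ?_, fun y hr hv => ?_⟩
  · rw [IsScalarTower.algebraMap_apply B A K, hx.vanishesAt_iff, hu, not_not]
  · rw [IsScalarTower.algebraMap_apply B A K]
    exact hx.ord_eq ((map_ne_zero_iff _ (IsLocalization.injective A
      q.primeCompl_le_nonZeroDivisors)).mpr hb)
  -- For uniqueness, elements outside q are units at y, so the fractions b/s making up A are regular
  -- at y, and those with b in q vanish there. Hence the local ring at y dominates that at x, and
  -- the points coincide.
  · have hs : ∀ s : q.primeCompl, UnitAt y (algebraMap B K s) := fun s =>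
      (hr s).unitAt_or_vanishesAt.resolve_right fun h => s.2 ((hv s).mp h)
    have hmk : ∀ (b : B) (s : q.primeCompl), algebraMap A K (IsLocalization.mk' A b s) =
        algebraMap B K b * (algebraMap B K s)⁻¹ := by
      intro b s
      rw [eq_mul_inv_iff_mul_eq₀ (hs s).ne_zero, IsScalarTower.algebraMap_apply B A K s, ← map_mul,
        IsLocalization.mk'_spec, ← IsScalarTower.algebraMap_apply]
    refine (eq_of_forall_regularAt (fun a ha => ?_) fun a ha => ?_).symm
    · obtain ⟨a, rfl⟩ := ha
      obtain ⟨a', ha', -⟩ := hx a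
      obtain ⟨b, s, rfl⟩ := IsLocalization.exists_mk'_eq q.primeCompl a'
      rw [← ha', hmk]
      exact (hr b).mul (hs s).inv.regularAt
    · obtain ⟨a, hau, rfl⟩ := ha
      obtain ⟨a', ha', hu'⟩ := hx a
      obtain ⟨b, s, rfl⟩ := IsLocalization.exists_mk'_eq q.primeCompl a'
      rw [← ha', hmk]
      refine ((hv b).mpr ?_).mul_regular (hs s).inv.regularAt
      by_contra hb
      exact hau (hu'.mp ((IsLocalization.AtPrime.isUnit_mk'_iff A q b s).mpr hb))

theorem regularAt_of_isIntegral {R : Type*} [CommRing R] [Algebra R C.scheme.functionField]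
    {x : C.scheme} (hx : IsClosed {x})
    (hR : ∀ r : R, RegularAt x (algebraMap R C.scheme.functionField r))
    {b : C.scheme.functionField} (hb : IsIntegral R b) : RegularAt x b := by
  obtain ⟨φ, hφ⟩ := exists_lift_of_forall_mem_range (stalk_injective x)
    (algebraMap R C.scheme.functionField) hR
  obtain ⟨P, hP, hPb⟩ := hb
  have := C.isDiscreteValuationRing_of_isClosed hx
  refine (IsIntegrallyClosed.isIntegral_iff (R := C.scheme.presheaf.stalk x)).mp
    ⟨P.map φ, hP.map φ, ?_⟩
  rw [Polynomial.eval₂_map, hφ, hPb]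

/-- The intended case is R = ℂ[f], F = ℂ(f) and B the integral closure of R in K. Zeros of f
correspond to primes of B over (f), orders to ramification indices, and the fundamental identity
with all inertia degrees one gives the sum. The hypothesis `hR` puts B inside the local ring at each
zero. -/
theorem finsum_max_ord_eq_finrank_of_dedekind {R : Type} (F B : Type) [CommRing R] [IsDomain R]
    [IsPrincipalIdealRing R] [Algebra ℂ R] [Field F] [Algebra R F] [IsFractionRing R F]
    [Algebra F C.scheme.functionField] [Algebra R C.scheme.functionField]
    [IsScalarTower R F C.scheme.functionField] [Module.Finite F C.scheme.functionField]
    [Algebra.IsSeparable F C.scheme.functionField] [CommRing B] [IsDedekindDomain B] [Algebra R B]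
    [Algebra B C.scheme.functionField] [IsScalarTower R B C.scheme.functionField]
    [IsIntegralClosure B R C.scheme.functionField] [IsFractionRing B C.scheme.functionField]
    {f : R} (hf : algebraMap R C.scheme.functionField f ≠ 0) (hmax : (Ideal.span {f}).IsMaximal)
    (hconst : ∀ z, algebraMap R C.scheme.functionField (algebraMap ℂ R z) = C.constFun z)
    (hsurj : Function.Surjective (algebraMap ℂ (R ⧸ Ideal.span {f})))
    (hR : ∀ x, RegularAt x (algebraMap R C.scheme.functionField f) →
      ∀ r : R, RegularAt x (algebraMap R C.scheme.functionField r)) :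
    ∑ᶠ x, max (Scheme.ord (algebraMap R C.scheme.functionField f) x) 0 =
      Module.finrank F C.scheme.functionField := by
  have : Module.Finite R B := IsIntegralClosure.finite R F C.scheme.functionField B
  let : Fintype ((Ideal.span {f}).primesOver B) :=
    (Algebra.QuasiFinite.finite_primesOver (Ideal.span {f})).fintype
  rw [← sum_ramificationIdx_eq_finrank ℂ F C.scheme.functionField B (Ideal.span {f}) hsurj]
  have hf₁ : algebraMap B C.scheme.functionField (algebraMap R B f) =
    algebraMap R C.scheme.functionField f := (IsScalarTower.algebraMap_apply R B _ f).symm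
  have hf₁0 : algebraMap R B f ≠ 0 := fun h => hf (by rw [← hf₁, h, map_zero])
  have hmem : ∀ q : (Ideal.span {f}).primesOver B, algebraMap R B f ∈ q.1 := fun q => by
    have h : f ∈ Ideal.span {f} := Ideal.mem_span_singleton_self _
    rw [q.2.2.over] at h
    exact h
  have hq0 : ∀ q : (Ideal.span {f}).primesOver B, q.1 ≠ ⊥ := fun q h =>
    hf₁0 (by simpa [h] using hmem q)
  have hex := fun q : (Ideal.span {f}).primesOver B =>
    have : q.1.IsPrime := q.2.1
    exists_point_of_prime (C := C) B (fun z => ⟨algebraMap R B (algebraMap ℂ R z), by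
      rw [← IsScalarTower.algebraMap_apply, hconst]⟩) q.1 (hq0 q)
  choose Φ hΦv hΦo hΦu using hex
  have hord : ∀ q, Scheme.ord (algebraMap R C.scheme.functionField f) (Φ q) =
      q.1.ramificationIdx R := by
    intro q
    have := q.2.1
    have := q.2.2
    rw [← hf₁, hΦo q _ hf₁0, Ideal.ramificationIdx_eq (Ideal.span {f})]
    rw [Ideal.map_span, Set.image_singleton, ← IsScalarTower.algebraMap_apply]
    rfl
  have hinj : Function.Injective Φ := by
    intro q q' h
    ext b
    rw [← hΦv, ← hΦv, h]
  have hrange : ∀ x, 0 < Scheme.ord (algebraMap R C.scheme.functionField f) x → ∃ q, Φ q = x := by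
    intro x hx
    have hcl : IsClosed {x} := C.isClosed_iff.mpr fun h => by simp [h, ord_genericPoint] at hx
    have hv : VanishesAt x (algebraMap R C.scheme.functionField f) := (vanishesAt_iff hf).mpr hx
    have hB : ∀ b : B, RegularAt x (algebraMap B C.scheme.functionField b) := fun b =>
      regularAt_of_isIntegral hcl (hR x hv.regularAt)
        ((IsIntegralClosure.isIntegral_iff (A := B)).mpr ⟨b, rfl⟩)
    obtain ⟨φ, hφ⟩ := exists_lift_of_forall_mem_range (stalk_injective x)
      (algebraMap B C.scheme.functionField) hB
    have hφv : ∀ b : B, VanishesAt x (algebraMap B C.scheme.functionField b) ↔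
        b ∈ (IsLocalRing.maximalIdeal (C.scheme.presheaf.stalk x)).comap φ := by
      intro b
      rw [← hφ]
      constructor
      · rintro ⟨a, ha, hab⟩
        rwa [stalk_injective x hab] at ha
      · exact fun h => ⟨φ b, h, rfl⟩
    have hprime : ((IsLocalRing.maximalIdeal (C.scheme.presheaf.stalk x)).comap φ).IsPrime :=
      inferInstance
    have hover : ((IsLocalRing.maximalIdeal (C.scheme.presheaf.stalk x)).comap φ).LiesOver
        (Ideal.span {f}) := by
      refine ⟨hmax.eq_of_le (Ideal.IsPrime.ne_top inferInstance) ?_⟩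
      rw [Ideal.span_singleton_le_iff_mem, Ideal.mem_comap, ← hφv, hf₁]
      exact hv
    exact ⟨⟨_, hprime, hover⟩, (hΦu ⟨_, hprime, hover⟩ x hB hφv).symm⟩
  rw [finsum_eq_sum_of_support_subset (s := Finset.univ.map ⟨Φ, hinj⟩), Finset.sum_map]
  · push_cast
    refine Finset.sum_congr rfl fun q _ => ?_
    rw [Function.Embedding.coeFn_mk, hord, max_eq_left (Nat.cast_nonneg _)]
  · intro x hx
    obtain ⟨q, rfl⟩ := hrange x (by
      by_contra h
      exact hx (max_eq_right (not_lt.mp h)))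
    simp

attribute [local instance] algebraFunctionField

open IntermediateField.algebraAdjoinAdjoin in
/-- The number of zeros of a nonconstant function `f` is the degree of the field extension
`K / ℂ(f)`. -/
theorem finsum_max_ord_eq_finrank {f : C.scheme.functionField} (hf : ∀ z, f ≠ C.constFun z) :
    ∑ᶠ x, max (Scheme.ord f x) 0 =
      Module.finrank (IntermediateField.adjoin ℂ {f}) C.scheme.functionField := by
  have hft : Transcendental ℂ f := fun h => by
    obtain ⟨z, hz⟩ := exists_eq_constFun_of_isAlgebraic h
    exact hf z hz
  have hf0 : f ≠ 0 := fun h => hf 0 (by rw [h, map_zero])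
  let R := Algebra.adjoin ℂ {f}
  let F := IntermediateField.adjoin ℂ {f}
  let B := integralClosure R C.scheme.functionField
  let e : Polynomial ℂ ≃ₐ[ℂ] R := Polynomial.algEquivOfTranscendental ℂ f hft
  let f₀ : R := ⟨f, Algebra.self_mem_adjoin_singleton ℂ f⟩
  have heX : e Polynomial.X = f₀ := Polynomial.algEquivOfTranscendental_apply_X ..
  have : IsPrincipalIdealRing R := IsPrincipalIdealRing.of_surjective e.toRingHom e.surjective
  have : Module.Finite F C.scheme.functionField := finite_adjoin hf
  have : CharZero F := charZero_of_injective_algebraMap (algebraMap ℂ F).injective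
  have : IsFractionRing B C.scheme.functionField :=
    IsIntegralClosure.isFractionRing_of_finite_extension R F C.scheme.functionField B
  have : IsDedekindDomain B := IsIntegralClosure.isDedekindDomain R F C.scheme.functionField B
  refine finsum_max_ord_eq_finrank_of_dedekind (R := R) F B (f := f₀) hf0 ?_ (fun _ => rfl) ?_
    fun x hx r => ?_
  · apply PrincipalIdealRing.isMaximal_of_irreducible
    rw [← heX]
    exact (MulEquiv.irreducible_iff e).mpr Polynomial.irreducible_X
  · intro r
    obtain ⟨r, rfl⟩ := Ideal.Quotient.mk_surjective r
    obtain ⟨g, rfl⟩ := e.surjective r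
    -- Modulo f, a polynomial in f equals its constant term.
    refine ⟨g.coeff 0, ?_⟩
    rw [IsScalarTower.algebraMap_apply ℂ R, Ideal.Quotient.algebraMap_eq, Ideal.Quotient.eq,
      Ideal.mem_span_singleton]
    have hg := congrArg e (Polynomial.X_mul_divX_add g)
    rw [map_add, map_mul, heX, ← Polynomial.algebraMap_eq, e.commutes] at hg
    exact ⟨- e g.divX, by rw [← hg]; ring⟩
  · refine Algebra.adjoin_induction (p := fun r _ => RegularAt x r) ?_ ?_ ?_ ?_ r.2
    · rintro _ rfl
      exact hx
    · exact fun z => regularAt_constFun z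
    · exact fun _ _ _ _ ha hb => ha.add hb
    · exact fun _ _ _ _ ha hb => ha.mul hb

/-- Principal divisors have degree zero. -/
theorem finsum_ord_eq_zero (f : C.scheme.functionField) : ∑ᶠ x, Scheme.ord f x = 0 := by
  by_cases hf : ∃ z, f = C.constFun z
  · obtain ⟨z, rfl⟩ := hf
    simp [ord_constFun]
  push Not at hf
  have hfin : ∀ f : C.scheme.functionField,
      (Function.support fun x => max (Scheme.ord f x) 0).Finite := fun f =>
    (finite_support_ord f).subset fun x hx h => hx (by simp [h])
  have hinv : ∀ z, f⁻¹ ≠ C.constFun z := fun z h => hf z⁻¹ (by rw [map_inv₀, ← h, inv_inv])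
  -- The poles of f are the zeros of its inverse, which generates the same subfield; both counts are
  -- therefore the same degree.
  have hadj : IntermediateField.adjoin ℂ {f⁻¹} = IntermediateField.adjoin ℂ {f} := by
    apply le_antisymm <;> rw [IntermediateField.adjoin_simple_le_iff]
    · exact inv_mem (IntermediateField.mem_adjoin_simple_self ℂ f)
    · exact inv_mem_iff.mp (IntermediateField.mem_adjoin_simple_self ℂ f⁻¹)
  have h := (finsum_max_ord_eq_finrank hf).symm
  rw [← hadj, ← finsum_max_ord_eq_finrank hinv] at h
  have hsub : (fun x => Scheme.ord f x) =
      fun x => max (Scheme.ord f x) 0 - max (Scheme.ord f⁻¹ x) 0 := by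
    ext x
    rw [ord_inv]
    omega
  rw [hsub, finsum_sub_distrib (hfin f) (hfin f⁻¹), h, sub_self]

end SmoothCurve

/-! ### Parity of the degree of an invariant divisor. -/

/-- Modulo two, the sum of an invariant function is the sum over the fixed points. -/
theorem neg_one_zpow_finsum_of_involutive {X : Type*} {n : ℕ} {t : X → X}
    (ht : Function.Involutive t) {p : Fin n → X} (hinj : Function.Injective p) {D : X → ℤ}
    (hD : (Function.support D).Finite) (hinv : ∀ x, D (t x) = D x)
    (hfix : ∀ i, t (p i) = p i) (hp : ∀ x, t x = x → D x ≠ 0 → x ∈ Set.range p) :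
    (-1 : ℤˣ) ^ ∑ᶠ x, D x = ∏ i, (-1 : ℤˣ) ^ D (p i) := by
  classical
  let S := hD.toFinset
  have hS : ∀ x, x ∈ S ↔ D x ≠ 0 := fun x => hD.mem_toFinset
  let I := Finset.univ.image p
  have hI : ∀ x, x ∈ I ↔ x ∈ Set.range p := fun x => by simp [I]
  have hdisj : Disjoint (S \ I) I := Finset.sdiff_disjoint
  rw [finsum_eq_sum_of_support_subset (s := (S \ I) ∪ I) D fun x hx => by
      rw [Finset.sdiff_union_self_eq_union]
      exact Finset.mem_coe.mpr (Finset.mem_union_left _ ((hS x).mpr hx))]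
  have hzpow : ∀ T : Finset X, (-1 : ℤˣ) ^ ∑ x ∈ T, D x = ∏ x ∈ T, (-1 : ℤˣ) ^ D x := fun T => by
    induction T using Finset.induction_on with
    | empty => simp
    | insert a T ha ih => rw [Finset.sum_insert ha, Finset.prod_insert ha, zpow_add, ih]
  rw [hzpow, Finset.prod_union hdisj, Finset.prod_image fun _ _ _ _ h => hinj h]
  convert one_mul _
  -- Away from the points `p i`, the involution has no fixed point in the support of D and pairs
  -- equal signs, whose product is 1.
  refine Finset.prod_involution (fun x _ => t x) (fun x _ => ?_) (fun x hx _ h => ?_)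
    (fun x hx => ?_) fun x _ => ht x
  · rw [hinv, ← zpow_add, Even.neg_one_zpow ⟨_, rfl⟩]
  · rw [Finset.mem_sdiff, hS, hI] at hx
    exact hx.2 (hp x h hx.1)
  · rw [Finset.mem_sdiff, hS, hI] at hx ⊢
    refine ⟨by rw [hinv]; exact hx.1, fun ⟨i, hi⟩ => hx.2 ⟨i, ?_⟩⟩
    rw [← ht x, ← hi, hfix]

theorem SmoothCurve.exists_hasDegree {C : SmoothCurve} (c : Pic C.scheme) : ∃ n, c.HasDegree n := by
  obtain ⟨L, rfl⟩ : ∃ L, Pic.mk L = c := Quotient.exists_rep c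
  exact ⟨_, L, L.rationalSection, rfl, finite_support_divisor _, rfl⟩

theorem SmoothCurve.finsum_divisor_eq {C : SmoothCurve} {L M : LineBundle C.scheme}
    (h : Pic.mk L = Pic.mk M) (σ : RationalSection L) (ρ : RationalSection M) :
    ∑ᶠ x, σ.divisor x = ∑ᶠ x, ρ.divisor x := by
  obtain ⟨f, -, hf⟩ := exists_ord_eq_of_mk_eq h σ ρ
  rw [← sub_eq_zero, ← finsum_sub_distrib (finite_support_divisor σ) (finite_support_divisor ρ),
    ← finsum_ord_eq_zero f]
  exact finsum_congr fun x => (hf x).symm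

namespace DoubleCover

open SmoothCurve

variable {C N : SmoothCurve} (cov : DoubleCover C N) {n : ℕ} {p : Fin n → C.scheme}

theorem prod_eq_neg_one_zpow_of_hasDegree (hinj : Function.Injective p)
    (hp : Set.range p = {x | IsClosed {x} ∧ cov.τ x = x}) {c : Pic C.scheme} {ε : Fin n → ℤˣ}
    (hc : cov.IsSignVector p c ε) {m : ℤ} (hm : c.HasDegree m) : ∏ i, ε i = (-1) ^ m := by
  obtain ⟨L, ρ, rfl, hρ, hε⟩ := hc
  obtain ⟨M, σ, hM, -, rfl⟩ := hm
  rw [finsum_divisor_eq hM σ ρ, neg_one_zpow_finsum_of_involutive cov.τ_τ hinj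
    (finite_support_divisor ρ) hρ (fun i => (hp.le ⟨i, rfl⟩).2) fun x hx h0 => ?_]
  · exact Finset.prod_congr rfl fun i _ => hε i
  -- The generic point is fixed by τ too, but divisors are zero there.
  · refine hp.ge ⟨C.isClosed_iff.mpr ?_, hx⟩
    rintro rfl
    exact h0 (ord_genericPoint _)

end DoubleCover

/-! ### The function field of the cover has degree two over that of the base. -/

theorem rankAtStalk_eq_finrank_of_isDomain {A M : Type u} [CommRing A] [IsDomain A] [AddCommGroup M]
    [Module A M] (p : PrimeSpectrum A) : Module.rankAtStalk M p = Module.finrank A M := by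
  have h := p.asIdeal.primeCompl_le_nonZeroDivisors
  rw [Module.rankAtStalk, Module.finrank, Module.finrank,
    IsLocalization.rank_eq (Localization.AtPrime p.asIdeal) p.asIdeal.primeCompl h,
    IsLocalizedModule.rank_eq p.asIdeal.primeCompl h
      (LocalizedModule.mkLinearMap p.asIdeal.primeCompl M)]

namespace DoubleCover

open SmoothCurve

variable {C N : SmoothCurve} (cov : DoubleCover C N)

theorem finrank_functionField :
    letI := cov.emb.toAlgebra
    Module.finrank N.scheme.functionField C.scheme.functionField = 2 := by
  have := cov.isFinite
  have := cov.flat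
  obtain ⟨V, hV, hη, -⟩ := exists_isAffineOpen_mem_and_subset
    (U := ⊤) (x := genericPoint N.scheme) trivial
  have hU : IsAffineOpen (cov.π ⁻¹ᵁ V) := hV.preimage cov.π
  have hηU : genericPoint C.scheme ∈ cov.π ⁻¹ᵁ V := by
    change cov.π _ ∈ V
    rwa [cov.π_genericPoint]
  have : Nonempty V := ⟨⟨_, hη⟩⟩
  have : Nonempty (cov.π ⁻¹ᵁ V) := ⟨⟨_, hηU⟩⟩
  have := functionField_isFractionRing_of_isAffineOpen N.scheme V hV
  have := functionField_isFractionRing_of_isAffineOpen C.scheme (cov.π ⁻¹ᵁ V) hU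
  let : Algebra Γ(N.scheme, V) Γ(C.scheme, cov.π ⁻¹ᵁ V) := (cov.π.appLE V _ le_rfl).hom.toAlgebra
  have hfin : Module.Finite Γ(N.scheme, V) Γ(C.scheme, cov.π ⁻¹ᵁ V) := by
    have := cov.π.finite_app V hV
    rw [← Scheme.Hom.appLE_eq_app] at this
    exact this
  have hflat : Module.Flat Γ(N.scheme, V) Γ(C.scheme, cov.π ⁻¹ᵁ V) :=
    cov.π.flat_appLE hV hU le_rfl
  have hcomm := IsAffineOpen.SpecMap_appLE_fromSpec cov.π hV hU le_rfl
  -- The degree of π is stable under base change, so on an affine V it is the rank of Γ(π⁻¹V) over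
  -- Γ(V), and hence the degree of the fraction fields.
  have hpb : IsPullback (Spec.map (cov.π.appLE V _ le_rfl)) hU.fromSpec hV.fromSpec cov.π :=
    IsOpenImmersion.isPullback _ _ _ _ hcomm.symm (by simp)
  have hrank := Scheme.Hom.finrank_of_isPullback _ _ _ _ hpb.flip (genericPoint _)
  rw [cov.degree_eq_two] at hrank
  have h2 := Scheme.Hom.finrank_SpecMap_algebraMap Γ(N.scheme, V) Γ(C.scheme, cov.π ⁻¹ᵁ V)
    (genericPoint (Spec Γ(N.scheme, V)))
  have h3 : Module.finrank Γ(N.scheme, V) Γ(C.scheme, cov.π ⁻¹ᵁ V) = 2 :=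
    (rankAtStalk_eq_finrank_of_isDomain _).symm.trans (h2.symm.trans hrank)
  let := cov.emb.toAlgebra
  let : Algebra Γ(N.scheme, V) C.scheme.functionField :=
    ((algebraMap Γ(C.scheme, cov.π ⁻¹ᵁ V) C.scheme.functionField).comp
      (algebraMap Γ(N.scheme, V) Γ(C.scheme, cov.π ⁻¹ᵁ V))).toAlgebra
  have : IsScalarTower Γ(N.scheme, V) Γ(C.scheme, cov.π ⁻¹ᵁ V) C.scheme.functionField :=
    .of_algebraMap_eq fun _ => rfl
  have : IsScalarTower Γ(N.scheme, V) N.scheme.functionField C.scheme.functionField :=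
    .of_algebraMap_eq fun a => (funMap_germ cov.π cov.π_genericPoint hη le_rfl hηU a).symm
  have hinj : FaithfulSMul Γ(N.scheme, V) Γ(C.scheme, cov.π ⁻¹ᵁ V) := by
    rw [faithfulSMul_iff_algebraMap_injective]
    have h : Function.Injective (algebraMap Γ(N.scheme, V) C.scheme.functionField) := by
      rw [IsScalarTower.algebraMap_eq _ N.scheme.functionField]
      exact (algebraMap N.scheme.functionField C.scheme.functionField).injective.comp
        (IsFractionRing.injective _ _)
    rw [IsScalarTower.algebraMap_eq _ Γ(C.scheme, cov.π ⁻¹ᵁ V)] at h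
    exact Function.Injective.of_comp (f := algebraMap Γ(C.scheme, cov.π ⁻¹ᵁ V) _) h
  rw [IsFractionRing.finrank_eq Γ(N.scheme, V) N.scheme.functionField
    Γ(C.scheme, cov.π ⁻¹ᵁ V) C.scheme.functionField, h3]

/-- The invariant functions on the cover are the functions on the base. -/
theorem exists_emb_eq {a : C.scheme.functionField} (ha : cov.inv a = a) : ∃ b, cov.emb b = a := by
  by_contra! hb
  obtain ⟨v, hv0, hv⟩ := cov.exists_inv_eq_neg
  have : CharZero C.scheme.functionField := charZero_of_injective_ringHom C.constFun.injective
  have h2 := cov.finrank_functionField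
  let := cov.emb.toAlgebra
  have : Module.Finite N.scheme.functionField C.scheme.functionField :=
    Module.finite_of_finrank_pos (by rw [h2]; exact two_pos)
  -- Applying τ to a relation splits off the term in the anti-invariant v. An invariant a not coming
  -- from N would thus make 1, a, v independent in a space of dimension two.
  have hli : LinearIndependent N.scheme.functionField ![1, a, v] := by
    rw [Fintype.linearIndependent_iff]
    intro g hg
    have hg1 : cov.emb (g 0) + cov.emb (g 1) * a + cov.emb (g 2) * v = 0 := by
      rw [Fin.sum_univ_three] at hg
      simp only [Algebra.smul_def, Matrix.cons_val] at hg
      rwa [mul_one] at hg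
    have hg2 := congrArg cov.inv hg1
    simp only [map_add, map_mul, inv_emb, ha, hv, map_zero] at hg2
    have h2v : cov.emb (g 2) * v = 0 := by linear_combination (hg1 - hg2) / 2
    have h01 : cov.emb (g 0) + cov.emb (g 1) * a = 0 := by linear_combination hg1 - h2v
    have g2 : g 2 = 0 := (map_eq_zero _).mp ((mul_eq_zero.mp h2v).resolve_right hv0)
    have g1 : g 1 = 0 := by
      by_contra h1
      have h1' : cov.emb (g 1) ≠ 0 := (map_ne_zero _).mpr h1
      refine hb (-g 0 / g 1) ?_
      rw [map_div₀, map_neg, div_eq_iff h1']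
      linear_combination -h01
    have g0 : g 0 = 0 := by
      rw [g1, map_zero, zero_mul, add_zero] at h01
      exact (map_eq_zero _).mp h01
    intro i
    fin_cases i
    exacts [g0, g1, g2]
  have := hli.fintype_card_le_finrank
  rw [h2] at this
  simp at this

end DoubleCover

/-! ### Separating points by functions on an affine open set. -/

namespace SmoothCurve

variable {C : SmoothCurve}

theorem vanishesAt_germ_iff {U : C.scheme.Opens} (hU : IsAffineOpen U)
    (hη : genericPoint C.scheme ∈ U) {x : C.scheme} (hx : x ∈ U) (s : Γ(C.scheme, U)) :
    VanishesAt x (C.scheme.presheaf.germ U _ hη s) ↔ s ∈ (hU.primeIdealOf ⟨x, hx⟩).asIdeal := by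
  let : Algebra Γ(C.scheme, U) (C.scheme.presheaf.stalk x) :=
    (C.scheme.presheaf.germ U x hx).hom.toAlgebra
  have : IsLocalization.AtPrime (C.scheme.presheaf.stalk x) (hU.primeIdealOf ⟨x, hx⟩).asIdeal :=
    hU.isLocalization_stalk ⟨x, hx⟩
  have h := IsLocalization.AtPrime.to_map_mem_maximal_iff (C.scheme.presheaf.stalk x)
    (hU.primeIdealOf ⟨x, hx⟩).asIdeal s
  rw [← h, ← algebraMap_germ hx]
  constructor
  · rintro ⟨a, ha, hab⟩
    rwa [stalk_injective x hab] at ha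
  · exact fun h => ⟨_, h, rfl⟩

/-- If the prime were zero, every nonzero section over U, and so every nonzero rational function,
would be a unit at x. A uniformizer contradicts this. -/
theorem isMaximal_primeIdealOf {U : C.scheme.Opens} (hU : IsAffineOpen U) {x : C.scheme}
    (hx : x ∈ U) (hcl : IsClosed {x}) : (hU.primeIdealOf ⟨x, hx⟩).asIdeal.IsMaximal := by
  refine isMaximal_of_isPrime hU _ (hU.primeIdealOf ⟨x, hx⟩).isPrime fun h => ?_
  have hη := genericPoint_mem hx
  have : Nonempty U := ⟨⟨_, hη⟩⟩
  have := functionField_isFractionRing_of_isAffineOpen C.scheme U hU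
  obtain ⟨t, ht0, ht⟩ := exists_ord_eq_one hcl
  obtain ⟨a, b, hb, rfl⟩ := IsFractionRing.div_surjective (A := Γ(C.scheme, U)) t
  have key : ∀ a : Γ(C.scheme, U), a ≠ 0 →
      UnitAt x (algebraMap Γ(C.scheme, U) C.scheme.functionField a) := by
    intro a ha
    have hr : RegularAt x (algebraMap Γ(C.scheme, U) C.scheme.functionField a) :=
      ⟨_, algebraMap_germ hx a⟩
    refine hr.unitAt_or_vanishesAt.resolve_right fun hv => ha ?_
    have := (vanishesAt_germ_iff hU hη hx a).mp hv
    rwa [h, Ideal.mem_bot] at this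
  have ha0 : a ≠ 0 := by rintro rfl; simp at ht0
  have hu := (key a ha0).div (key b (nonZeroDivisors.ne_zero hb))
  rw [unitAt_iff ht0, ht] at hu
  exact one_ne_zero hu

/-- Distinct points of an affine open set are separated by functions. -/
theorem exists_separating {U : C.scheme.Opens} (hU : IsAffineOpen U) {x y : C.scheme} (hx : x ∈ U)
    (hy : y ∈ U) (hxc : IsClosed {x}) (hyc : IsClosed {y}) (hne : x ≠ y) :
    ∃ c : C.scheme.functionField, (∀ z ∈ U, RegularAt z c) ∧ VanishesAt x c ∧
      VanishesAt y (1 - c) := by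
  have hmx := isMaximal_primeIdealOf hU hx hxc
  have hmy := isMaximal_primeIdealOf hU hy hyc
  have hne' : (hU.primeIdealOf ⟨x, hx⟩).asIdeal ≠ (hU.primeIdealOf ⟨y, hy⟩).asIdeal := by
    intro h
    have h1 := congrArg hU.fromSpec (PrimeSpectrum.ext h)
    rw [hU.fromSpec_primeIdealOf, hU.fromSpec_primeIdealOf] at h1
    exact hne h1
  obtain ⟨a, ha, b, hb, hab⟩ := Submodule.mem_sup.mp
    ((Ideal.eq_top_iff_one _).mp (Ideal.isCoprime_iff_sup_eq.mp
      (Ideal.isCoprime_of_isMaximal hne')))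
  have hη := genericPoint_mem hx
  refine ⟨C.scheme.presheaf.germ U _ hη a, fun z hz => ⟨_, algebraMap_germ hz a⟩,
    (vanishesAt_germ_iff hU hη hx a).mpr ha, ?_⟩
  have := (vanishesAt_germ_iff hU hη hy b).mpr hb
  rwa [← add_sub_cancel_left a b, hab, map_sub, map_one] at this

end SmoothCurve

theorem VanishesAt.unitAt_of_one_sub {X : Scheme.{u}} [IsIntegral X] {x : X} {c : X.functionField}
    (h : VanishesAt x (1 - c)) : UnitAt x c := by
  have := UnitAt.one.add_vanishesAt h.neg
  rwa [neg_sub, add_sub_cancel] at this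

namespace SmoothCurve

variable {C : SmoothCurve}

/-- There is a function with prescribed order at one point that is a unit at another point. -/
theorem exists_ord_eq_of_ne {U : C.scheme.Opens} (hU : IsAffineOpen U) {x y : C.scheme} (hx : x ∈ U)
    (hy : y ∈ U) (hxc : IsClosed {x}) (hyc : IsClosed {y}) (hne : x ≠ y) (m : ℤ) :
    ∃ s : C.scheme.functionField, s ≠ 0 ∧ Scheme.ord s x = m ∧ Scheme.ord s y = 0 := by
  suffices h : ∃ s : C.scheme.functionField, s ≠ 0 ∧ Scheme.ord s x = 1 ∧ Scheme.ord s y = 0 by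
    obtain ⟨s, hs0, hsx, hsy⟩ := h
    refine ⟨s ^ m, zpow_ne_zero _ hs0, ?_, ?_⟩
    · rw [ord_zpow hs0, hsx, mul_one]
    · rw [ord_zpow hs0, hsy, mul_zero]
  obtain ⟨c, -, hcx, hcy⟩ := exists_separating hU hx hy hxc hyc hne
  obtain ⟨d, -, hdy, hdx⟩ := exists_separating hU hy hx hyc hxc hne.symm
  obtain ⟨u, hu0, hu⟩ := exists_ord_eq_one hxc
  have hcu := hcy.unitAt_of_one_sub
  have hdu := hdx.unitAt_of_one_sub
  have hc0 := hcu.ne_zero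
  have hd0 := hdu.ne_zero
  -- This exponent outweighs any pole of u at y, so that u · d^n vanishes there while keeping order
  -- 1 at x.
  let n := (Scheme.ord u y).natAbs + 1
  have hw0 : u * d ^ n ≠ 0 := mul_ne_zero hu0 (pow_ne_zero _ hd0)
  have hwx : Scheme.ord (u * d ^ n) x = 1 := by
    rw [Scheme.ord_mul hu0 (pow_ne_zero _ hd0), ord_pow hd0, hu, (unitAt_iff hd0).mp hdu, mul_zero,
      add_zero]
  have hwy : VanishesAt y (u * d ^ n) := by
    rw [vanishesAt_iff hw0, Scheme.ord_mul hu0 (pow_ne_zero _ hd0), ord_pow hd0]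
    have h1 := (vanishesAt_iff hd0).mp hdy
    have h2 : (n : ℤ) * 1 ≤ n * Scheme.ord d y := mul_le_mul_of_nonneg_left h1 (by positivity)
    have h3 : (n : ℤ) = |Scheme.ord u y| + 1 := by simp [n]
    have h4 := neg_abs_le (Scheme.ord u y)
    linarith
  -- In s = c² + u · d^n the first term dominates at y, where c is a unit. At x it has order at
  -- least 2, so the second term, of order 1, dominates.
  have hsy : UnitAt y (c ^ 2 + u * d ^ n) := (hcu.pow 2).add_vanishesAt hwy
  have hsx : UnitAt x (1 + c ^ 2 / (u * d ^ n)) := by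
    refine UnitAt.one.add_vanishesAt ?_
    rw [vanishesAt_iff (div_ne_zero (pow_ne_zero _ hc0) hw0), ord_div (pow_ne_zero _ hc0) hw0, hwx,
      ord_pow hc0]
    have h1 := (vanishesAt_iff hc0).mp hcx
    push_cast
    linarith
  have hs : c ^ 2 + u * d ^ n = (u * d ^ n) * (1 + c ^ 2 / (u * d ^ n)) := by
    field_simp
    ring
  refine ⟨_, hsy.ne_zero, ?_, (unitAt_iff hsy.ne_zero).mp hsy⟩
  rw [hs, Scheme.ord_mul hw0 hsx.ne_zero, hwx, (unitAt_iff hsx.ne_zero).mp hsx, add_zero]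

end SmoothCurve

/-! ### Fibres of π, descent of even invariant divisors, and the kernel of α. -/

namespace DoubleCover

open SmoothCurve

variable {C N : SmoothCurve} (cov : DoubleCover C N)

theorem isClosed_π_iff {x : C.scheme} : IsClosed {cov.π x} ↔ IsClosed {x} := by
  have := cov.isFinite
  constructor
  · intro h
    rw [C.isClosed_iff]
    rintro rfl
    rw [cov.π_genericPoint] at h
    exact N.not_isClosed_genericPoint h
  · intro h
    have := cov.π.isClosedMap _ h
    rwa [Set.image_singleton] at this

theorem exists_isAffineOpen_preimage (y : N.scheme) :
    ∃ U : C.scheme.Opens, IsAffineOpen U ∧ ∀ x, cov.π x = y → x ∈ U := by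
  have := cov.isFinite
  obtain ⟨V, hV, hy, -⟩ := exists_isAffineOpen_mem_and_subset (U := ⊤) (x := y) trivial
  refine ⟨cov.π ⁻¹ᵁ V, hV.preimage cov.π, fun x hx => ?_⟩
  change cov.π x ∈ V
  rwa [hx]

/-- The fibres of a double cover are the orbits of the involution. -/
theorem eq_or_eq_τ_of_π_eq {x z : C.scheme} (h : cov.π z = cov.π x) : z = x ∨ z = cov.τ x := by
  rcases C.eq_genericPoint_or_isClosed x with rfl | hx
  · left
    by_contra hz
    have := cov.isClosed_π_iff.mpr (C.isClosed_iff.mpr hz)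
    rw [h, cov.π_genericPoint] at this
    exact N.not_isClosed_genericPoint this
  have hz : IsClosed {z} := by rw [← cov.isClosed_π_iff, h, cov.isClosed_π_iff]; exact hx
  by_contra! hne
  obtain ⟨U, hU, hmem⟩ := cov.exists_isAffineOpen_preimage (cov.π x)
  have hxU := hmem x rfl
  have hzU := hmem z h
  have hτU := hmem (cov.τ x) (cov.π_τ x)
  obtain ⟨c, hc, hcz, hcx⟩ := exists_separating hU hzU hxU hz hx hne.1
  obtain ⟨d, hd, hdz, hdx⟩ := exists_separating hU hzU hτU hz (cov.isClosed_τ_iff.mpr hx) hne.2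
  -- This function vanishes at z and takes the value 1 at x and τ(x). Its norm a · τ(a) comes from a
  -- function b on N, which would vanish at π(z) but not at the same point π(x).
  let a := 1 - (1 - c) * (1 - d)
  have haz : VanishesAt z a := by
    have : a = c + d * (1 - c) := by ring
    rw [this]
    refine hcz.add (hdz.mul_regular ?_)
    rw [sub_eq_add_neg]
    exact UnitAt.one.regularAt.add hcz.regularAt.neg
  have hax : UnitAt x a := by
    refine VanishesAt.unitAt_of_one_sub ?_
    rw [sub_sub_cancel]
    refine hcx.mul_regular ?_
    rw [sub_eq_add_neg]
    exact UnitAt.one.regularAt.add (hd x hxU).neg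
  have haτ : UnitAt (cov.τ x) a := by
    refine VanishesAt.unitAt_of_one_sub ?_
    rw [sub_sub_cancel, mul_comm]
    refine hdx.mul_regular ?_
    rw [sub_eq_add_neg]
    exact UnitAt.one.regularAt.add (hc _ hτU).neg
  have ha0 := hax.ne_zero
  have hTa0 := cov.inv_ne_zero_iff.mpr ha0
  obtain ⟨b, hb⟩ := cov.exists_emb_eq (a := a * cov.inv a) (by rw [map_mul, inv_inv, mul_comm])
  obtain ⟨e, he, hex⟩ := exists_ord_funMap cov.π cov.π_genericPoint (cov.isClosed_π_iff.mpr hx)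
  obtain ⟨e', he', hez⟩ := exists_ord_funMap cov.π cov.π_genericPoint (cov.isClosed_π_iff.mpr hz)
  have h1 := hex b
  have h2 := hez b
  change Scheme.ord (cov.emb b) x = _ at h1
  change Scheme.ord (cov.emb b) z = _ at h2
  rw [hb, Scheme.ord_mul ha0 hTa0, cov.ord_inv, (unitAt_iff ha0).mp hax, (unitAt_iff ha0).mp haτ,
    add_zero, eq_comm, mul_eq_zero] at h1
  rw [h, h1.resolve_left he.ne', mul_zero, hb, Scheme.ord_mul ha0 hTa0, cov.ord_inv] at h2
  have h3 := (vanishesAt_iff ha0).mp haz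
  have h4 : RegularAt (cov.τ z) a := by
    have hU' := hmem (cov.τ z) ((cov.π_τ z).trans h)
    have hone : ∀ w : C.scheme, RegularAt w (1 : C.scheme.functionField) := fun w =>
      UnitAt.one.regularAt
    have : a = 1 + -((1 + -c) * (1 + -d)) := by ring
    rw [this]
    exact (hone _).add (((hone _).add (hc _ hU').neg).mul ((hone _).add (hd _ hU').neg)).neg
  have h5 := (regularAt_iff ha0).mp h4
  linarith

/-- The function t is the norm s · τ(s), whose order at x is the sum of those of s at x and τ(x). At
a fixed point s is a uniformizer to the power D(x)/2, which is where evenness is needed. Otherwise s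
has order D(x) at x and 0 at τ(x). The fibre is one orbit, so invariance gives its other points. -/
theorem exists_emb_ord_eq {D : C.scheme → ℤ} (hinv : ∀ x, D (cov.τ x) = D x)
    (hη : D (genericPoint C.scheme) = 0) (heven : ∀ x, IsClosed {x} → cov.τ x = x → Even (D x))
    (y : N.scheme) : ∃ t : N.scheme.functionField, t ≠ 0 ∧
      ∀ x, cov.π x = y → Scheme.ord (cov.emb t) x = D x := by
  obtain ⟨x, rfl⟩ := cov.π_surjective y
  have hfib : ∀ t, Scheme.ord (cov.emb t) x = D x →
      ∀ z, cov.π z = cov.π x → Scheme.ord (cov.emb t) z = D z := by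
    intro t ht z hz
    rcases cov.eq_or_eq_τ_of_π_eq hz with rfl | rfl
    · exact ht
    · rw [← cov.ord_inv, inv_emb, ht, hinv]
  suffices h : ∃ s : C.scheme.functionField, s ≠ 0 ∧
      Scheme.ord s x + Scheme.ord s (cov.τ x) = D x by
    obtain ⟨s, hs0, hs⟩ := h
    obtain ⟨t, ht⟩ := cov.exists_emb_eq (a := s * cov.inv s) (by rw [map_mul, inv_inv, mul_comm])
    have hTs0 := cov.inv_ne_zero_iff.mpr hs0
    refine ⟨t, fun h => mul_ne_zero hs0 hTs0 (by rw [← ht, h, map_zero]), hfib t ?_⟩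
    rw [ht, Scheme.ord_mul hs0 hTs0, cov.ord_inv, hs]
  rcases C.eq_genericPoint_or_isClosed x with rfl | hx
  · exact ⟨1, one_ne_zero, by simp [ord_one, hη]⟩
  by_cases hfix : cov.τ x = x
  · obtain ⟨m, hm⟩ := heven x hx hfix
    obtain ⟨u, hu0, hu⟩ := exists_ord_eq_one hx
    exact ⟨u ^ m, zpow_ne_zero _ hu0, by rw [hfix, ord_zpow hu0, hu, mul_one, hm]⟩
  · obtain ⟨U, hU, hmem⟩ := cov.exists_isAffineOpen_preimage (cov.π x)
    obtain ⟨s, hs0, hsx, hsy⟩ := exists_ord_eq_of_ne hU (hmem x rfl) (hmem _ (cov.π_τ x)) hx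
      (cov.isClosed_τ_iff.mpr hx) (Ne.symm hfix) (D x)
    exact ⟨s, hs0, by rw [hsx, hsy, add_zero]⟩

variable {n : ℕ} {p : Fin n → C.scheme}

theorem mem_range_pullback_of_isSignVector (hp : Set.range p = {x | IsClosed {x} ∧ cov.τ x = x})
    {c : Pic C.scheme} (hc : cov.IsSignVector p c 1) : c ∈ (Pic.pullback cov.π).range := by
  obtain ⟨L, ρ, rfl, hρ, hε⟩ := hc
  have hex := cov.exists_emb_ord_eq hρ (ord_genericPoint _) fun x hx hfix => by
    obtain ⟨i, rfl⟩ := hp.ge ⟨hx, hfix⟩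
    by_contra ho
    have := hε i
    rw [(Int.not_even_iff_odd.mp ho).neg_one_zpow] at this
    exact absurd (show (1 : ℤˣ) = -1 from this) (by decide)
  choose t ht0 ht using hex
  -- The functions t are local equations on N; their orders are nonzero only below the finite
  -- support of the divisor of ρ.
  obtain ⟨M, σ, hσ⟩ := exists_lineBundle_of_finite t ht0 (by
    refine ((finite_support_divisor ρ).image cov.π).subset fun y hy => ?_
    obtain ⟨x, rfl⟩ := cov.π_surjective y
    refine ⟨x, fun h0 => hy ?_, rfl⟩
    rcases C.eq_genericPoint_or_isClosed x with rfl | hx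
    · rw [cov.π_genericPoint, ord_genericPoint]
    obtain ⟨e, he, hex⟩ := exists_ord_funMap cov.π cov.π_genericPoint (cov.isClosed_π_iff.mpr hx)
    have h1 := (hex (t (cov.π x))).symm.trans ((ht (cov.π x) x rfl).trans h0)
    exact (mul_eq_zero.mp h1).resolve_left he.ne')
  refine ⟨Pic.mk M, ?_⟩
  change Pic.mk (M.pullback cov.π) = Pic.mk L
  refine mk_eq_of_ord (σ.pullback cov.π cov.π_genericPoint) ρ one_ne_zero fun x => ?_
  rw [ord_one, eq_comm, sub_eq_zero, ← ht (cov.π x) x rfl, ← hσ]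
  rfl

/-- Local equations pulled back from N are τ-invariant functions, so their order at each fixed point
is even. -/
theorem isSignVector_pullback (hp : ∀ i, IsClosed {p i} ∧ cov.τ (p i) = p i)
    (c : Pic N.scheme) :
    Pic.pullback cov.π c ∈ Pic.invariants cov.τ ∧ cov.IsSignVector p (Pic.pullback cov.π c) 1 := by
  obtain ⟨M, rfl⟩ : ∃ M, Pic.mk M = c := Quotient.exists_rep c
  let ρ := M.rationalSection.pullback cov.π cov.π_genericPoint
  have hdiv : ∀ x, ρ.divisor x = Scheme.ord (cov.emb (M.rationalSection.s (cov.π x))) x :=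
    fun _ => rfl
  have hρ : ∀ x, ρ.divisor (cov.τ x) = ρ.divisor x := fun x => by
    rw [hdiv, hdiv, cov.π_τ, ← cov.ord_inv, inv_emb]
  refine ⟨cov.mem_invariants_of_divisor ρ hρ, _, ρ, rfl, hρ, fun i => ?_⟩
  rw [hdiv, cov.parity_of_inv_eq hp ((map_ne_zero _).mpr (M.rationalSection.ne_zero _))
    (ε := 1) (by simp)]
  rfl

end DoubleCover

end InvariantLineBundles
end

/-! ### The main theorem. -/

open InvariantLineBundles in
theorem mainTheorem7 (C N : SmoothCurve) (cov : DoubleCover C N) (k : ℕ) (hk : 0 < k)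
    (p : Fin (2 * k) → C.scheme) (hp_inj : Function.Injective p)
    (hp : Set.range p = {x | IsClosed {x} ∧ cov.τ x = x}) :
    -- every invariant line bundle has a linearization, unique up to sign,
    -- which acts on the fibres at the fixed points by signs
    (∀ L : LineBundle C.scheme, Pic.mk L ∈ Pic.invariants cov.τ →
      Nonempty (Linearization cov.τ L)) ∧
    (∀ (L : LineBundle C.scheme) (φ ψ : Linearization cov.τ L),
      (φ.toIso.Same ψ.toIso ∨ φ.toIso.Same ψ.toIso.neg) ∧
      ∀ i, φ.fibreScalar (p i) = 1 ∨ φ.fibreScalar (p i) = -1) ∧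
    -- the resulting map `α` is a homomorphism
    ∃ α : Pic.invariants cov.τ →* SignQuotient (2 * k),
      (∀ (L : LineBundle C.scheme) (hL : Pic.mk L ∈ Pic.invariants cov.τ)
        (φ : Linearization cov.τ L) (ε : Fin (2 * k) → ℤˣ),
        (∀ i, φ.fibreScalar (p i) = ((ε i : ℤ) : C.scheme.residueField (p i))) →
          α ⟨Pic.mk L, hL⟩ = SignQuotient.mk ε) ∧
      Function.Surjective α ∧
      -- `d (α L) = (-1) ^ deg L`
      (∀ c : Pic.invariants cov.τ, (∃ n, (c : Pic C.scheme).HasDegree n) ∧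
        ∀ n, (c : Pic C.scheme).HasDegree n → SignQuotient.d k (α c) = (-1) ^ n) ∧
      -- the value of `α` on `𝒪(p_{i₁} + ⋯ + p_{iₗ})`
      (∀ S : Finset (Fin (2 * k)),
        (∃ c : Pic C.scheme, c.IsClassOfDivisor (∑ i ∈ S, pointDivisor (p i))) ∧
        ∀ c : Pic C.scheme, c.IsClassOfDivisor (∑ i ∈ S, pointDivisor (p i)) →
          ∃ hc : c ∈ Pic.invariants cov.τ,
            α ⟨c, hc⟩ = SignQuotient.mk (fun i => if i ∈ S then -1 else 1)) ∧
      -- `Ker α = π^* Pic N`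
      α.ker.map (Pic.invariants cov.τ).subtype = (Pic.pullback cov.π).range := by
  have hp' : ∀ i, IsClosed {p i} ∧ cov.τ (p i) = p i := fun i => hp.le ⟨i, rfl⟩
  refine ⟨fun L hL => cov.exists_linearization hL, fun L φ ψ => ⟨cov.linearization_unique φ ψ,
    cov.fibreScalar_eq_one_or hp' φ⟩, cov.signHom p hp', ?_, ?_, ?_, ?_, ?_⟩
  · intro L hL φ ε h
    exact cov.signHom_eq hp' hL (cov.isSignVector_of_fibreScalar hp' φ h)
  · intro q
    obtain ⟨ε, rfl⟩ : ∃ ε, SignQuotient.mk ε = q := QuotientGroup.mk_surjective q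
    -- A sign vector is attained by the sum of the points carrying the sign -1.
    let S : Finset (Fin (2 * k)) := {i | ε i = -1}
    obtain ⟨c, hc⟩ := SmoothCurve.exists_isClassOfDivisor (fun i => (hp' i).1) S
    obtain ⟨hinv, hsign⟩ := cov.isSignVector_of_isClassOfDivisor hp' hp_inj S hc
    refine ⟨⟨c, hinv⟩, (cov.signHom_eq hp' hinv hsign).trans (congrArg _ (funext fun i => ?_))⟩
    rcases Int.units_eq_one_or (ε i) with h | h <;> simp [S, h]
  · rintro ⟨c, hc⟩
    refine ⟨SmoothCurve.exists_hasDegree c, fun m hm => ?_⟩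
    obtain ⟨ε, hε⟩ := cov.exists_isSignVector (p := p) hc
    rw [cov.signHom_eq hp' hc hε]
    exact cov.prod_eq_neg_one_zpow_of_hasDegree hp_inj hp hε hm
  · intro S
    refine ⟨SmoothCurve.exists_isClassOfDivisor (fun i => (hp' i).1) S, fun c hc => ?_⟩
    obtain ⟨hinv, hsign⟩ := cov.isSignVector_of_isClassOfDivisor hp' hp_inj S hc
    exact ⟨hinv, cov.signHom_eq hp' hinv hsign⟩
  · ext c
    constructor
    · rintro ⟨⟨c, hc⟩, h, rfl⟩
      exact cov.mem_range_pullback_of_isSignVector hp ((cov.signHom_eq_one_iff hp' hc).mp h)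
    · rintro ⟨c, rfl⟩
      obtain ⟨hinv, hsign⟩ := cov.isSignVector_pullback hp' c
      exact ⟨⟨_, hinv⟩, (cov.signHom_eq_one_iff hp' hinv).mpr hsign, rfl⟩
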